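/- **Setting.** All logarithms are natural. A white Lévy noise $X$ with Lévy exponent $f$ is a random tempered distribution (a random continuous linear functional on $\mathcal S(\mathbb R)$) with $\mathbb E\,e^{\mathrm j\langle X,\varphi\rangle}=\exp\big(\int_{\mathbb R} f(\varphi(t))\,dt\big)$ for all $\varphi\in\mathcal S(\mathbb R)$, where $f$ has a Lévy–Khintchine representation whose Lévy measure $V$ satisfies $\int_{|a|>1}|a|^\theta\,dV(a)<\infty$ for some $\theta>0$. It is *stable* with parameters $(\alpha,\beta,\sigma,\mu)\in(0,2]\times[-1,1]\times(0,\infty)\times\mathbb R$ if $f(\omega)=\mathrm j\omega\mu-\sigma^\alpha|\omega|^\alpha\big(1-\mathrm j\beta\,\mathrm{sgn}(\omega)\Phi(\omega)\big)$, with $\Phi(\omega)=\tan\frac{\pi\alpha}{2}$ for $\alpha\ne1$ and $\Phi(\omega)=-\frac2\pi\log|\omega|$ for $\alpha=1$. It is *impulsive Poisson* with rate $\lambda>0$ and amplitude law $\nu$ (a probability measure on $\mathbb R$) if $f(\omega)=\lambda\int_{\mathbb R\setminus\{0\}}(e^{\mathrm ja\omega}-1)\,d\nu(a)$. For $n\ge1$,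 $i\in\mathbb Z$, let $X_i^{(n)}=\langle X,\mathbf 1_{[(i-1)/n,\,i/n)}\rangle$, the limit in probability of $\langle X,\psi_k\rangle$ for any uniformly bounded test functions $\psi_k$ that are supported in a common bounded interval and converge in $L^1$ to the indicator function. For real $m>0$ let $[x]_m=\frac1m\lfloor\frac12+mx\rfloor$. With $\mathrm H$ the discrete entropy and $\widetilde{\mathbf X}_i^{m,n}=\big([X^{(n)}_{n(i-1)+1}]_m,\dots,[X^{(n)}_{ni}]_m\big)$, put $$\mathcal H_{m,n}(X)=\lim_{T\to\infty}\frac{\mathrm H\big(\widetilde{\mathbf X}^{m,n}_{-T+1},\dots,\widetilde{\mathbf X}^{m,n}_{T}\big)}{2T}.$$ Let $\mathrm h$ be the differential entropy, $\mathrm h(p)=\int p\log\frac1p$, and let $m$ range over the positive reals. Call $a:\mathbb N\to(0,\infty)$ a *threshold* for $X$ if $$\lim_{n\to\infty}\ \sup_{m\ge a(n)}\Big|\frac{\mathcal H_{m,n}(X)}{\kappa(n)}-\log m-\zeta(n)\Big|=0,$$ where, for a stable noise, $\kappa(n)=n$ and $\zeta(n)=\mathrm h(X_1^{(n)})$, and,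 for an impulsive Poisson noise of rate $\lambda$ with absolutely continuous amplitude law, $\kappa(n)=n(1-e^{-\lambda/n})$ and $\zeta$ is some function with $c_1\log n\le\zeta(n)\le c_2\log n$ for all $n\ge1$ and some constants $0<c_1\le c_2<\infty$. **Theorem.** (i) Let $X_1,X_2$ be stable white noises with stability parameters $0<\alpha_1<\alpha_2\le2$ (and arbitrary other parameters). Then $X_1$ and $X_2$ have thresholds, and for all thresholds $m_1$ of $X_1$ and $m_2$ of $X_2$ and every function $m(n)\ge\max\{m_1(n),m_2(n)\}$, $$\limsup_{n\to\infty}\sup_{m\ge m(n)}\frac{\mathcal H_{m,n}(X_1)}{\mathcal H_{m,n}(X_2)}\le1,\qquad \lim_{n\to\infty}\sup_{m\ge m(n)}\big(\mathcal H_{m,n}(X_1)-\mathcal H_{m,n}(X_2)\big)=-\infty.$$ (ii) Let $X_1,X_2$ be impulsive Poisson white noises with rates $0<\lambda_1<\lambda_2$ and absolutely continuous amplitude laws with densities $p_1,p_2$, such that $\int p_i|\log p_i|<\infty$ and the entropy of the quantization with step $1$ of $\langle X_i,\mathbf 1_{[0,1)}\rangle$ is finite, $i=1,2$. Then $X_1$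 and $X_2$ have thresholds, and for all thresholds $m_1$ of $X_1$ and $m_2$ of $X_2$ and every function $m(n)\ge\max\{m_1(n),m_2(n)\}$, $$\lim_{n\to\infty}\sup_{m\ge m(n)}\frac{\mathcal H_{m,n}(X_1)}{\mathcal H_{m,n}(X_2)}=\frac{\lambda_1}{\lambda_2}<1,\qquad \lim_{n\to\infty}\sup_{m\ge m(n)}\big(\mathcal H_{m,n}(X_1)-\mathcal H_{m,n}(X_2)\big)=-\infty.$$ -/

import Mathlib

open MeasureTheory Filter Topology
open scoped SchwartzMap ENNReal

noncomputable section

namespace LevyNoise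

/-! ### Entropy and amplitude quantization -/

/-- Discrete entropy (natural logarithm) of a random element `Z` taking countably many values,
as an element of `[0, ∞]`. -/
def shannonEntropy {Ω S : Type*} [MeasurableSpace Ω] (P : Measure Ω) (Z : Ω → S) : ℝ≥0∞ :=
  ∑' s : S, ENNReal.ofReal (Real.negMulLog (P.real (Z ⁻¹' {s})))

/-- The Lebesgue density of an absolutely continuous law on the line. -/
def pdf (ν : Measure ℝ) (x : ℝ) : ℝ := (ν.rnDeriv volume x).toReal

/-- The differential entropy of an absolutely continuous law is well-defined:
`∫ p |log (1/p)| < ∞`. -/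
def HasDiffEntropy (ν : Measure ℝ) : Prop :=
  Integrable (fun x => Real.negMulLog (pdf ν x)) volume

/-- The differential entropy `∫ p log (1/p)` of a law with density `p`. -/
def diffEntropy (ν : Measure ℝ) : ℝ := ∫ x, Real.negMulLog (pdf ν x)

/-- Quantization with step size `1/m`. -/
def quantize (m x : ℝ) : ℝ := 1 / m * (⌊1 / 2 + m * x⌋ : ℝ)

/-! ### White Lévy noises -/

/-- `f` is the Lévy exponent with triplet `(μ, σ, V)`, where `V` is the Lévy measure. -/
structure HasLevyTriplet (f : ℝ → ℂ) (μ σ : ℝ) (V : Measure ℝ) : Prop where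
  zero : V {0} = 0
  lintegral_lt_top : ∫⁻ a, ENNReal.ofReal (min 1 (a ^ 2)) ∂V < ∞
  eq : ∀ w : ℝ, f w = -((σ ^ 2 / 2 * w ^ 2 : ℝ) : ℂ) + Complex.I * μ * w
    + ∫ a : ℝ, (Complex.exp (Complex.I * w * a) - 1
        - Complex.I * w * a * (Set.indicator (Set.Ioo (-1) 1) (fun _ => 1) a : ℝ)) ∂V

/-- `X` is a white Lévy noise with Lévy exponent `f`: a random tempered distribution
(measurable for the cylinder σ-algebra) with characteristic functional `exp (∫ f (φ t) dt)`,
where the Lévy measure of `f` has a finite tail moment of some positive order. -/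
structure IsWhiteLevyNoise {Ω : Type*} [MeasurableSpace Ω] (P : Measure Ω)
    (X : Ω → 𝓢(ℝ, ℝ) →L[ℝ] ℝ) (f : ℝ → ℂ) : Prop where
  measurable : ∀ φ : 𝓢(ℝ, ℝ), Measurable (fun ω => X ω φ)
  triplet : ∃ (μ σ : ℝ) (V : Measure ℝ), HasLevyTriplet f μ σ V ∧
    ∃ θ : ℝ, 0 < θ ∧ ∫⁻ a in (Set.Icc (-1 : ℝ) 1)ᶜ, ENNReal.ofReal (|a| ^ θ) ∂V < ∞
  charFunctional : ∀ φ : 𝓢(ℝ, ℝ),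
    ∫ ω, Complex.exp (Complex.I * (X ω φ : ℝ)) ∂P = Complex.exp (∫ t : ℝ, f (φ t))

/-- The function `Φ` in the exponent of a stable law. -/
def stablePhi (α w : ℝ) : ℝ :=
  if α = 1 then -(2 / Real.pi) * Real.log |w| else Real.tan (Real.pi * α / 2)

/-- The exponent of the stable law with stability `α`, skewness `β`, scale `σ`, shift `μ`. -/
def stableExponent (α β σ μ w : ℝ) : ℂ :=
  Complex.I * w * μ - ((σ ^ α * |w| ^ α : ℝ) : ℂ)
    * (1 - Complex.I * β * (Real.sign w : ℝ) * (stablePhi α w : ℝ))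

/-- `X` is a stable white noise with parameters `(α, β, σ, μ)`. -/
structure IsStableNoise {Ω : Type*} [MeasurableSpace Ω] (P : Measure Ω)
    (X : Ω → 𝓢(ℝ, ℝ) →L[ℝ] ℝ) (α β σ μ : ℝ) : Prop where
  stability : 0 < α ∧ α ≤ 2
  skewness : -1 ≤ β ∧ β ≤ 1
  scale : 0 < σ
  noise : IsWhiteLevyNoise P X (stableExponent α β σ μ)

/-- The Lévy exponent of an impulsive Poisson noise with rate `lam` and amplitude law `ν`. -/
def poissonExponent (lam : ℝ) (ν : Measure ℝ) (w : ℝ) : ℂ :=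
  lam * ∫ a in ({0} : Set ℝ)ᶜ, (Complex.exp (Complex.I * (a : ℝ) * w) - 1) ∂ν

/-- `X` is an impulsive Poisson white noise with rate `lam` and amplitude law `ν`. -/
structure IsPoissonNoise {Ω : Type*} [MeasurableSpace Ω] (P : Measure Ω)
    (X : Ω → 𝓢(ℝ, ℝ) →L[ℝ] ℝ) (lam : ℝ) (ν : Measure ℝ) : Prop where
  rate : 0 < lam
  prob : IsProbabilityMeasure ν
  noise : IsWhiteLevyNoise P X (poissonExponent lam ν)

/-! ### Time quantization and the quantization entropy -/

/-- `Y` is the random variable `⟨X, g⟩`, for a bounded, compactly supported, possibly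
discontinuous `g`: the limit in probability of `⟨X, ψ k⟩` along test functions `ψ k` that
converge to `g` in `L¹` and are uniformly bounded with supports in a common bounded interval.
For a white Lévy noise, `Y` exists and is almost surely unique. -/
def IsPairing {Ω : Type*} [MeasurableSpace Ω] (P : Measure Ω)
    (X : Ω → 𝓢(ℝ, ℝ) →L[ℝ] ℝ) (g : ℝ → ℝ) (Y : Ω → ℝ) : Prop :=
  Measurable Y ∧ ∀ ψ : ℕ → 𝓢(ℝ, ℝ),
    (∃ C R : ℝ, ∀ k t, |ψ k t| ≤ C ∧ (R < |t| → ψ k t = 0)) →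
    Tendsto (fun k => ∫ t, |ψ k t - g t|) atTop (𝓝 0) →
    TendstoInMeasure P (fun k ω => X ω (ψ k)) atTop Y

open Classical in
/-- The random variable `⟨X, g⟩` (zero if it does not exist). -/
def pairing {Ω : Type*} [MeasurableSpace Ω] (P : Measure Ω)
    (X : Ω → 𝓢(ℝ, ℝ) →L[ℝ] ℝ) (g : ℝ → ℝ) : Ω → ℝ :=
  if h : ∃ Y, IsPairing P X g Y then h.choose else 0

/-- The rectangular pulse, the indicator function of `[0, 1)`. -/
def pulse : ℝ → ℝ := Set.indicator (Set.Ico 0 1) (fun _ => 1)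

/-- The time quantization `X_i^{(n)} = ⟨X, φ(n t - i + 1)⟩`, the integral of `X` over
`[(i-1)/n, i/n)`. -/
def timeQuant {Ω : Type*} [MeasurableSpace Ω] (P : Measure Ω)
    (X : Ω → 𝓢(ℝ, ℝ) →L[ℝ] ℝ) (n : ℕ) (i : ℤ) : Ω → ℝ :=
  pairing P X (fun t => pulse (n * t - i + 1))

/-- The vector of the `n` quantized samples of `X` over the unit interval `[i-1, i)`. -/
def quantBlock {Ω : Type*} [MeasurableSpace Ω] (P : Measure Ω)
    (X : Ω → 𝓢(ℝ, ℝ) →L[ℝ] ℝ) (m : ℝ) (n : ℕ) (i : ℤ) (ω : Ω) : Fin n → ℝ :=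
  fun j => quantize m (timeQuant P X n (n * (i - 1) + (j : ℕ) + 1) ω)

/-- The quantization entropy `𝓗_{m,n}(X)`: the limit, as `T → ∞`, of the joint entropy of the
`2T` blocks with indices `-T+1, …, T`, divided by `2T`. -/
def quantEntropy {Ω : Type*} [MeasurableSpace Ω] (P : Measure Ω)
    (X : Ω → 𝓢(ℝ, ℝ) →L[ℝ] ℝ) (m : ℝ) (n : ℕ) : ℝ≥0∞ :=
  limUnder atTop (fun T : ℕ =>
    shannonEntropy P (fun ω (i : Finset.Ioc (-(T : ℤ)) (T : ℤ)) => quantBlock P X m n i ω)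
      / (2 * (T : ℝ≥0∞)))

/-! ### The threshold functions `m(n)` -/

/-- `lim_{n → ∞} sup_{m ≥ a(n)} |𝓗_{m,n}(X) / κ(n) - log m - ζ(n)| = 0`. -/
def HasExpansion {Ω : Type*} [MeasurableSpace Ω] (P : Measure Ω)
    (X : Ω → 𝓢(ℝ, ℝ) →L[ℝ] ℝ) (κ ζ : ℕ → ℝ) (a : ℕ → ℝ) : Prop :=
  Tendsto (fun n => ⨆ m ∈ Set.Ici (a n),
    ((quantEntropy P X m n : EReal) / (κ n : EReal) - ((Real.log m + ζ n : ℝ) : EReal)).abs)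
    atTop (𝓝 0)

/-- `a` is a threshold function for a noise `X` with continuous `X_0`:
the expansion holds for `m ≥ a(n)` with `κ(n) = n` and `ζ(n) = h(X_1^{(n)})`. -/
def IsContinuousThreshold {Ω : Type*} [MeasurableSpace Ω] (P : Measure Ω)
    (X : Ω → 𝓢(ℝ, ℝ) →L[ℝ] ℝ) (a : ℕ → ℝ) : Prop :=
  (∀ n, 0 < a n) ∧
  HasExpansion P X (fun n => n) (fun n => diffEntropy (P.map (timeQuant P X n 1))) a

/-- `a` is a threshold function for an impulsive Poisson noise `X` with rate `lam` and absolutely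
continuous amplitudes: the expansion holds for `m ≥ a(n)` with `κ(n) = n (1 - exp (-lam / n))`
and some `ζ(n)` lying between two positive multiples of `log n`. -/
def IsPoissonThreshold {Ω : Type*} [MeasurableSpace Ω] (P : Measure Ω)
    (X : Ω → 𝓢(ℝ, ℝ) →L[ℝ] ℝ) (lam : ℝ) (a : ℕ → ℝ) : Prop :=
  (∀ n, 0 < a n) ∧
  ∃ ζ : ℕ → ℝ,
    (∃ c₁ c₂ : ℝ, 0 < c₁ ∧ c₁ ≤ c₂ ∧
      ∀ n : ℕ, 1 ≤ n → c₁ * Real.log n ≤ ζ n ∧ ζ n ≤ c₂ * Real.log n) ∧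
    HasExpansion P X (fun n => n * (1 - Real.exp (-lam / n))) ζ a

end LevyNoise

end

namespace LevyNoise

/-! ### Continuity of the characteristic functional -/

/-! Everything reduces to the law of one sample. The windows `[(i-1)/n, i/n)` are disjoint and the
exponent satisfies `f 0 = 0`, so the joint characteristic function of the samples is a product of
factors `exp (f u / n)`. The samples are therefore independent with a common law, and the
quantization entropy equals `n` times the entropy of one quantized sample
(`IsWhiteLevyNoise.quantEntropy_eq`).

For an absolutely continuous law `μ` of finite differential entropy, Rényi's theorem says that the
entropy of the quantization is `log m + h(μ) + o(1)` as `m → ∞`. It is proved against a reference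
density `b` whose logarithm is Lipschitz and `μ`-integrable. Jensen's inequality on the cells bounds
the entropy below; Fatou's lemma for the nonnegative gap in Gibbs' inequality bounds it above
(`IsReference.tendsto_shannonEntropy`).

Stable case. The characteristic function is integrable, so the density is bounded. It is Hölder at
the origin, so there is a logarithmic moment and `b = 1/(1+x²)` serves. A sample has the law of
`n^(-1/α) Y + s`, with `Y` the sample over a unit interval, so its differential entropy is `c -
(1/α) log n`. Above both thresholds `log m` cancels, and the difference of the entropies is at most
`n (O(1) - (1/α₁ - 1/α₂) log n)`.

Poisson case. With `s = λ/n` and `p = 1 - exp (-s)`, a sample has law `(1-p) δ₀ + p Q`, where `Q` is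
the law conditioned on at least one jump. Dividing its quantization entropy by `p` gives `log m -
log p + h(Q) + O(1)` for large `m`, and `-log p = log n + O(1)`. The key point is that `h(Q)` is
bounded uniformly in `n` (`exists_bound_jumpLaw`). Hence the quantization entropy is `κ(n) (log m +
log n + O(1))` above any threshold, with `κ(n) → λ`. A threshold must also stay eventually above a
fixed `m₀`: at `m₀` the atom and the central cell merge, which costs a fixed fraction of `log n`. So
`log m + log n → ∞` uniformly in `m`, and the rates decide both limits. -/

lemma exists_modulus {f : ℝ → ℂ} (hf : Continuous f) (C : ℝ) {ε : ℝ} (hε : 0 < ε) :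
    ∃ K : ℝ, 0 ≤ K ∧ ∀ x y : ℝ, |x| ≤ C → |y| ≤ C → ‖f x - f y‖ ≤ ε + K * |x - y| := by
  have hc : IsCompact (Set.Icc (-C) C) := isCompact_Icc
  have hu := hc.uniformContinuousOn_of_continuous hf.continuousOn
  rw [Metric.uniformContinuousOn_iff] at hu
  obtain ⟨δ, hδ, hu⟩ := hu ε hε
  obtain ⟨M, hM⟩ := hc.exists_bound_of_continuousOn hf.continuousOn
  -- Beyond the modulus `δ` the crude bound `2|M|` is at most `(2|M|/δ) |x - y|`. This affine form
  -- survives integration and turns `L¹` closeness into closeness of exponents.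
  refine ⟨2 * |M| / δ, by positivity, fun x y hx hy => ?_⟩
  rw [abs_le] at hx hy
  by_cases h : |x - y| < δ
  · have := hu x hx y hy (by simpa [Real.dist_eq] using h)
    rw [dist_eq_norm] at this
    have : 0 ≤ 2 * |M| / δ * |x - y| := by positivity
    linarith
  · push Not at h
    have h1 : ‖f x - f y‖ ≤ 2 * |M| := by
      have := norm_sub_le (f x) (f y)
      have := hM x hx
      have := hM y hy
      have := le_abs_self M
      linarith
    have h2 : 2 * |M| ≤ 2 * |M| / δ * |x - y| := by
      rw [div_mul_eq_mul_div, le_div_iff₀ hδ]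
      gcongr
    linarith

lemma integrable_of_bounded_support {E : Type*} [NormedAddCommGroup E] {g : ℝ → E} {C R : ℝ}
    (hm : AEStronglyMeasurable g volume) (hb : ∀ t, ‖g t‖ ≤ C) (hs : ∀ t, R < |t| → g t = 0) :
    Integrable g := by
  have : IntegrableOn g (Set.Icc (-R) R) :=
    Measure.integrableOn_of_bounded (M := C) (by simp) hm (by filter_upwards with t using hb t)
  rwa [integrableOn_iff_integrable_of_support_subset] at this
  intro t ht
  by_contra h
  refine ht (hs t ?_)
  by_contra h'
  exact h (abs_le.1 (not_lt.1 h'))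

lemma exists_integral_comp_bound {f : ℝ → ℂ} (hf : Continuous f) (hf0 : f 0 = 0) (C R : ℝ)
    {ε : ℝ} (hε : 0 < ε) :
    ∃ K : ℝ, 0 ≤ K ∧ ∀ ψ g : ℝ → ℝ, Measurable ψ → Measurable g →
      (∀ t, |ψ t| ≤ C ∧ (R < |t| → ψ t = 0)) → (∀ t, |g t| ≤ C ∧ (R < |t| → g t = 0)) →
      ‖(∫ t, f (ψ t)) - ∫ t, f (g t)‖ ≤ ε + K * ∫ t, |ψ t - g t| := by
  -- The error `ε` is spread over an interval of length `2|R|`; the added `1` keeps the divisor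
  -- positive.
  set V : ℝ := 2 * |R| + 1 with hV
  have hVpos : 0 < V := by positivity
  obtain ⟨K, hK0, hK⟩ := exists_modulus hf C (div_pos hε hVpos)
  obtain ⟨M, hM⟩ := (isCompact_Icc (a := -C) (b := C)).exists_bound_of_continuousOn
    hf.continuousOn
  refine ⟨K, hK0, fun ψ g hψm hgm hψ hg => ?_⟩
  have hint : ∀ φ : ℝ → ℝ, Measurable φ → (∀ t, |φ t| ≤ C ∧ (R < |t| → φ t = 0)) →
      Integrable (fun t => f (φ t)) := fun φ hm h =>
    integrable_of_bounded_support (C := M) (R := R) (hf.measurable.comp hm).aestronglyMeasurable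
      (fun t => hM _ (abs_le.1 (h t).1)) (fun t ht => by simp [(h t).2 ht, hf0])
  have hintr : ∀ φ : ℝ → ℝ, Measurable φ → (∀ t, |φ t| ≤ C ∧ (R < |t| → φ t = 0)) →
      Integrable φ := fun φ hm h =>
    integrable_of_bounded_support (C := C) (R := R) hm.aestronglyMeasurable
      (fun t => (h t).1) (fun t ht => (h t).2 ht)
  have hd : Integrable (fun t => |ψ t - g t|) := ((hintr ψ hψm hψ).sub (hintr g hgm hg)).abs
  rw [← integral_sub (hint ψ hψm hψ) (hint g hgm hg)]
  have hi : IntegrableOn (fun _ : ℝ => ε / V) (Set.Icc (-|R|) |R|) := by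
    simp
  have hi' : Integrable ((Set.Icc (-|R|) |R|).indicator (fun _ : ℝ => ε / V)) :=
    hi.integrable_indicator measurableSet_Icc
  calc ‖∫ t, (f (ψ t) - f (g t))‖
      ≤ ∫ t, ((Set.Icc (-|R|) |R|).indicator (fun _ : ℝ => ε / V) t + K * |ψ t - g t|) := by
        refine norm_integral_le_of_norm_le (hi'.add (hd.const_mul K)) ?_
        filter_upwards with t
        by_cases ht : t ∈ Set.Icc (-|R|) |R|
        · rw [Set.indicator_of_mem ht]
          exact hK _ _ (hψ t).1 (hg t).1
        · have ht' : R < |t| := by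
            by_contra h
            exact ht (abs_le.1 ((not_lt.1 h).trans (le_abs_self R)))
          rw [Set.indicator_of_notMem ht, (hψ t).2 ht', (hg t).2 ht']
          simp
    _ = ε / V * (2 * |R|) + K * ∫ t, |ψ t - g t| := by
        rw [integral_add hi' (hd.const_mul K), integral_const_mul,
          integral_indicator measurableSet_Icc]
        congr 1
        simp
        ring_nf
    _ ≤ ε + K * ∫ t, |ψ t - g t| := by
        gcongr
        rw [div_mul_eq_mul_div, div_le_iff₀ hVpos]
        gcongr
        linarith

/-- A sequence of test functions that approximates `g` in the sense of `IsPairing`. -/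
def Approximates (ψ : ℕ → 𝓢(ℝ, ℝ)) (g : ℝ → ℝ) : Prop :=
  (∃ C R : ℝ, ∀ k t, |ψ k t| ≤ C ∧ (R < |t| → ψ k t = 0)) ∧
    Tendsto (fun k => ∫ t, |ψ k t - g t|) atTop (𝓝 0)

lemma Approximates.comp {ψ : ℕ → 𝓢(ℝ, ℝ)} {g : ℝ → ℝ} (h : Approximates ψ g) {ns : ℕ → ℕ}
    (hn : Tendsto ns atTop atTop) : Approximates (fun k => ψ (ns k)) g := by
  obtain ⟨⟨C, R, h1⟩, h2⟩ := h
  exact ⟨⟨C, R, fun k t => h1 (ns k) t⟩, h2.comp hn⟩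

lemma integrable_testFunction (φ : 𝓢(ℝ, ℝ)) : Integrable (fun t => φ t) := φ.integrable

lemma measurable_testFunction (φ : 𝓢(ℝ, ℝ)) : Measurable (fun t => φ t) :=
  φ.continuous.measurable

/-! ### Extension of the noise to discontinuous functions by continuity in probability. -/

section

set_option linter.unusedSectionVars false

variable {Ω : Type*} [MeasurableSpace Ω] {P : Measure Ω} [IsProbabilityMeasure P]
  {X : Ω → 𝓢(ℝ, ℝ) →L[ℝ] ℝ} {f : ℝ → ℂ}

lemma IsWhiteLevyNoise.charFun_eq (hX : IsWhiteLevyNoise P X f) (φ : 𝓢(ℝ, ℝ)) (u : ℝ) :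
    charFun (P.map (fun ω => X ω φ)) u = Complex.exp (∫ t, f (u * φ t)) := by
  rw [charFun_apply_real, integral_map (hX.measurable φ).aemeasurable
    (by fun_prop)]
  have h := hX.charFunctional (u • φ)
  simp only [map_smul, smul_apply, smul_eq_mul] at h
  rw [← h]
  refine integral_congr_ae ?_
  filter_upwards with ω
  congr 1
  push_cast
  ring

/-- The tail beyond `r` is controlled by the integral of `1 - charFun` over `|u| ≤ 2/r`. There the
exponent is small by comparison with the zero test function. -/
lemma IsWhiteLevyNoise.small_in_prob (hX : IsWhiteLevyNoise P X f) (hf : Continuous f)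
    (hf0 : f 0 = 0) (C R : ℝ) {r ε : ℝ} (hr : 0 < r) (hε : 0 < ε) :
    ∃ δ > 0, ∀ φ : 𝓢(ℝ, ℝ), (∀ t, |φ t| ≤ C ∧ (R < |t| → φ t = 0)) → ∫ t, |φ t| < δ →
      P.real {ω | r < |X ω φ|} ≤ ε := by
  -- The bound `1/2` keeps the exponent in the unit disc, where `|exp z - 1| ≤ 2|z|`. The bound
  -- `ε/8` absorbs the factor `(r/2) · 4 · (4/r) = 8` at the end.
  set η : ℝ := min (1 / 2) (ε / 8) with hη
  have hη0 : 0 < η := by positivity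
  obtain ⟨K, hK0, hK⟩ := exists_integral_comp_bound hf hf0 (2 * r⁻¹ * C) R hη0
  refine ⟨η / (K * (2 * r⁻¹) + 1), by positivity, fun φ hφ hδ => ?_⟩
  have : IsProbabilityMeasure (P.map (fun ω => X ω φ)) :=
    Measure.isProbabilityMeasure_map (hX.measurable φ).aemeasurable
  have hb := measureReal_abs_gt_le_integral_charFun (μ := P.map (fun ω => X ω φ)) hr
  rw [map_measureReal_apply (hX.measurable φ)
    (measurableSet_lt measurable_const (by fun_prop))] at hb
  refine hb.trans ?_
  have hI0 : 0 ≤ ∫ t, |φ t| := integral_nonneg fun t => abs_nonneg _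
  have key : ∀ u ∈ Set.uIoc (-2 * r⁻¹) (2 * r⁻¹),
      ‖1 - charFun (P.map (fun ω => X ω φ)) u‖ ≤ 2 * (2 * η) := by
    intro u hu
    rw [Set.uIoc_of_le (by have : 0 < r⁻¹ := by positivity
                           linarith)] at hu
    have hu' : |u| ≤ 2 * r⁻¹ := abs_le.2 ⟨by linarith [hu.1], hu.2⟩
    have hC : 0 ≤ C := (abs_nonneg _).trans (hφ 0).1
    have h1 := hK (fun t => u * φ t) (fun _ => 0) (by have := measurable_testFunction φ; fun_prop)
      measurable_const
      (fun t => ⟨by rw [abs_mul]; exact mul_le_mul hu' (hφ t).1 (abs_nonneg _) (by positivity),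
        fun ht => by simp [(hφ t).2 ht]⟩)
      (fun t => ⟨by simp; positivity, fun _ => rfl⟩)
    simp only [hf0, integral_zero, sub_zero, abs_mul, integral_const_mul] at h1
    have h2 : K * (|u| * ∫ t, |φ t|) ≤ η := by
      have h4 : (K * (2 * r⁻¹) + 1) * ∫ t, |φ t| ≤ η := by
        have := (lt_div_iff₀ (show 0 < K * (2 * r⁻¹) + 1 by positivity)).1 hδ
        linarith
      have h3 : K * (|u| * ∫ t, |φ t|) ≤ K * (2 * r⁻¹ * ∫ t, |φ t|) := by gcongr
      nlinarith
    have h3 : ‖∫ t, f (u * φ t)‖ ≤ 2 * η := by linarith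
    have hη1 : η ≤ 1 / 2 := min_le_left _ _
    rw [hX.charFun_eq, norm_sub_rev]
    exact (Complex.norm_exp_sub_one_le (by linarith)).trans (by gcongr)
  have h5 := intervalIntegral.norm_integral_le_of_norm_le_const key
  have hη2 : η ≤ ε / 8 := min_le_right _ _
  have hri : 0 < r⁻¹ := by positivity
  rw [abs_of_pos (by linarith)] at h5
  calc 2⁻¹ * r * _ ≤ 2⁻¹ * r * (2 * (2 * η) * (2 * r⁻¹ - -2 * r⁻¹)) := by gcongr
    _ = 8 * η := by field_simp; ring
    _ ≤ ε := by linarith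

lemma IsWhiteLevyNoise.exists_close (hX : IsWhiteLevyNoise P X f) (hf : Continuous f)
    (hf0 : f 0 = 0) {g : ℝ → ℝ} (hg : Integrable g) (C R : ℝ) {r ε : ℝ} (hr : 0 < r)
    (hε : 0 < ε) :
    ∃ δ > 0, ∀ φ ψ : 𝓢(ℝ, ℝ), (∀ t, |φ t| ≤ C ∧ (R < |t| → φ t = 0)) →
      (∀ t, |ψ t| ≤ C ∧ (R < |t| → ψ t = 0)) →
      ∫ t, |φ t - g t| < δ → ∫ t, |ψ t - g t| < δ →
      P.real {ω | r < |X ω φ - X ω ψ|} ≤ ε := by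
  obtain ⟨δ, hδ, h⟩ := hX.small_in_prob hf hf0 (2 * C) R hr hε
  refine ⟨δ / 2, by positivity, fun φ ψ hφ hψ h1 h2 => ?_⟩
  have := h (φ - ψ) (fun t => ⟨?_, fun ht => ?_⟩) ?_
  · simpa using this
  · rw [sub_apply]
    have := abs_sub (φ t) (ψ t)
    linarith [(hφ t).1, (hψ t).1]
  · simp [(hφ t).2 ht, (hψ t).2 ht]
  · calc ∫ t, |(φ - ψ) t| ≤ ∫ t, (|φ t - g t| + |ψ t - g t|) := by
          refine integral_mono (integrable_testFunction _).abs
            (((integrable_testFunction _).sub hg).abs.add ((integrable_testFunction _).sub hg).abs)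
            fun t => ?_
          rw [sub_apply]
          have := abs_sub_le (φ t) (g t) (ψ t)
          rwa [abs_sub_comm (g t)] at this
      _ = (∫ t, |φ t - g t|) + ∫ t, |ψ t - g t| :=
          integral_add ((integrable_testFunction _).sub hg).abs
            ((integrable_testFunction _).sub hg).abs
      _ < δ := by linarith

/-- Existence of the pairing of a white noise with an integrable function that can be
approximated by test functions. -/
theorem IsWhiteLevyNoise.exists_isPairing (hX : IsWhiteLevyNoise P X f) (hf : Continuous f)
    (hf0 : f 0 = 0) {g : ℝ → ℝ} (hg : Integrable g) {ψ : ℕ → 𝓢(ℝ, ℝ)} (hψ : Approximates ψ g) :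
    ∃ Y, IsPairing P X g Y := by
  obtain ⟨⟨C, R, hCR⟩, hlim⟩ := id hψ
  have hstep : ∀ k : ℕ, ∃ N : ℕ, ∀ i j, N ≤ i → N ≤ j →
      P.real {ω | (1 / 2 : ℝ) ^ k < |X ω (ψ i) - X ω (ψ j)|} ≤ (1 / 2 : ℝ) ^ k := by
    intro k
    obtain ⟨δ, hδ, h⟩ := hX.exists_close hf hf0 hg C R
      (show (0 : ℝ) < (1 / 2) ^ k by positivity) (show (0 : ℝ) < (1 / 2) ^ k by positivity)
    obtain ⟨N, hN⟩ := (eventually_atTop.1 (hlim.eventually_lt_const hδ))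
    exact ⟨N, fun i j hi hj => h _ _ (hCR i) (hCR j) (hN i hi) (hN j hj)⟩
  choose N hN using hstep
  -- Adding up the `N i` makes `ns` monotone and at least `N k`; the summand `k` forces it to
  -- infinity.
  let ns : ℕ → ℕ := fun k => k + ∑ i ∈ Finset.range (k + 1), N i
  have hns : ∀ k, N k ≤ ns k := fun k =>
    (Finset.single_le_sum (f := N) (fun _ _ => Nat.zero_le _) (Finset.self_mem_range_succ k)).trans
      (Nat.le_add_left _ _)
  have hns1 : ∀ k, ns k ≤ ns (k + 1) := fun k => by
    simp only [ns]
    rw [Finset.sum_range_succ _ (k + 1)]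
    omega
  have hnst : Tendsto ns atTop atTop :=
    tendsto_atTop_mono (fun k => Nat.le_add_right k _) tendsto_id
  -- By Borel–Cantelli the increments along `ns` are almost surely eventually below a geometric
  -- sequence, so the subsequence converges almost surely.
  have hBC : ∀ᵐ ω ∂P, ∀ᶠ k in atTop,
      ω ∉ {ω | (1 / 2 : ℝ) ^ k < |X ω (ψ (ns k)) - X ω (ψ (ns (k + 1)))|} := by
    apply ae_eventually_notMem
    have : ∀ k, P {ω | (1 / 2 : ℝ) ^ k < |X ω (ψ (ns k)) - X ω (ψ (ns (k + 1)))|}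
        ≤ ENNReal.ofReal ((1 / 2 : ℝ) ^ k) := fun k => by
      have := hN k (ns k) (ns (k + 1)) (hns k) ((hns k).trans (hns1 k))
      rw [measureReal_def] at this
      exact (ENNReal.le_ofReal_iff_toReal_le (measure_ne_top _ _) (by positivity)).2 this
    refine ne_top_of_le_ne_top ?_ (ENNReal.tsum_le_tsum this)
    rw [← ENNReal.ofReal_tsum_of_nonneg (fun _ => by positivity) summable_geometric_two]
    exact ENNReal.ofReal_ne_top
  have hae : ∀ᵐ ω ∂P, ∃ l : ℝ, Tendsto (fun k => X ω (ψ (ns k))) atTop (𝓝 l) := by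
    filter_upwards [hBC] with ω hω
    apply cauchySeq_tendsto_of_complete
    obtain ⟨k₀, hk₀⟩ := eventually_atTop.1 hω
    rw [← cauchySeq_shift k₀]
    refine cauchySeq_of_le_geometric (1 / 2) ((1 / 2) ^ k₀) (by norm_num) fun k => ?_
    have := hk₀ (k + k₀) (Nat.le_add_left _ _)
    simp only [not_lt] at this
    rw [Real.dist_eq, show k + 1 + k₀ = k + k₀ + 1 by ring]
    exact this.trans (by rw [pow_add, mul_comm])
  obtain ⟨Y, hYm, hY⟩ := measurable_limit_of_tendsto_metrizable_ae
    (fun k => (hX.measurable (ψ (ns k))).aemeasurable) hae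
  have hYin : TendstoInMeasure P (fun k ω => X ω (ψ (ns k))) atTop Y :=
    tendstoInMeasure_of_tendsto_ae
      (fun k => (hX.measurable (ψ (ns k))).aestronglyMeasurable) hY
  -- The limit does not depend on the approximating sequence: `χ` and the chosen subsequence are
  -- both `L¹`-close to `g` under common bounds, so `exists_close` applies to the pair.
  refine ⟨Y, hYm, fun χ hχ1 hχ2 => ?_⟩
  obtain ⟨C', R', hCR'⟩ := hχ1
  rw [tendstoInMeasure_iff_measureReal_dist] at hYin ⊢
  intro ε hε
  have hY2 := hYin (ε / 2) (by positivity)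
  rw [Metric.tendsto_atTop]
  intro η hη
  obtain ⟨δ, hδ, h⟩ := hX.exists_close hf hf0 hg (max C C') (max R R')
      (show (0 : ℝ) < ε / 4 by positivity) (show (0 : ℝ) < η / 4 by positivity)
  have e1 := (hlim.comp hnst).eventually_lt_const hδ
  have e2 := hχ2.eventually_lt_const hδ
  have e3 := hY2.eventually_lt_const (show 0 < η / 4 by positivity)
  obtain ⟨K, hK⟩ := eventually_atTop.1 (e1.and (e2.and e3))
  refine ⟨K, fun k hk => ?_⟩
  obtain ⟨b1, b2, b3⟩ := hK k hk
  have h4 := h (χ k) (ψ (ns k))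
    (fun t => ⟨(hCR' k t).1.trans (le_max_right _ _),
      fun ht => (hCR' k t).2 ((le_max_right _ _).trans_lt ht)⟩)
    (fun t => ⟨(hCR (ns k) t).1.trans (le_max_left _ _),
      fun ht => (hCR (ns k) t).2 ((le_max_left _ _).trans_lt ht)⟩) b2 b1
  rw [Real.dist_eq, sub_zero, abs_of_nonneg measureReal_nonneg]
  calc P.real {ω | ε ≤ dist (X ω (χ k)) (Y ω)}
      ≤ P.real ({ω | ε / 4 < |X ω (χ k) - X ω (ψ (ns k))|} ∪
          {ω | ε / 2 ≤ dist (X ω (ψ (ns k))) (Y ω)}) := by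
        refine measureReal_mono fun ω hω => ?_
        simp only [Set.mem_ofPred_eq, Set.mem_union] at hω ⊢
        by_contra hcon
        push Not at hcon
        have := dist_triangle (X ω (χ k)) (X ω (ψ (ns k))) (Y ω)
        rw [Real.dist_eq (X ω (χ k)) (X ω (ψ (ns k)))] at this
        linarith [hcon.1, hcon.2]
    _ ≤ η / 4 + η / 4 := (measureReal_union_le _ _).trans (add_le_add h4 b3.le)
    _ < η := by linarith

lemma IsPairing.exists_ae_tendsto {g : ℝ → ℝ} {Y : Ω → ℝ} (hY : IsPairing P X g Y)
    {ψ : ℕ → 𝓢(ℝ, ℝ)} (hψ : Approximates ψ g) :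
    ∃ χ : ℕ → 𝓢(ℝ, ℝ), Approximates χ g ∧
      ∀ᵐ ω ∂P, Tendsto (fun k => X ω (χ k)) atTop (𝓝 (Y ω)) := by
  obtain ⟨ns, hns, h⟩ := (hY.2 ψ hψ.1 hψ.2).exists_seq_tendsto_ae
  exact ⟨fun k => ψ (ns k), hψ.comp hns.tendsto_atTop, h⟩

lemma pairing_spec {g : ℝ → ℝ} (h : ∃ Y, IsPairing P X g Y) : IsPairing P X g (pairing P X g) := by
  rw [pairing, dif_pos h]
  exact h.choose_spec

/-- The joint characteristic function of finitely many pairings. -/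
theorem IsWhiteLevyNoise.integral_exp_sum_pairing (hX : IsWhiteLevyNoise P X f)
    (hf : Continuous f) (hf0 : f 0 = 0) {ι : Type*} [Fintype ι] {g : ι → ℝ → ℝ} {Y : ι → Ω → ℝ}
    {C R : ℝ} (hgm : ∀ i, Measurable (g i)) (hgb : ∀ i t, |g i t| ≤ C ∧ (R < |t| → g i t = 0))
    (hY : ∀ i, IsPairing P X (g i) (Y i)) (hψ : ∀ i, ∃ ψ, Approximates ψ (g i)) (u : ι → ℝ) :
    ∫ ω, Complex.exp (Complex.I * (∑ i, u i * Y i ω : ℝ)) ∂P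
      = Complex.exp (∫ t, f (∑ i, u i * g i t)) := by
  choose ψ₀ hψ₀ using hψ
  -- Passing to subsequences gives almost sure convergence, as needed for dominated convergence on
  -- the left-hand side.
  choose ψ hψ hae using fun i => (hY i).exists_ae_tendsto (hψ₀ i)
  choose C' R' hCR using fun i => (hψ i).1
  have L1 : Tendsto (fun k => ∫ ω, Complex.exp (Complex.I * (X ω (∑ i, u i • ψ i k) : ℝ)) ∂P)
      atTop (𝓝 (∫ ω, Complex.exp (Complex.I * (∑ i, u i * Y i ω : ℝ)) ∂P)) := by
    refine tendsto_integral_of_dominated_convergence (fun _ => 1) (fun k => ?_)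
      (integrable_const _) (fun k => ?_) ?_
    · have := hX.measurable (∑ i, u i • ψ i k)
      exact Measurable.aestronglyMeasurable (by fun_prop)
    · filter_upwards with ω
      rw [mul_comm, Complex.norm_exp_ofReal_mul_I]
    · filter_upwards [ae_all_iff.2 hae] with ω hω
      have : Tendsto (fun k => X ω (∑ i, u i • ψ i k)) atTop (𝓝 (∑ i, u i * Y i ω)) := by
        simp only [map_sum, map_smul, smul_eq_mul]
        exact tendsto_finsetSum _ fun i _ => (hω i).const_mul _
      exact (Complex.continuous_exp.tendsto _).comp
        (((Complex.continuous_ofReal.tendsto _).comp this).const_mul _)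
  -- `CC` and `RR` bound the limit and all approximants at once, so that a single estimate of the
  -- exponents covers the whole sequence.
  set CC : ℝ := ∑ i, |u i| * max |C| |C' i| with hCC
  set RR : ℝ := max |R| (∑ i, |R' i|) with hRR
  have bg : ∀ t, |∑ i, u i * g i t| ≤ CC ∧ (RR < |t| → ∑ i, u i * g i t = 0) := fun t => by
    refine ⟨(Finset.abs_sum_le_sum_abs _ _).trans (Finset.sum_le_sum fun i _ => ?_), fun ht => ?_⟩
    · rw [abs_mul]
      gcongr
      exact ((hgb i t).1.trans (le_abs_self _)).trans (le_max_left _ _)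
    · refine Finset.sum_eq_zero fun i _ => ?_
      rw [(hgb i t).2 (((le_abs_self R).trans (le_max_left _ _)).trans_lt ht), mul_zero]
  have bψ : ∀ k t, |∑ i, u i * ψ i k t| ≤ CC ∧ (RR < |t| → ∑ i, u i * ψ i k t = 0) := fun k t => by
    refine ⟨(Finset.abs_sum_le_sum_abs _ _).trans (Finset.sum_le_sum fun i _ => ?_), fun ht => ?_⟩
    · rw [abs_mul]
      gcongr
      exact ((hCR i k t).1.trans (le_abs_self _)).trans (le_max_right _ _)
    · refine Finset.sum_eq_zero fun i _ => ?_
      have h1 : R' i ≤ ∑ i, |R' i| := (le_abs_self _).trans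
        (Finset.single_le_sum (f := fun i => |R' i|) (fun _ _ => abs_nonneg _) (Finset.mem_univ i))
      rw [(hCR i k t).2 ((h1.trans (le_max_right _ _)).trans_lt ht), mul_zero]
  have hgi : ∀ i, Integrable (g i) := fun i =>
    integrable_of_bounded_support (C := C) (R := R) (hgm i).aestronglyMeasurable
      (fun t => (hgb i t).1) (fun t => (hgb i t).2)
  have hL1 : Tendsto (fun k => ∫ t, |(∑ i, u i * ψ i k t) - ∑ i, u i * g i t|) atTop (𝓝 0) := by
    have h0 : Tendsto (fun k => ∑ i, |u i| * ∫ t, |ψ i k t - g i t|) atTop (𝓝 0) := by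
      have := tendsto_finsetSum Finset.univ fun i _ => ((hψ i).2.const_mul |u i|)
      simpa using this
    refine squeeze_zero (fun k => integral_nonneg fun t => abs_nonneg _) (fun k => ?_) h0
    have hint : ∀ i, Integrable (fun t => |u i| * |ψ i k t - g i t|) := fun i =>
      ((integrable_testFunction (ψ i k)).sub (hgi i)).abs.const_mul _
    simp_rw [← integral_const_mul]
    rw [← integral_finsetSum _ fun i _ => hint i]
    refine integral_mono_of_nonneg (by filter_upwards with t using abs_nonneg _)
      (integrable_finsetSum _ fun i _ => hint i) ?_
    filter_upwards with t
    rw [← Finset.sum_sub_distrib]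
    refine (Finset.abs_sum_le_sum_abs _ _).trans (Finset.sum_le_sum fun i _ => ?_)
    rw [← mul_sub, abs_mul]
  have L2 : Tendsto (fun k => ∫ t, f (∑ i, u i * ψ i k t)) atTop
      (𝓝 (∫ t, f (∑ i, u i * g i t))) := by
    rw [Metric.tendsto_atTop]
    intro ε hε
    obtain ⟨K, hK0, hK⟩ := exists_integral_comp_bound hf hf0 CC RR (half_pos hε)
    obtain ⟨N, hN⟩ := eventually_atTop.1 (hL1.eventually_lt_const
      (show 0 < ε / 2 / (K + 1) by positivity))
    refine ⟨N, fun k hk => ?_⟩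
    rw [dist_eq_norm]
    have hm : ∀ i, Measurable (fun t => ψ i k t) := fun i => measurable_testFunction _
    have h1 := hK (fun t => ∑ i, u i * ψ i k t) (fun t => ∑ i, u i * g i t) (by fun_prop)
      (by fun_prop) (bψ k) bg
    have h2 := (lt_div_iff₀ (by positivity)).1 (hN k hk)
    have h3 : 0 ≤ ∫ t, |(∑ i, u i * ψ i k t) - ∑ i, u i * g i t| :=
      integral_nonneg fun t => abs_nonneg _
    nlinarith
  have L3 : Tendsto (fun k => ∫ ω, Complex.exp (Complex.I * (X ω (∑ i, u i • ψ i k) : ℝ)) ∂P)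
      atTop (𝓝 (Complex.exp (∫ t, f (∑ i, u i * g i t)))) := by
    refine ((Complex.continuous_exp.tendsto _).comp L2).congr fun k => ?_
    rw [hX.charFunctional]
    simp
  exact tendsto_nhds_unique L1 L3

end


/-! ### Entropy of independent families -/

section Entropy

open ProbabilityTheory

set_option linter.unusedSectionVars false

variable {Ω : Type*} [MeasurableSpace Ω] {P : Measure Ω}

lemma shannonEntropy_comp_injective {S T : Type*} {g : S → T} (hg : g.Injective) (Z : Ω → S) :
    shannonEntropy P (fun ω => g (Z ω)) = shannonEntropy P Z := by
  unfold shannonEntropy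
  rw [← hg.tsum_eq]
  · refine tsum_congr fun s => ?_
    congr 3
    ext ω
    simp [hg.eq_iff]
  · intro t ht
    by_contra h
    refine ht ?_
    have : (fun ω => g (Z ω)) ⁻¹' {t} = ∅ := by
      ext ω
      simp only [Set.mem_preimage, Set.mem_singleton_iff, Set.mem_empty_iff_false, iff_false]
      exact fun h' => h ⟨_, h'⟩
    simp [this]

lemma tsum_fiber {S : Type*} [MeasurableSpace S] [MeasurableSingletonClass S]
    [IsProbabilityMeasure P] {Z : Ω → S} (hZ : Measurable Z) (hc : (Set.range Z).Countable) :
    ∑' s, P (Z ⁻¹' {s}) = 1 := by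
  have h := tsum_measure_preimage_singleton (μ := P) hc
    (fun y _ => hZ (measurableSet_singleton y))
  rw [Set.preimage_range, measure_univ] at h
  rw [← h]
  refine (tsum_subtype_eq_of_support_subset (f := fun s => P (Z ⁻¹' {s})) ?_).symm
  intro s hs
  by_contra hcon
  refine hs ?_
  have : Z ⁻¹' {s} = ∅ := by
    ext ω
    simp only [Set.mem_preimage, Set.mem_singleton_iff, Set.mem_empty_iff_false, iff_false]
    exact fun h' => hcon ⟨_, h'⟩
  simp [this]

/-- The identity `negMulLog (xy) = y negMulLog x + x negMulLog y` splits each term, and one fibre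
mass then sums to one. Countable ranges are needed for this total because the sums run over
arbitrary types. -/
lemma shannonEntropy_prodMk {S T : Type*} [MeasurableSpace S] [MeasurableSingletonClass S]
    [MeasurableSpace T] [MeasurableSingletonClass T] [IsProbabilityMeasure P]
    {Z : Ω → S} {W : Ω → T} (hZ : Measurable Z) (hW : Measurable W)
    (hcZ : (Set.range Z).Countable) (hcW : (Set.range W).Countable) (hi : IndepFun Z W P) :
    shannonEntropy P (fun ω => (Z ω, W ω)) = shannonEntropy P Z + shannonEntropy P W := by
  have h : ∀ s t, ENNReal.ofReal (Real.negMulLog (P.real ((fun ω => (Z ω, W ω)) ⁻¹' {(s, t)})))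
      = P (W ⁻¹' {t}) * ENNReal.ofReal (Real.negMulLog (P.real (Z ⁻¹' {s})))
        + P (Z ⁻¹' {s}) * ENNReal.ofReal (Real.negMulLog (P.real (W ⁻¹' {t}))) := by
    intro s t
    have h1 : (fun ω => (Z ω, W ω)) ⁻¹' {(s, t)} = Z ⁻¹' {s} ∩ W ⁻¹' {t} := by
      ext ω; simp
    rw [h1, measureReal_def, hi.measure_inter_preimage_eq_mul _ _ (measurableSet_singleton s)
      (measurableSet_singleton t), ENNReal.toReal_mul, Real.negMulLog_mul,
      ENNReal.ofReal_add, ENNReal.ofReal_mul ENNReal.toReal_nonneg,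
      ENNReal.ofReal_mul ENNReal.toReal_nonneg, ENNReal.ofReal_toReal (measure_ne_top _ _),
      ENNReal.ofReal_toReal (measure_ne_top _ _)]
    · rfl
    · exact mul_nonneg ENNReal.toReal_nonneg
        (Real.negMulLog_nonneg measureReal_nonneg measureReal_le_one)
    · exact mul_nonneg ENNReal.toReal_nonneg
        (Real.negMulLog_nonneg measureReal_nonneg measureReal_le_one)
  unfold shannonEntropy
  rw [ENNReal.tsum_prod']
  simp_rw [h, ENNReal.tsum_add, ENNReal.tsum_mul_left, ENNReal.tsum_mul_right]
  rw [tsum_fiber hZ hcZ, tsum_fiber hW hcW]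
  simp_rw [ENNReal.tsum_mul_left, one_mul]

lemma countable_range_pi {ι S : Type*} [Finite ι] {Z : ι → Ω → S}
    (h : ∀ i, (Set.range (Z i)).Countable) : (Set.range fun ω i => Z i ω).Countable :=
  (Set.countable_univ_pi h).mono fun z hz => by
    obtain ⟨ω, rfl⟩ := hz
    exact fun i _ => ⟨ω, rfl⟩

lemma shannonEntropy_pi_fin {S : Type*} [MeasurableSpace S] [MeasurableSingletonClass S]
    [IsProbabilityMeasure P] :
    ∀ {N : ℕ} {Z : Fin N → Ω → S}, (∀ i, Measurable (Z i)) → (∀ i, (Set.range (Z i)).Countable) →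
      iIndepFun Z P → shannonEntropy P (fun ω i => Z i ω) = ∑ i, shannonEntropy P (Z i)
  | 0, Z, _, _, _ => by
      unfold shannonEntropy
      rw [tsum_eq_single default (fun b hb => absurd (Subsingleton.elim _ _) hb)]
      have : (fun ω (i : Fin 0) => Z i ω) ⁻¹' {default} = Set.univ := by
        ext ω
        simp [Subsingleton.elim (fun i : Fin 0 => Z i ω) default]
      rw [this]
      simp
  | N + 1, Z, hZ, hc, hi => by
      have hinj : Function.Injective (fun z : Fin (N + 1) → S => (z 0, fun i : Fin N => z i.succ)) := by
        intro z w h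
        simp only [Prod.mk.injEq] at h
        ext i
        refine Fin.cases h.1 (fun j => congr_fun h.2 j) i
      rw [← shannonEntropy_comp_injective hinj, Fin.sum_univ_succ,
        ← shannonEntropy_pi_fin (fun i => hZ i.succ) (fun i => hc i.succ)
          (hi.precomp (Fin.succ_injective N))]
      refine shannonEntropy_prodMk (hZ 0) (measurable_pi_lambda _ fun i => hZ i.succ) (hc 0)
        (countable_range_pi fun i => hc i.succ) ?_
      have h := hi.indepFun_finset {0} (Finset.univ.erase 0) (by simp) hZ
      have hφ : Measurable (fun z : ({0} : Finset (Fin (N + 1))) → S => z ⟨0, by simp⟩) :=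
        measurable_pi_apply _
      have hψ : Measurable (fun (z : ((Finset.univ.erase 0 : Finset (Fin (N + 1))) → S))
          (i : Fin N) => z ⟨i.succ, by simp [Fin.succ_ne_zero]⟩) :=
        measurable_pi_lambda _ fun i => measurable_pi_apply _
      exact h.comp hφ hψ

lemma measurable_quantize (m : ℝ) : Measurable (quantize m) := by
  unfold quantize
  fun_prop

lemma countable_range_quantize (m : ℝ) (Y : Ω → ℝ) :
    (Set.range fun ω => quantize m (Y ω)).Countable :=
  (Set.countable_range fun k : ℤ => 1 / m * (k : ℝ)).mono fun x hx => by
    obtain ⟨ω, rfl⟩ := hx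
    exact ⟨_, rfl⟩

lemma shannonEntropy_map {S : Type*} [MeasurableSpace S] [MeasurableSingletonClass S] {Y : Ω → ℝ}
    (hY : Measurable Y) {q : ℝ → S} (hq : Measurable q) :
    shannonEntropy (P.map Y) q = shannonEntropy P (fun ω => q (Y ω)) := by
  unfold shannonEntropy
  refine tsum_congr fun s => ?_
  rw [map_measureReal_apply hY (hq (measurableSet_singleton s))]
  rfl

end Entropy

/-! ### The samples of a white noise -/

/-- The sampling window of `timeQuant`. -/
noncomputable def window (n : ℕ) (i : ℤ) (t : ℝ) : ℝ := pulse (n * t - i + 1)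

lemma window_eq_indicator {n : ℕ} (hn : 0 < n) (i : ℤ) :
    window n i = Set.indicator (Set.Ico ((i - 1) / n : ℝ) (i / n)) (fun _ => 1) := by
  have hn' : (0 : ℝ) < n := by exact_mod_cast hn
  ext t
  unfold window pulse
  have : ((n : ℝ) * t - i + 1 ∈ Set.Ico (0 : ℝ) 1) ↔ t ∈ Set.Ico ((i - 1) / n : ℝ) (i / n) := by
    rw [Set.mem_Ico, Set.mem_Ico, div_le_iff₀ hn', lt_div_iff₀ hn']
    constructor <;> rintro ⟨h1, h2⟩ <;> constructor <;> linarith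
  by_cases h : t ∈ Set.Ico ((i - 1) / n : ℝ) (i / n)
  · rw [Set.indicator_of_mem h, Set.indicator_of_mem (this.2 h)]
  · rw [Set.indicator_of_notMem h, Set.indicator_of_notMem (mt this.1 h)]

lemma integral_window {n : ℕ} (hn : 0 < n) (i : ℤ) : ∫ t, window n i t = 1 / n := by
  rw [window_eq_indicator hn, integral_indicator measurableSet_Ico]
  simp
  rw [max_eq_left]
  · ring
  · rw [← sub_div]
    simp

lemma integrable_window {n : ℕ} (hn : 0 < n) (i : ℤ) : Integrable (window n i) := by
  rw [window_eq_indicator hn]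
  exact (integrable_indicator_iff measurableSet_Ico).2 (by simp)

lemma measurable_window {n : ℕ} (hn : 0 < n) (i : ℤ) : Measurable (window n i) := by
  rw [window_eq_indicator hn]
  exact measurable_const.indicator measurableSet_Ico

lemma window_bound {n : ℕ} (hn : 0 < n) (i : ℤ) (t : ℝ) :
    |window n i t| ≤ 1 ∧ (|(i : ℝ)| + 1 < |t| → window n i t = 0) := by
  have hn' : (1 : ℝ) ≤ n := by exact_mod_cast hn
  rw [window_eq_indicator hn]
  constructor
  · unfold Set.indicator
    split_ifs <;> simp
  · intro h
    refine Set.indicator_of_notMem (fun ht => ?_) _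
    have h1 := (div_le_iff₀ (by linarith)).1 ht.1
    have h2 := (lt_div_iff₀ (by linarith)).1 ht.2
    have h3 : |t| ≤ |t * n| := by
      rw [abs_mul, abs_of_pos (show (0 : ℝ) < n by linarith)]
      nlinarith [abs_nonneg t]
    have h4 : |t * n| ≤ |(i : ℝ)| + 1 := by
      rw [abs_le]
      constructor <;> linarith [neg_abs_le (i : ℝ), le_abs_self (i : ℝ)]
    linarith

/-- Smooth bumps with the window as outer interval and inner radius increasing to the half-width
converge to the indicator almost everywhere, and dominated convergence gives `L¹`. -/
lemma exists_approximates_window {n : ℕ} (hn : 0 < n) (i : ℤ) :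
    ∃ ψ, Approximates ψ (window n i) := by
  have hn' : (0 : ℝ) < n := by exact_mod_cast hn
  set c : ℝ := (i - 1 / 2) / n with hc
  set r : ℝ := 1 / (2 * n) with hr
  have hr0 : 0 < r := by positivity
  -- With `k + 2` instead of `k + 1` the inner radius is positive already at `k = 0`.
  have hlim : Tendsto (fun k : ℕ => r * (1 - 1 / ((k : ℝ) + 2))) atTop (𝓝 r) := by
    have h1 : Tendsto (fun k : ℕ => 1 / ((k : ℝ) + 2)) atTop (𝓝 0) :=
      tendsto_const_nhds.div_atTop (tendsto_natCast_atTop_atTop.atTop_add tendsto_const_nhds)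
    simpa using (h1.const_sub 1).const_mul r
  have hk : ∀ k : ℕ, 0 < 1 / ((k : ℝ) + 2) ∧ 1 / ((k : ℝ) + 2) < 1 := fun k => by
    refine ⟨by positivity, ?_⟩
    rw [div_lt_one (by positivity)]
    have : (0 : ℝ) ≤ k := by positivity
    linarith
  let B : ℕ → ContDiffBump c := fun k =>
    { rIn := r * (1 - 1 / ((k : ℝ) + 2))
      rOut := r
      rIn_pos := mul_pos hr0 (by linarith [(hk k).2])
      rIn_lt_rOut := by nlinarith [(hk k).1] }
  have hwin : window n i = Set.indicator (Set.Ico (c - r) (c + r)) (fun _ => 1) := by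
    rw [window_eq_indicator hn]
    congr 2 <;> rw [hc, hr] <;> field_simp <;> ring
  let ψ : ℕ → 𝓢(ℝ, ℝ) := fun k => (B k).hasCompactSupport.toSchwartzMap (B k).contDiff
  have hψ : ∀ k t, ψ k t = B k t := fun k t => rfl
  have hzero : ∀ k t, r ≤ |t - c| → ψ k t = 0 := fun k t ht =>
    (B k).zero_of_le_dist (by rw [Real.dist_eq]; exact ht)
  have hle : ∀ k t, |ψ k t| ≤ 1 := fun k t => by
    rw [hψ, abs_of_nonneg (B k).nonneg]
    exact (B k).le_one
  refine ⟨ψ, ⟨1, |c| + r, fun k t => ⟨hle k t, fun ht => hzero k t ?_⟩⟩, ?_⟩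
  · have := abs_sub_abs_le_abs_sub t c
    linarith
  have hint : Integrable ((Set.Icc (c - r) (c + r)).indicator (fun _ : ℝ => (1 : ℝ) + 1)) :=
    (integrable_indicator_iff measurableSet_Icc).2 (by simp)
  have := tendsto_integral_of_dominated_convergence
    (F := fun k t => |ψ k t - window n i t|) (f := fun _ => 0) (μ := volume)
    ((Set.Icc (c - r) (c + r)).indicator (fun _ : ℝ => (1 : ℝ) + 1))
    (fun k => ((integrable_testFunction _).sub (integrable_window hn i)).abs.aestronglyMeasurable)
    hint (fun k => ?_) ?_
  · simpa using this
  · filter_upwards with t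
    rw [Real.norm_eq_abs, abs_abs]
    by_cases ht : t ∈ Set.Icc (c - r) (c + r)
    · rw [Set.indicator_of_mem ht]
      exact (abs_sub _ _).trans (add_le_add (hle k t) (window_bound hn i t).1)
    · rw [Set.indicator_of_notMem ht, hwin, Set.indicator_of_notMem
        (fun h => ht (Set.Ico_subset_Icc_self h)), hzero k t]
      · simp
      · by_contra hcon
        have := abs_lt.1 (not_le.1 hcon)
        exact ht ⟨by linarith [this.1], by linarith [this.2]⟩
  -- At the left endpoint every bump vanishes while the half-open window equals one; this single
  -- point is discarded.
  · filter_upwards [Measure.ae_ne volume (c - r)] with t htne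
    refine tendsto_const_nhds.congr' ?_
    by_cases ht : |t - c| < r
    · filter_upwards [hlim.eventually_const_lt ht] with k hk
      rw [hψ, (B k).one_of_mem_closedBall (by
        rw [Metric.mem_closedBall, Real.dist_eq]; exact hk.le), hwin, Set.indicator_of_mem]
      · simp
      · have := abs_lt.1 ht
        exact ⟨by linarith [this.1], by linarith [this.2]⟩
    · filter_upwards with k
      rw [hzero k t (not_lt.1 ht), hwin, Set.indicator_of_notMem]
      · simp
      · intro h
        refine ht (abs_lt.2 ⟨?_, by linarith [h.2]⟩)
        have := lt_of_le_of_ne h.1 (Ne.symm htne)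
        linarith

lemma window_eq_zero_of_ne {n : ℕ} {i j : ℤ} (hij : i ≠ j) {t : ℝ} (h : window n i t ≠ 0) :
    window n j t = 0 := by
  unfold window pulse at *
  have h1 := Set.mem_of_indicator_ne_zero h
  refine Set.indicator_of_notMem (fun h2 => hij ?_) _
  have e1 : (i : ℝ) < j + 1 := by linarith [h1.1, h1.2, h2.1, h2.2]
  have e2 : (j : ℝ) < i + 1 := by linarith [h1.1, h1.2, h2.1, h2.2]
  have e1' : i < j + 1 := by exact_mod_cast e1
  have e2' : j < i + 1 := by exact_mod_cast e2
  omega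

/-- At each `t` at most one window is nonzero, and it equals one; `f 0 = 0` handles the others. This
is the source of independence. -/
lemma comp_sum_window {f : ℝ → ℂ} (hf0 : f 0 = 0) {ι : Type*} [Fintype ι] (n : ℕ) {k : ι → ℤ}
    (hk : k.Injective) (u : ι → ℝ) (t : ℝ) :
    f (∑ i, u i * window n (k i) t) = ∑ i, f (u i) * (window n (k i) t : ℂ) := by
  classical
  by_cases h : ∃ i, window n (k i) t ≠ 0
  · obtain ⟨i, hi⟩ := h
    have hz : ∀ j, j ≠ i → window n (k j) t = 0 := fun j hj =>
      window_eq_zero_of_ne (fun e => hj (hk e).symm) hi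
    rw [Finset.sum_eq_single i (fun j _ hj => by simp [hz j hj]) (by simp),
      Finset.sum_eq_single i (fun j _ hj => by simp [hz j hj]) (by simp)]
    have h1 : window n (k i) t = 1 := by
      unfold window pulse at hi ⊢
      rw [Set.indicator_of_mem (Set.mem_of_indicator_ne_zero hi)]
    simp [h1]
  · push Not at h
    simp [h, hf0]

/-! ### Samples over disjoint windows are independent and identically distributed. -/

section

open ProbabilityTheory

set_option linter.unusedSectionVars false

variable {Ω : Type*} [MeasurableSpace Ω] {P : Measure Ω} [IsProbabilityMeasure P]
  {X : Ω → 𝓢(ℝ, ℝ) →L[ℝ] ℝ} {f : ℝ → ℂ}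

lemma IsWhiteLevyNoise.isPairing_timeQuant (hX : IsWhiteLevyNoise P X f) (hf : Continuous f)
    (hf0 : f 0 = 0) {n : ℕ} (hn : 0 < n) (i : ℤ) :
    IsPairing P X (window n i) (timeQuant P X n i) := by
  obtain ⟨ψ, hψ⟩ := exists_approximates_window hn i
  exact pairing_spec (hX.exists_isPairing hf hf0 (integrable_window hn i) hψ)

/-- Disjoint windows make the exponent additive, and each has integral `1/n`. One index yields the
law of a sample, several yield independence. -/
lemma IsWhiteLevyNoise.integral_exp_sum_timeQuant (hX : IsWhiteLevyNoise P X f)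
    (hf : Continuous f) (hf0 : f 0 = 0) {n : ℕ} (hn : 0 < n) {ι : Type*} [Fintype ι] {k : ι → ℤ}
    (hk : k.Injective) (u : ι → ℝ) :
    ∫ ω, Complex.exp (Complex.I * (∑ i, u i * timeQuant P X n (k i) ω : ℝ)) ∂P
      = ∏ i, Complex.exp (f (u i) / n) := by
  have hle : ∀ i, |(k i : ℝ)| + 1 ≤ (∑ j, |(k j : ℝ)|) + 1 := fun i => by
    gcongr
    exact Finset.single_le_sum (f := fun j => |(k j : ℝ)|) (fun _ _ => abs_nonneg _)
      (Finset.mem_univ i)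
  rw [hX.integral_exp_sum_pairing hf hf0 (g := fun i => window n (k i)) (C := 1)
    (R := (∑ j, |(k j : ℝ)|) + 1) (fun i => measurable_window hn _)
    (fun i t => ⟨(window_bound hn _ t).1, fun ht => (window_bound hn _ t).2
      ((hle i).trans_lt ht)⟩)
    (fun i => hX.isPairing_timeQuant hf hf0 hn (k i))
    (fun i => exists_approximates_window hn _), ← Complex.exp_sum]
  congr 1
  simp_rw [comp_sum_window hf0 n hk]
  rw [integral_finsetSum]
  · refine Finset.sum_congr rfl fun i _ => ?_
    rw [integral_const_mul, integral_complex_ofReal, integral_window hn]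
    push_cast
    ring
  · exact fun i _ => ((integrable_window hn (k i)).ofReal).const_mul _

lemma IsWhiteLevyNoise.charFun_timeQuant (hX : IsWhiteLevyNoise P X f) (hf : Continuous f)
    (hf0 : f 0 = 0) {n : ℕ} (hn : 0 < n) (i : ℤ) (u : ℝ) :
    charFun (P.map (timeQuant P X n i)) u = Complex.exp (f u / n) := by
  have hm := (hX.isPairing_timeQuant hf hf0 hn i).1
  have h := hX.integral_exp_sum_timeQuant hf hf0 hn (ι := Unit) (k := fun _ => i)
    (fun _ _ _ => rfl) (fun _ => u)
  simp only [Finset.univ_unique, Finset.sum_singleton, Finset.prod_singleton] at h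
  rw [← h, charFun_apply_real, integral_map hm.aemeasurable (by fun_prop)]
  refine integral_congr_ae ?_
  filter_upwards with ω
  congr 1
  push_cast
  ring

lemma IsWhiteLevyNoise.iIndepFun_timeQuant (hX : IsWhiteLevyNoise P X f)
    (hf : Continuous f) (hf0 : f 0 = 0) {n : ℕ} (hn : 0 < n) {ι : Type*} [Fintype ι] {k : ι → ℤ}
    (hk : k.Injective) : iIndepFun (fun i => timeQuant P X n (k i)) P := by
  have hm : ∀ i, Measurable (timeQuant P X n i) := fun i =>
    (hX.isPairing_timeQuant hf hf0 hn i).1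
  rw [iIndepFun_iff_charFun_pi fun i => (hm (k i)).aemeasurable]
  intro t
  simp_rw [hX.charFun_timeQuant hf hf0 hn]
  have hmt : Measurable (fun ω => WithLp.toLp 2 fun i => timeQuant P X n (k i) ω) :=
    (WithLp.measurable_toLp 2 _).comp (measurable_pi_lambda _ fun i => hm (k i))
  have hme : Measurable fun x : PiLp 2 (fun _ : ι => ℝ) =>
      Complex.exp ((inner ℝ x t : ℝ) * Complex.I) := by fun_prop
  rw [← hX.integral_exp_sum_timeQuant hf hf0 hn hk (fun i => t i), charFun_apply,
    integral_map hmt.aemeasurable hme.aestronglyMeasurable]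
  refine integral_congr_ae ?_
  filter_upwards with ω
  rw [mul_comm Complex.I]
  congr 3

lemma IsWhiteLevyNoise.map_timeQuant_eq (hX : IsWhiteLevyNoise P X f) (hf : Continuous f)
    (hf0 : f 0 = 0) {n : ℕ} (hn : 0 < n) (i j : ℤ) :
    P.map (timeQuant P X n i) = P.map (timeQuant P X n j) := by
  have h1 := (hX.isPairing_timeQuant hf hf0 hn i).1
  have h2 := (hX.isPairing_timeQuant hf hf0 hn j).1
  have := Measure.isProbabilityMeasure_map (μ := P) h1.aemeasurable
  have := Measure.isProbabilityMeasure_map (μ := P) h2.aemeasurable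
  refine Measure.ext_of_charFun ?_
  ext u
  rw [hX.charFun_timeQuant hf hf0 hn, hX.charFun_timeQuant hf hf0 hn]

/-- The quantization entropy is `n` times the entropy of one quantized sample. -/
theorem IsWhiteLevyNoise.quantEntropy_eq (hX : IsWhiteLevyNoise P X f) (hf : Continuous f)
    (hf0 : f 0 = 0) {n : ℕ} (hn : 0 < n) (m : ℝ) :
    quantEntropy P X m n
      = n * shannonEntropy (P.map (timeQuant P X n 1)) (quantize m) := by
  have hm : ∀ i, Measurable (timeQuant P X n i) := fun i =>
    (hX.isPairing_timeQuant hf hf0 hn i).1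
  set h := shannonEntropy (P.map (timeQuant P X n 1)) (quantize m) with hh
  have key : ∀ T : ℕ, shannonEntropy P
      (fun ω (i : Finset.Ioc (-(T : ℤ)) (T : ℤ)) => quantBlock P X m n i ω) = (2 * T) * (n * h) := by
    intro T
    -- The nested blocks are flattened to a single finite family. The sample indices are distinct
    -- because the position inside a block is less than `n`.
    let e := Fintype.equivFin (Finset.Ioc (-(T : ℤ)) (T : ℤ) × Fin n)
    let k : Finset.Ioc (-(T : ℤ)) (T : ℤ) × Fin n → ℤ := fun x => n * (x.1 - 1) + (x.2 : ℕ) + 1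
    have hk : k.Injective := by
      rintro ⟨x, a⟩ ⟨y, b⟩ hxy
      simp only [k] at hxy
      have ha : ((a : ℕ) : ℤ) < n := by exact_mod_cast a.2
      have hb : ((b : ℕ) : ℤ) < n := by exact_mod_cast b.2
      have h1 : (n : ℤ) * (x - y) = (b : ℕ) - (a : ℕ) := by linarith
      have h2 : ((x : ℤ) - y) = 0 := by
        by_contra hne
        rcases lt_or_gt_of_ne hne with h3 | h3
        · nlinarith
        · nlinarith
      rw [h2] at h1
      have h3 : (a : ℕ) = b := by omega
      exact Prod.ext (Subtype.ext (by simpa [sub_eq_zero] using h2)) (Fin.ext h3)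
    have hinj : Function.Injective (fun (z : Fin (Fintype.card
        (Finset.Ioc (-(T : ℤ)) (T : ℤ) × Fin n)) → ℝ) (i : Finset.Ioc (-(T : ℤ)) (T : ℤ))
        (j : Fin n) => z (e (i, j))) := by
      intro z w hzw
      ext a
      have := congr_fun (congr_fun hzw (e.symm a).1) (e.symm a).2
      simpa using this
    have h1 := shannonEntropy_comp_injective (P := P) hinj
      (fun ω a => quantize m (timeQuant P X n (k (e.symm a)) ω))
    have h2 : (fun ω (i : Finset.Ioc (-(T : ℤ)) (T : ℤ)) => quantBlock P X m n i ω)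
        = fun ω i j => quantize m (timeQuant P X n (k (e.symm (e (i, j)))) ω) := by
      ext ω i j
      rw [Equiv.symm_apply_apply]
      rfl
    rw [h2, h1, shannonEntropy_pi_fin]
    · have h3 : ∀ a, shannonEntropy P (fun ω => quantize m (timeQuant P X n (k (e.symm a)) ω)) = h :=
        fun a => by
          rw [hh, ← hX.map_timeQuant_eq hf hf0 hn (k (e.symm a)) 1,
            shannonEntropy_map (hm _) (measurable_quantize m)]
      simp_rw [h3]
      have h4 : ((T : ℤ) + T).toNat = 2 * T := by omega
      simp [h4, mul_assoc]
    · exact fun a => (measurable_quantize m).comp (hm _)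
    · exact fun a => countable_range_quantize m _
    · exact (hX.iIndepFun_timeQuant hf hf0 hn (hk.comp e.symm.injective)).comp
        (fun _ => quantize m) (fun _ => measurable_quantize m)
  unfold quantEntropy
  -- The normalized entropy is constant for `T ≥ 1`; the term `T = 0`, a division by zero, is
  -- discarded.
  refine Tendsto.limUnder_eq (tendsto_const_nhds.congr' ?_)
  filter_upwards [eventually_ge_atTop 1] with T hT
  rw [key T, mul_comm (2 * (T : ℝ≥0∞)), ENNReal.mul_div_cancel_right]
  · simp; omega
  · exact ENNReal.mul_ne_top (by simp) (by simp)

end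


/-! ### Densities -/

lemma measurable_pdf (μ : Measure ℝ) : Measurable (pdf μ) :=
  (Measure.measurable_rnDeriv μ volume).ennreal_toReal

lemma pdf_nonneg (μ : Measure ℝ) (x : ℝ) : 0 ≤ pdf μ x := ENNReal.toReal_nonneg

lemma integrable_pdf (μ : Measure ℝ) [IsFiniteMeasure μ] : Integrable (pdf μ) :=
  Measure.integrable_toReal_rnDeriv

lemma setIntegral_pdf {μ : Measure ℝ} [IsFiniteMeasure μ] (h : μ ≪ volume) (s : Set ℝ) :
    ∫ x in s, pdf μ x = μ.real s :=
  Measure.setIntegral_toReal_rnDeriv h s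

lemma integral_pdf_mul {μ : Measure ℝ} [IsFiniteMeasure μ] (h : μ ≪ volume) (g : ℝ → ℝ) :
    ∫ x, pdf μ x * g x = ∫ x, g x ∂μ :=
  integral_rnDeriv_smul h

lemma integrable_pdf_mul {μ : Measure ℝ} [IsFiniteMeasure μ] (h : μ ≪ volume) {g : ℝ → ℝ}
    (hg : Integrable g μ) : Integrable (fun x => pdf μ x * g x) :=
  (integrable_rnDeriv_smul_iff h).2 hg

/-! ### The cells of the quantizer -/

/-- The quantization cell of `k / m`. -/
def cell (m : ℝ) (k : ℤ) : Set ℝ := {x | ⌊1 / 2 + m * x⌋ = k}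

lemma mem_cell {m x : ℝ} {k : ℤ} : x ∈ cell m k ↔ ⌊1 / 2 + m * x⌋ = k := Iff.rfl

lemma measurable_cellIndex (m : ℝ) : Measurable fun x : ℝ => ⌊1 / 2 + m * x⌋ :=
  Int.measurable_floor.comp (by fun_prop)

lemma measurableSet_cell (m : ℝ) (k : ℤ) : MeasurableSet (cell m k) :=
  measurable_cellIndex m (measurableSet_singleton k)

lemma iUnion_cell (m : ℝ) : ⋃ k, cell m k = Set.univ := by
  ext x
  simp [mem_cell]

lemma pairwise_disjoint_cell (m : ℝ) : Pairwise (Function.onFun Disjoint (cell m)) := by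
  intro i j hij
  refine Set.disjoint_left.2 fun x hi hj => hij ?_
  rw [← mem_cell.1 hi, ← mem_cell.1 hj]

lemma cell_eq_Ico {m : ℝ} (hm : 0 < m) (k : ℤ) :
    cell m k = Set.Ico ((k - 1 / 2) / m) ((k + 1 / 2) / m) := by
  ext x
  rw [mem_cell, Int.floor_eq_iff, Set.mem_Ico, div_le_iff₀ hm, lt_div_iff₀ hm]
  constructor <;> rintro ⟨h1, h2⟩ <;> constructor <;> linarith

lemma volume_cell {m : ℝ} (hm : 0 < m) (k : ℤ) : volume (cell m k) = ENNReal.ofReal (1 / m) := by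
  rw [cell_eq_Ico hm, Real.volume_Ico]
  congr 1
  field_simp
  ring

lemma volume_real_cell {m : ℝ} (hm : 0 < m) (k : ℤ) : volume.real (cell m k) = 1 / m := by
  rw [measureReal_def, volume_cell hm, ENNReal.toReal_ofReal (by positivity)]

lemma abs_sub_center_le {m x : ℝ} (hm : 0 < m) {k : ℤ} (hx : x ∈ cell m k) :
    |x - k / m| ≤ 1 / (2 * m) := by
  rw [cell_eq_Ico hm, Set.mem_Ico, div_le_iff₀ hm, lt_div_iff₀ hm] at hx
  have : x - k / m = (x * m - k) / m := by field_simp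
  rw [this, abs_div, abs_of_pos hm, div_le_div_iff₀ hm (by positivity)]
  have : |x * m - k| ≤ 1 / 2 := abs_le.2 ⟨by linarith [hx.1], by linarith [hx.2]⟩
  nlinarith

lemma hasSum_measureReal_cell (μ : Measure ℝ) [IsProbabilityMeasure μ] (m : ℝ) :
    HasSum (fun k => μ.real (cell m k)) 1 := by
  have h := hasSum_integral_iUnion (μ := μ) (f := fun _ => (1 : ℝ)) (measurableSet_cell m)
    (pairwise_disjoint_cell m) (integrable_const _).integrableOn
  simpa [iUnion_cell] using h

lemma hasSum_setIntegral_cell {μ : Measure ℝ} {g : ℝ → ℝ} (hg : Integrable g μ) (m : ℝ) :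
    HasSum (fun k => ∫ x in cell m k, g x ∂μ) (∫ x, g x ∂μ) := by
  have h := hasSum_integral_iUnion (μ := μ) (f := g) (measurableSet_cell m)
    (pairwise_disjoint_cell m) hg.integrableOn
  simpa [iUnion_cell] using h

lemma shannonEntropy_quantize {μ : Measure ℝ} {m : ℝ} (hm : 0 < m) :
    shannonEntropy μ (quantize m)
      = ∑' k : ℤ, ENNReal.ofReal (Real.negMulLog (μ.real (cell m k))) := by
  have h : quantize m = fun x => (fun k : ℤ => 1 / m * (k : ℝ)) ⌊1 / 2 + m * x⌋ := rfl
  rw [h, shannonEntropy_comp_injective (g := fun k : ℤ => 1 / m * (k : ℝ))]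
  · rfl
  · intro i j hij
    have h1 : (1 / m : ℝ) ≠ 0 := by positivity
    exact_mod_cast mul_left_cancel₀ h1 hij

/-! ### Gibbs' inequality with respect to a reference density -/

/-- This is `log x ≤ x - 1` at `x = b/c`. Keeping `b - c` makes the gap nonnegative pointwise, and
`b` need not have mass one. -/
lemma negMulLog_le_gibbs {c b : ℝ} (hc : 0 ≤ c) (hb : 0 < b) :
    Real.negMulLog c ≤ -(c * Real.log b) + b - c := by
  rcases hc.eq_or_lt with rfl | hc
  · simp [hb.le]
  · have h := Real.log_le_sub_one_of_pos (div_pos hb hc)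
    rw [Real.log_div hb.ne' hc.ne'] at h
    have := mul_le_mul_of_nonneg_left h hc.le
    rw [mul_sub, mul_sub, mul_div_cancel₀ _ hc.ne'] at this
    unfold Real.negMulLog
    linarith

/-- A positive integrable function with Lipschitz logarithm, integrable with respect to `μ`. -/
structure IsReference (μ : Measure ℝ) (b : ℝ → ℝ) (L : ℝ) : Prop where
  pos : ∀ x, 0 < b x
  integrable : Integrable b
  lipschitz : ∀ x y, |Real.log (b x) - Real.log (b y)| ≤ L * |x - y|
  integrable_log : Integrable (fun x => Real.log (b x)) μ

lemma IsReference.nonneg {μ : Measure ℝ} {b : ℝ → ℝ} {L : ℝ} (hb : IsReference μ b L) : 0 ≤ L := by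
  have := (abs_nonneg _).trans (hb.lipschitz 1 0)
  simpa using this

/-! ### Rényi's theorem through Jensen, Gibbs and Fatou. -/

section Quantization

set_option linter.unusedSectionVars false

variable {μ : Measure ℝ} [IsProbabilityMeasure μ] {b : ℝ → ℝ} {L : ℝ}

/-- The reference supplies an integrable majorant by Gibbs' inequality. The minorant `l` comes from
a bounded density in the stable case and from convexity in the Poisson case. -/
lemma IsReference.hasDiffEntropy (hb : IsReference μ b L) (hac : μ ≪ volume) {l : ℝ → ℝ}
    (hl : Integrable l) (hle : ∀ᵐ x, l x ≤ Real.negMulLog (pdf μ x)) : HasDiffEntropy μ := by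
  have hu : Integrable (fun x => -(pdf μ x * Real.log (b x)) + b x - pdf μ x) :=
    ((integrable_pdf_mul hac hb.integrable_log).neg.add hb.integrable).sub (integrable_pdf μ)
  refine (hl.abs.add hu.abs).mono'
    (Real.continuous_negMulLog.measurable.comp (measurable_pdf μ)).aestronglyMeasurable ?_
  filter_upwards [hle] with x hx
  have h2 := negMulLog_le_gibbs (pdf_nonneg μ x) (hb.pos x)
  rw [Real.norm_eq_abs, abs_le]
  simp only [Pi.add_apply]
  constructor
  · linarith [neg_abs_le (l x), abs_nonneg (-(pdf μ x * Real.log (b x)) + b x - pdf μ x)]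
  · linarith [abs_nonneg (l x), le_abs_self (-(pdf μ x * Real.log (b x)) + b x - pdf μ x)]

lemma IsReference.diffEntropy_le (hb : IsReference μ b L) (hac : μ ≪ volume)
    (hh : HasDiffEntropy μ) :
    diffEntropy μ ≤ (∫ x, -Real.log (b x) ∂μ) + (∫ x, b x) - 1 := by
  have hi := integrable_pdf_mul hac hb.integrable_log
  calc diffEntropy μ ≤ ∫ x, (-(pdf μ x * Real.log (b x)) + b x - pdf μ x) :=
        integral_mono hh ((hi.neg.add hb.integrable).sub (integrable_pdf μ))
          fun x => negMulLog_le_gibbs (pdf_nonneg μ x) (hb.pos x)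
    _ = _ := by
        have e1 : ∫ x, pdf μ x = 1 := by
          rw [← setIntegral_univ, setIntegral_pdf hac]; simp
        have e2 : ∫ x, -Real.log (b x) ∂μ = ∫ x, -(pdf μ x * Real.log (b x)) := by
          rw [integral_neg, integral_neg, integral_pdf_mul hac]
        have e3 : ∫ x, (-(pdf μ x * Real.log (b x)) + b x - pdf μ x)
            = (∫ x, (-(pdf μ x * Real.log (b x)) + b x)) - ∫ x, pdf μ x :=
          integral_sub (hi.neg.add hb.integrable) (integrable_pdf μ)
        have e4 : ∫ x, (-(pdf μ x * Real.log (b x)) + b x)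
            = (∫ x, -(pdf μ x * Real.log (b x))) + ∫ x, b x :=
          integral_add hi.neg hb.integrable
        rw [e3, e4, e1, e2]

/-- The contribution of a cell to the entropy of the quantization, centred by `log m`. -/
noncomputable def cellTerm (μ : Measure ℝ) (m : ℝ) (k : ℤ) : ℝ :=
  Real.negMulLog (μ.real (cell m k)) - μ.real (cell m k) * Real.log m

/-- Since `m μ(cell)` is the mean density on the cell, centring by `log m` turns discrete entropy
into the differential entropy of the cell-averaged density. -/
lemma negMulLog_mul_measureReal_cell (m : ℝ) (k : ℤ) :
    Real.negMulLog (m * μ.real (cell m k)) = m * cellTerm μ m k := by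
  rw [Real.negMulLog_mul, cellTerm]
  unfold Real.negMulLog
  ring

/-- Jensen's inequality for the concave `negMulLog` and the average over the cell: averaging a
density cannot lower its entropy. -/
lemma setIntegral_negMulLog_le_cellTerm (hac : μ ≪ volume) (hh : HasDiffEntropy μ) {m : ℝ}
    (hm : 0 < m) (k : ℤ) :
    ∫ x in cell m k, Real.negMulLog (pdf μ x) ≤ cellTerm μ m k := by
  have h := Real.concaveOn_negMulLog.le_map_set_average (μ := volume) (t := cell m k)
    (f := pdf μ) Real.continuous_negMulLog.continuousOn isClosed_Ici
    (by rw [volume_cell hm]; simpa using hm) (by rw [volume_cell hm]; simp)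
    (by filter_upwards with x using pdf_nonneg μ x) (integrable_pdf μ).integrableOn
    hh.integrableOn
  rw [setAverage_eq, setAverage_eq, volume_real_cell hm, setIntegral_pdf hac, one_div, inv_inv,
    smul_eq_mul, smul_eq_mul, negMulLog_mul_measureReal_cell] at h
  exact le_of_mul_le_mul_left h hm

/-- The cellwise Gibbs bound for `cellTerm`. -/
noncomputable def cellBound (μ : Measure ℝ) (b : ℝ → ℝ) (L m : ℝ) (k : ℤ) : ℝ :=
  -(∫ x in cell m k, Real.log (b x) ∂μ) + (∫ x in cell m k, b x) - μ.real (cell m k)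
    + μ.real (cell m k) * (L / m)

/-- The integrand is the Gibbs gap of the averaged density against `b`. Freezing `log b` at the
centre of the cell costs `L/(2m)` per unit mass, once under Lebesgue measure and once under `μ`;
hence the `L/m` in `cellBound`. -/
lemma IsReference.setLIntegral_gibbs_le (hb : IsReference μ b L) {m : ℝ} (hm : 0 < m) (k : ℤ) :
    0 ≤ cellBound μ b L m k - cellTerm μ m k ∧
    ∫⁻ x in cell m k, ENNReal.ofReal (-(m * μ.real (cell m k) * Real.log (b x)) + b x
      - m * μ.real (cell m k) - Real.negMulLog (m * μ.real (cell m k)))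
      ≤ ENNReal.ofReal (cellBound μ b L m k - cellTerm μ m k) := by
  set p := μ.real (cell m k) with hp
  have hp0 : 0 ≤ p := measureReal_nonneg
  set l := Real.log (b (k / m)) with hl
  have hlip : ∀ x ∈ cell m k, |Real.log (b x) - l| ≤ L / (2 * m) := fun x hx => by
    refine (hb.lipschitz x (k / m)).trans ?_
    have := mul_le_mul_of_nonneg_left (abs_sub_center_le hm hx) hb.nonneg
    rwa [mul_one_div] at this
  set A : ℝ := -(m * p * l) + m * p * (L / (2 * m)) - m * p - Real.negMulLog (m * p) with hA
  have hcell : MeasurableSet (cell m k) := measurableSet_cell m k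
  have hpt : ∀ x ∈ cell m k, -(m * p * Real.log (b x)) + b x - m * p - Real.negMulLog (m * p)
      ≤ A + b x := fun x hx => by
    have h1 := (abs_le.1 (hlip x hx)).1
    have h2 : m * p * (l - Real.log (b x)) ≤ m * p * (L / (2 * m)) :=
      mul_le_mul_of_nonneg_left (by linarith) (by positivity)
    rw [hA]
    linarith
  have hpos : ∀ x ∈ cell m k, 0 ≤ A + b x := fun x hx => by
    have := negMulLog_le_gibbs (show 0 ≤ m * p by positivity) (hb.pos x)
    linarith [hpt x hx]
  have hfin : volume (cell m k) ≠ ∞ := by rw [volume_cell hm]; simp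
  have hconst : IntegrableOn (fun _ => A) (cell m k) := integrableOn_const hfin
  have hint : IntegrableOn (fun x => A + b x) (cell m k) :=
    hconst.add hb.integrable.integrableOn
  have hval : ∫ x in cell m k, (A + b x) = A / m + ∫ x in cell m k, b x := by
    rw [integral_add hconst hb.integrable.integrableOn, setIntegral_const,
      volume_real_cell hm, smul_eq_mul]
    ring
  have hlog : ∫ x in cell m k, Real.log (b x) ∂μ ≤ p * (l + L / (2 * m)) := by
    calc ∫ x in cell m k, Real.log (b x) ∂μ ≤ ∫ x in cell m k, (l + L / (2 * m)) ∂μ := by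
          refine setIntegral_mono_on hb.integrable_log.integrableOn
            (integrable_const _).integrableOn hcell fun x hx => ?_
          linarith [(abs_le.1 (hlip x hx)).2]
      _ = p * (l + L / (2 * m)) := by rw [setIntegral_const, smul_eq_mul]
  have hle : A / m + ∫ x in cell m k, b x ≤ cellBound μ b L m k - cellTerm μ m k := by
    have h1 : A / m = -(p * l) + p * (L / (2 * m)) - p - cellTerm μ m k := by
      rw [hA, hp, negMulLog_mul_measureReal_cell]
      field_simp
    rw [h1, cellBound]
    have h2 : p * (L / m) = p * (L / (2 * m)) + p * (L / (2 * m)) := by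
      field_simp
      ring
    rw [← hp, h2]
    linarith
  have hnn : 0 ≤ ∫ x in cell m k, (A + b x) := setIntegral_nonneg hcell hpos
  refine ⟨by linarith, ?_⟩
  calc _ ≤ ∫⁻ x in cell m k, ENNReal.ofReal (A + b x) :=
        setLIntegral_mono' hcell fun x hx => ENNReal.ofReal_le_ofReal (hpt x hx)
    _ = ENNReal.ofReal (∫ x in cell m k, (A + b x)) := by
        rw [ofReal_integral_eq_lintegral_ofReal hint]
        filter_upwards [ae_restrict_mem hcell] with x hx using hpos x hx
    _ ≤ _ := ENNReal.ofReal_le_ofReal (by linarith)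

lemma IsReference.hasSum_cellBound (hb : IsReference μ b L) (m : ℝ) :
    HasSum (cellBound μ b L m) ((∫ x, -Real.log (b x) ∂μ) + (∫ x, b x) - 1 + L / m) := by
  have h := (((hasSum_setIntegral_cell hb.integrable_log m).neg.add
    (hasSum_setIntegral_cell hb.integrable m)).sub (hasSum_measureReal_cell μ m)).add
    ((hasSum_measureReal_cell μ m).mul_right (L / m))
  rw [integral_neg]
  rwa [one_mul] at h

lemma IsReference.summable_cellTerm (hb : IsReference μ b L) (hac : μ ≪ volume)
    (hh : HasDiffEntropy μ) {m : ℝ} (hm : 0 < m) : Summable (cellTerm μ m) := by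
  refine Summable.of_norm_bounded
    ((hasSum_setIntegral_cell hh m).summable.abs.add (hb.hasSum_cellBound m).summable.abs)
    fun k => ?_
  have h1 := setIntegral_negMulLog_le_cellTerm hac hh hm k
  have h2 := (hb.setLIntegral_gibbs_le hm k).1
  rw [Real.norm_eq_abs, abs_le]
  constructor
  · linarith [neg_abs_le (∫ x in cell m k, Real.negMulLog (pdf μ x)),
      abs_nonneg (cellBound μ b L m k)]
  · linarith [abs_nonneg (∫ x in cell m k, Real.negMulLog (pdf μ x)),
      le_abs_self (cellBound μ b L m k)]

lemma IsReference.shannonEntropy_eq (hb : IsReference μ b L) (hac : μ ≪ volume)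
    (hh : HasDiffEntropy μ) {m : ℝ} (hm : 0 < m) :
    shannonEntropy μ (quantize m) = ENNReal.ofReal (Real.log m + ∑' k, cellTerm μ m k) ∧
      (shannonEntropy μ (quantize m)).toReal = Real.log m + ∑' k, cellTerm μ m k := by
  have h : HasSum (fun k => Real.negMulLog (μ.real (cell m k)))
      (Real.log m + ∑' k, cellTerm μ m k) := by
    have := ((hasSum_measureReal_cell μ m).mul_right (Real.log m)).add
      (hb.summable_cellTerm hac hh hm).hasSum
    rw [one_mul] at this
    have e : (fun k => Real.negMulLog (μ.real (cell m k)))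
        = fun k => μ.real (cell m k) * Real.log m + cellTerm μ m k := by
      funext k
      simp only [cellTerm]
      ring
    rw [e]
    exact this
  have h0 : ∀ k, 0 ≤ Real.negMulLog (μ.real (cell m k)) := fun k =>
    Real.negMulLog_nonneg measureReal_nonneg measureReal_le_one
  have h1 : shannonEntropy μ (quantize m)
      = ENNReal.ofReal (Real.log m + ∑' k, cellTerm μ m k) := by
    rw [shannonEntropy_quantize hm, ← ENNReal.ofReal_tsum_of_nonneg h0 h.summable, h.tsum_eq]
  refine ⟨h1, ?_⟩
  rw [h1, ENNReal.toReal_ofReal]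
  rw [← h.tsum_eq]
  exact tsum_nonneg h0

lemma IsReference.diffEntropy_le_tsum (hb : IsReference μ b L) (hac : μ ≪ volume)
    (hh : HasDiffEntropy μ) {m : ℝ} (hm : 0 < m) : diffEntropy μ ≤ ∑' k, cellTerm μ m k :=
  hasSum_le (fun k => setIntegral_negMulLog_le_cellTerm hac hh hm k)
    (hasSum_setIntegral_cell hh m) (hb.summable_cellTerm hac hh hm).hasSum

lemma IsReference.tsum_le (hb : IsReference μ b L) (hac : μ ≪ volume)
    (hh : HasDiffEntropy μ) {m : ℝ} (hm : 0 < m) :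
    ∑' k, cellTerm μ m k ≤ (∫ x, -Real.log (b x) ∂μ) + (∫ x, b x) - 1 + L / m :=
  hasSum_le (fun k => by linarith [(hb.setLIntegral_gibbs_le hm k).1])
    (hb.summable_cellTerm hac hh hm).hasSum (hb.hasSum_cellBound m)

/-- Lebesgue differentiation along the quantization cells. -/
lemma ae_tendsto_cell_density (hac : μ ≪ volume) :
    ∀ᵐ x, Tendsto (fun m : ℝ => m * μ.real (cell m ⌊1 / 2 + m * x⌋)) atTop (𝓝 (pdf μ x)) := by
  filter_upwards [IsUnifLocDoublingMeasure.ae_tendsto_average (μ := volume)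
    (integrable_pdf μ).locallyIntegrable 1] with x hx
  have hδ : Tendsto (fun m : ℝ => 1 / (2 * m)) atTop (𝓝[>] 0) := by
    refine tendsto_nhdsWithin_iff.2 ⟨tendsto_const_nhds.div_atTop
      (tendsto_id.const_mul_atTop two_pos), ?_⟩
    filter_upwards [eventually_gt_atTop 0] with m hm
    simpa using hm
  -- The cell of `x` is, up to an endpoint, the closed ball of radius `1/(2m)` about `k/m`. That
  -- ball contains `x` without being centred there, so differentiation along non-centred balls is
  -- used.
  have h := hx (fun m : ℝ => (⌊1 / 2 + m * x⌋ : ℝ) / m) (fun m => 1 / (2 * m)) hδ (by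
    filter_upwards [eventually_gt_atTop 0] with m hm
    rw [one_mul, Metric.mem_closedBall, Real.dist_eq]
    exact abs_sub_center_le hm (mem_cell.2 rfl))
  refine h.congr' ?_
  filter_upwards [eventually_gt_atTop 0] with m hm
  set k := ⌊1 / 2 + m * x⌋
  have h1 : Metric.closedBall ((k : ℝ) / m) (1 / (2 * m))
      = Set.Icc ((k - 1 / 2) / m) ((k + 1 / 2) / m) := by
    rw [Real.closedBall_eq_Icc]
    congr 1 <;> field_simp
  have h2 : Set.Icc ((k - 1 / 2) / m) ((k + 1 / 2) / m) =ᵐ[volume] cell m k := by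
    rw [cell_eq_Ico hm]
    exact Ico_ae_eq_Icc.symm
  rw [h1, setAverage_congr h2, setAverage_eq, setIntegral_pdf hac, volume_real_cell hm]
  simp

/-- The Gibbs gap of the averaged density is nonnegative and converges almost everywhere to the gap
of the density, whose integral is `a`. Fatou keeps the integrated gap eventually above `a - δ/2`,
while it is at most `V + L/m` minus the centred entropy; this bounds the entropy above. -/
lemma IsReference.eventually_tsum_le (hb : IsReference μ b L) (hac : μ ≪ volume)
    (hh : HasDiffEntropy μ) {δ : ℝ} (hδ : 0 < δ) :
    ∀ᶠ m in atTop, ∑' k, cellTerm μ m k ≤ diffEntropy μ + δ := by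
  set V := (∫ x, -Real.log (b x) ∂μ) + (∫ x, b x) - 1 with hV
  have hlim : ∀ᶠ m : ℝ in atTop, L / m < δ / 2 :=
    (tendsto_const_nhds.div_atTop tendsto_id).eventually_lt_const (half_pos hδ)
  set a := V - diffEntropy μ with ha
  -- If `a ≤ 0`, the bound `V + L/m` already suffices. Otherwise `0 < a` makes the comparison strict
  -- after truncation to `[0, ∞]`.
  rcases le_or_gt a 0 with ha0 | ha0
  · filter_upwards [hlim, eventually_gt_atTop 0] with m h1 hm
    have := hb.tsum_le hac hh hm
    linarith
  let c : ℝ → ℝ → ℝ := fun m x => m * μ.real (cell m ⌊1 / 2 + m * x⌋)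
  let g : ℝ → ℝ → ℝ := fun t x => -(t * Real.log (b x)) + b x - t - Real.negMulLog t
  have hi := integrable_pdf_mul hac hb.integrable_log
  have hG : Integrable (fun x => g (pdf μ x) x) :=
    ((hi.neg.add hb.integrable).sub (integrable_pdf μ)).sub hh
  have hGval : ∫ x, g (pdf μ x) x = a := by
    have e1 : ∫ x, pdf μ x = 1 := by
      rw [← setIntegral_univ, setIntegral_pdf hac]; simp
    have e2 : ∫ x, -Real.log (b x) ∂μ = ∫ x, -(pdf μ x * Real.log (b x)) := by
      rw [integral_neg, integral_neg, integral_pdf_mul hac]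
    have e3 : ∫ x, g (pdf μ x) x
        = (∫ x, (-(pdf μ x * Real.log (b x)) + b x - pdf μ x)) - diffEntropy μ :=
      integral_sub ((hi.neg.add hb.integrable).sub (integrable_pdf μ)) hh
    have e4 : ∫ x, (-(pdf μ x * Real.log (b x)) + b x - pdf μ x)
        = (∫ x, (-(pdf μ x * Real.log (b x)) + b x)) - ∫ x, pdf μ x :=
      integral_sub (hi.neg.add hb.integrable) (integrable_pdf μ)
    have e5 : ∫ x, (-(pdf μ x * Real.log (b x)) + b x)
        = (∫ x, -(pdf μ x * Real.log (b x))) + ∫ x, b x :=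
      integral_add hi.neg hb.integrable
    rw [e3, e4, e5, e1, ha, hV, e2]
  have hbm : Measurable fun x => Real.log (b x) := by
    have : Continuous fun x => Real.log (b x) := by
      refine (LipschitzWith.of_dist_le_mul (K := ⟨L, hb.nonneg⟩) fun x y => ?_).continuous
      rw [Real.dist_eq, Real.dist_eq]
      exact hb.lipschitz x y
    exact this.measurable
  have hbm' : Measurable b := by
    have : b = fun x => Real.exp (Real.log (b x)) := by
      ext x
      rw [Real.exp_log (hb.pos x)]
    rw [this]
    fun_prop
  have hcm : ∀ m, Measurable (c m) := fun m =>
    (measurable_const.mul ((measurable_from_top (f := fun k : ℤ => μ.real (cell m k))).comp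
      (measurable_cellIndex m)))
  have hgm : ∀ m, Measurable fun x => ENNReal.ofReal (g (c m x) x) := fun m => by
    have h1 := hcm m
    have h2 : Measurable fun x => Real.negMulLog (c m x) :=
      Real.continuous_negMulLog.measurable.comp h1
    exact ((((h1.mul hbm).neg.add hbm').sub h1).sub h2).ennreal_ofReal
  have hfatou := lintegral_liminf_le (μ := volume) (u := (atTop : Filter ℝ)) hgm
  have hleft : ∫⁻ x, liminf (fun m => ENNReal.ofReal (g (c m x) x)) atTop
      = ENNReal.ofReal a := by
    rw [← hGval, ofReal_integral_eq_lintegral_ofReal hG]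
    · refine lintegral_congr_ae ?_
      filter_upwards [ae_tendsto_cell_density hac] with x hx
      refine Tendsto.liminf_eq ?_
      refine (ENNReal.continuous_ofReal.tendsto _).comp ?_
      exact (((hx.mul_const _).neg.add tendsto_const_nhds).sub hx).sub
        ((Real.continuous_negMulLog.tendsto _).comp hx)
    · filter_upwards with x
      have := negMulLog_le_gibbs (pdf_nonneg μ x) (hb.pos x)
      simp only [g, Pi.zero_apply]
      linarith
  have hright : ∀ m : ℝ, 0 < m → ∫⁻ x, ENNReal.ofReal (g (c m x) x)
      ≤ ENNReal.ofReal (V + L / m - ∑' k, cellTerm μ m k) := by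
    intro m hm
    have hs := (hb.hasSum_cellBound m).sub (hb.summable_cellTerm hac hh hm).hasSum
    rw [← hs.tsum_eq, ENNReal.ofReal_tsum_of_nonneg
      (fun k => (hb.setLIntegral_gibbs_le hm k).1) hs.summable, ← setLIntegral_univ,
      ← iUnion_cell m, lintegral_iUnion (measurableSet_cell m) (pairwise_disjoint_cell m)]
    refine ENNReal.tsum_le_tsum fun k => ?_
    refine le_trans (le_of_eq ?_) (hb.setLIntegral_gibbs_le hm k).2
    refine setLIntegral_congr_fun (measurableSet_cell m k) fun x hx => ?_
    simp only [g, c, mem_cell.1 hx]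
  have hlt : ENNReal.ofReal (a - δ / 2)
      < liminf (fun m => ∫⁻ x, ENNReal.ofReal (g (c m x) x)) atTop := by
    refine lt_of_lt_of_le ?_ (hleft ▸ hfatou)
    exact (ENNReal.ofReal_lt_ofReal_iff ha0).2 (by linarith)
  filter_upwards [eventually_lt_of_lt_liminf hlt, eventually_gt_atTop 0, hlim] with m h1 hm h2
  have h3 := h1.trans_le (hright m hm)
  have h4 : a - δ / 2 < V + L / m - ∑' k, cellTerm μ m k := by
    by_contra hcon
    exact absurd h3 (not_lt.2 (ENNReal.ofReal_le_ofReal (not_lt.1 hcon)))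
  linarith

/-- Rényi's theorem: the entropy of the quantization with step `1 / m` is `log m + h(μ) + o(1)`. -/
theorem IsReference.tendsto_shannonEntropy (hb : IsReference μ b L) (hac : μ ≪ volume)
    (hh : HasDiffEntropy μ) :
    Tendsto (fun m => (shannonEntropy μ (quantize m)).toReal - Real.log m) atTop
      (𝓝 (diffEntropy μ)) := by
  rw [Metric.tendsto_nhds]
  intro ε hε
  filter_upwards [hb.eventually_tsum_le hac hh (half_pos hε), eventually_gt_atTop 0] with m h1 hm
  have h2 := hb.diffEntropy_le_tsum hac hh hm
  rw [(hb.shannonEntropy_eq hac hh hm).2, Real.dist_eq, abs_lt]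
  constructor <;> linarith

lemma IsReference.shannonEntropy_ne_top (hb : IsReference μ b L) (hac : μ ≪ volume)
    (hh : HasDiffEntropy μ) {m : ℝ} (hm : 0 < m) : shannonEntropy μ (quantize m) ≠ ∞ := by
  rw [(hb.shannonEntropy_eq hac hh hm).1]
  exact ENNReal.ofReal_ne_top

lemma IsReference.shannonEntropy_le (hb : IsReference μ b L) (hac : μ ≪ volume)
    (hh : HasDiffEntropy μ) {m : ℝ} (hm : 0 < m) :
    (shannonEntropy μ (quantize m)).toReal
      ≤ Real.log m + ((∫ x, -Real.log (b x) ∂μ) + (∫ x, b x) - 1 + L / m) := by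
  rw [(hb.shannonEntropy_eq hac hh hm).2]
  linarith [hb.tsum_le hac hh hm]

end Quantization


/-! ### Laws with integrable characteristic function -/

open scoped FourierTransform in
-- Fourier inversion and Fubini pair the characteristic function with the transform of `φ`, which is
-- bounded by the `L¹` norm of `φ`. Thus `μ` is a functional bounded in `L¹`, which is what a
-- bounded density amounts to.
lemma norm_integral_le_of_integrable_charFun {μ : Measure ℝ} [IsProbabilityMeasure μ]
    (h : Integrable (charFun μ)) (φ : 𝓢(ℝ, ℂ)) :
    ‖∫ x, φ x ∂μ‖ ≤ (∫ x, ‖φ x‖) * ∫ u, ‖charFun μ (2 * Real.pi * u)‖ := by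
  have hF : ∀ x, φ x = ∫ u, Complex.exp (((2 * Real.pi * (u * x) : ℝ) : ℂ) * Complex.I)
      * (𝓕 φ) u := by
    intro x
    have h1 : φ x = (𝓕⁻ (𝓕 φ)) x := by rw [FourierTransform.fourierInv_fourier_eq]
    rw [h1, SchwartzMap.fourierInv_coe, Real.fourierInv_eq']
    refine integral_congr_ae ?_
    filter_upwards with u
    simp [mul_comm, mul_assoc, mul_left_comm]
  have hint : Integrable (Function.uncurry fun x u : ℝ =>
      Complex.exp (((2 * Real.pi * (u * x) : ℝ) : ℂ) * Complex.I) * (𝓕 φ) u)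
      (μ.prod volume) := by
    have h1 : Integrable (fun z : ℝ × ℝ => (1 : ℂ) * (𝓕 φ) z.2) (μ.prod volume) :=
      Integrable.mul_prod (f := fun _ : ℝ => (1 : ℂ)) (integrable_const (1 : ℂ)) (𝓕 φ).integrable
    refine h1.mono ?_ ?_
    · have : Continuous fun z : ℝ × ℝ => (𝓕 φ) z.2 := (𝓕 φ).continuous.comp continuous_snd
      refine Continuous.aestronglyMeasurable ?_
      unfold Function.uncurry
      fun_prop
    · filter_upwards with z
      simp only [Function.uncurry, norm_mul, Complex.norm_exp_ofReal_mul_I, norm_one]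
      exact le_rfl
  have hswap : ∫ x, φ x ∂μ = ∫ u, charFun μ (2 * Real.pi * u) * (𝓕 φ) u := by
    calc ∫ x, φ x ∂μ = ∫ x, (∫ u, Complex.exp (((2 * Real.pi * (u * x) : ℝ) : ℂ) * Complex.I)
            * (𝓕 φ) u) ∂μ := integral_congr_ae (by filter_upwards with x using hF x)
      _ = ∫ u, ∫ x, Complex.exp (((2 * Real.pi * (u * x) : ℝ) : ℂ) * Complex.I)
            * (𝓕 φ) u ∂μ := integral_integral_swap hint
      _ = _ := by
          refine integral_congr_ae ?_
          filter_upwards with u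
          rw [integral_mul_const, charFun_apply_real]
          congr 1
          refine integral_congr_ae ?_
          filter_upwards with x
          congr 1
          push_cast
          ring
  have hc : Integrable fun u => ‖charFun μ (2 * Real.pi * u)‖ :=
    (h.comp_mul_left' (by positivity : (2 * Real.pi : ℝ) ≠ 0)).norm
  rw [hswap, ← integral_const_mul]
  refine norm_integral_le_of_norm_le (hc.const_mul _) ?_
  filter_upwards with u
  rw [norm_mul, mul_comm]
  gcongr
  rw [SchwartzMap.fourier_coe]
  exact VectorFourier.norm_fourierIntegral_le_integral_norm _ _ _ _ _

lemma exists_bump_between {K U : Set ℝ} (hK : IsCompact K) (hU : IsOpen U) (hKU : K ⊆ U) :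
    ∃ φ : 𝓢(ℝ, ℂ), (∀ x, ∃ r : ℝ, 0 ≤ r ∧ r ≤ 1 ∧ φ x = r ∧ (x ∈ K → r = 1) ∧
      (x ∉ U → r = 0)) ∧ HasCompactSupport φ := by
  obtain ⟨R, hR⟩ := hK.isBounded.subset_ball 0
  obtain ⟨f, hf, hrange, hsupp, hone⟩ := exists_contMDiff_support_eq_eq_one_iff
    (n := (⊤ : ℕ∞)) (modelWithCornersSelf ℝ ℝ) (hU.inter (Metric.isOpen_ball (x := 0) (ε := R)))
    hK.isClosed (Set.subset_inter hKU hR)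
  have hcs : HasCompactSupport fun x => (f x : ℂ) := by
    refine HasCompactSupport.of_support_subset_isCompact (isCompact_closedBall (0 : ℝ) R) ?_
    intro x hx
    have : x ∈ Function.support f := by
      intro h
      exact hx (by simp [h])
    rw [hsupp] at this
    exact Metric.ball_subset_closedBall this.2
  have hcd : ContDiff ℝ (⊤ : ℕ∞) fun x => (f x : ℂ) :=
    Complex.ofRealCLM.contDiff.comp (contMDiff_iff_contDiff.1 hf)
  refine ⟨hcs.toSchwartzMap hcd, fun x => ⟨f x, (hrange ⟨x, rfl⟩).1, (hrange ⟨x, rfl⟩).2, rfl,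
    fun hx => (hone x).1 hx, fun hx => ?_⟩, hcs⟩
  by_contra h
  have : x ∈ Function.support f := h
  rw [hsupp] at this
  exact hx this.1

/-- A law with integrable characteristic function has a bounded density. -/
theorem exists_le_smul_volume {μ : Measure ℝ} [IsProbabilityMeasure μ]
    (h : Integrable (charFun μ)) : ∃ M : ℝ, 0 < M ∧ μ ≤ ENNReal.ofReal M • volume := by
  set M := ∫ u, ‖charFun μ (2 * Real.pi * u)‖ with hM
  have hM0 : 0 ≤ M := integral_nonneg fun u => norm_nonneg _
  -- A bump between `K` and `U` gives the estimate; inner regularity of `μ` on `U` and outer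
  -- regularity of the volume extend it to all sets. The constant `M + 1` is positive, so division
  -- by it is allowed.
  have key : ∀ K U : Set ℝ, IsCompact K → IsOpen U → K ⊆ U →
      μ K ≤ ENNReal.ofReal (M + 1) * volume U := by
    intro K U hK hU hKU
    rcases eq_or_ne (volume U) ∞ with hi | hfin
    · rw [hi, ENNReal.mul_top]
      · exact le_top
      · simp; linarith
    obtain ⟨φ, hφ, hcs⟩ := exists_bump_between hK hU hKU
    choose r hr0 hr1 hr hrK hrU using hφ
    have hb := norm_integral_le_of_integrable_charFun h φ
    have hrint : Integrable r μ := by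
      have : r = fun x => (φ x).re := by
        ext x
        rw [hr]
        simp
      have hc : Continuous r := by
        rw [this]
        exact Complex.continuous_re.comp φ.continuous
      exact (integrable_const (1 : ℝ)).mono' hc.aestronglyMeasurable
        (by filter_upwards with x; rw [Real.norm_eq_abs, abs_of_nonneg (hr0 x)]; exact hr1 x)
    have h1 : μ.real K ≤ ‖∫ x, φ x ∂μ‖ := by
      have : ∫ x, φ x ∂μ = ((∫ x, r x ∂μ : ℝ) : ℂ) := by
        rw [← integral_complex_ofReal]
        exact integral_congr_ae (by filter_upwards with x using hr x)
      rw [this, Complex.norm_real, Real.norm_eq_abs, abs_of_nonneg (integral_nonneg hr0)]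
      calc μ.real K = ∫ x, K.indicator (fun _ => (1 : ℝ)) x ∂μ := by
            rw [integral_indicator hK.measurableSet]; simp
        _ ≤ ∫ x, r x ∂μ := by
            refine integral_mono ((integrable_const _).indicator hK.measurableSet) hrint fun x => ?_
            by_cases hx : x ∈ K
            · rw [Set.indicator_of_mem hx, hrK x hx]
            · rw [Set.indicator_of_notMem hx]
              exact hr0 x
    have h2 : ∫ x, ‖φ x‖ ≤ volume.real U := by
      calc ∫ x, ‖φ x‖ ≤ ∫ x, U.indicator (fun _ => (1 : ℝ)) x := by
            refine integral_mono φ.integrable.norm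
              ((integrable_indicator_iff hU.measurableSet).2 (integrableOn_const hfin)) fun x => ?_
            simp only [hr, Complex.norm_real, Real.norm_eq_abs, abs_of_nonneg (hr0 x)]
            by_cases hx : x ∈ U
            · rw [Set.indicator_of_mem hx]
              exact hr1 x
            · rw [Set.indicator_of_notMem hx, hrU x hx]
        _ = volume.real U := by rw [integral_indicator hU.measurableSet]; simp
    have h3 : μ.real K ≤ (M + 1) * volume.real U := by
      have : (∫ x, ‖φ x‖) * M ≤ volume.real U * M := by gcongr
      have h0 : 0 ≤ volume.real U := measureReal_nonneg
      nlinarith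
    rw [← ENNReal.ofReal_toReal hfin, ← ENNReal.ofReal_mul (by linarith),
      ← ENNReal.ofReal_toReal (measure_ne_top μ K)]
    exact ENNReal.ofReal_le_ofReal h3
  refine ⟨M + 1, by linarith, Measure.le_iff.2 fun s _ => ?_⟩
  rw [Measure.smul_apply, smul_eq_mul]
  refine le_of_forall_pos_le_add fun ε hε => ?_
  set δ : ℝ≥0∞ := ε / ENNReal.ofReal (M + 1) with hδ
  have hne : ENNReal.ofReal (M + 1) ≠ 0 := by simp; linarith
  have hδ0 : δ ≠ 0 := (ENNReal.div_pos hε.ne' ENNReal.ofReal_ne_top).ne'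
  obtain ⟨U, hsU, hU, hUle⟩ := s.exists_isOpen_le_add volume hδ0
  calc μ s ≤ μ U := measure_mono hsU
    _ ≤ ENNReal.ofReal (M + 1) * volume U := by
        rw [hU.measure_eq_iSup_isCompact]
        exact iSup₂_le fun K hK => iSup_le fun hKc => key K U hKc hU hK
    _ ≤ ENNReal.ofReal (M + 1) * (volume s + δ) := by gcongr
    _ = ENNReal.ofReal (M + 1) * volume s + ε := by
        rw [mul_add, hδ, ENNReal.mul_div_cancel hne ENNReal.ofReal_ne_top]

lemma absolutelyContinuous_of_le_smul {μ : Measure ℝ} {C : ℝ≥0∞} (h : μ ≤ C • volume) :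
    μ ≪ volume :=
  (Measure.absolutelyContinuous_of_le h).trans Measure.smul_absolutelyContinuous

lemma pdf_le_of_le_smul {μ : Measure ℝ} [IsProbabilityMeasure μ] {M : ℝ} (hM : 0 < M)
    (h : μ ≤ ENNReal.ofReal M • volume) : ∀ᵐ x, pdf μ x ≤ M := by
  have h1 : μ.rnDeriv volume ≤ᵐ[volume] fun _ => ENNReal.ofReal M := by
    refine ae_le_of_forall_setLIntegral_le_of_sigmaFinite (Measure.measurable_rnDeriv _ _)
      fun s hs _ => ?_
    rw [setLIntegral_const]
    exact (Measure.setLIntegral_rnDeriv_le s).trans (by simpa using h s)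
  filter_upwards [h1] with x hx
  exact ENNReal.toReal_le_of_le_ofReal hM.le hx

lemma neg_mul_abs_log_le_negMulLog {q M : ℝ} (hq : 0 ≤ q) (hM : q ≤ M) :
    -(q * |Real.log M|) ≤ Real.negMulLog q := by
  rcases hq.eq_or_lt with rfl | hq
  · simp
  · unfold Real.negMulLog
    have : Real.log q ≤ |Real.log M| := (Real.log_le_log hq hM).trans (le_abs_self _)
    nlinarith

/-! ### Logarithmic moments -/

/-- The tail of `μ` beyond `r` is `O(r^(-γ))`, so `log (1 + |x|)` has exponentially decaying tails
and the layer-cake formula applies. -/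
lemma integrable_log_of_charFun {μ : Measure ℝ} [IsProbabilityMeasure μ] {C γ : ℝ} (hγ : 0 < γ)
    (hC : 0 ≤ C) (h : ∀ u, |u| ≤ 2 → ‖1 - charFun μ u‖ ≤ C * |u| ^ γ) :
    Integrable (fun x => Real.log (1 + |x|)) μ := by
  have htail : ∀ r : ℝ, 1 ≤ r → μ.real {x | r < |x|} ≤ 2 * C * (2 / r) ^ γ := by
    intro r hr
    have hr0 : 0 < r := by linarith
    have h1 := measureReal_abs_gt_le_integral_charFun (μ := μ) hr0
    have h2r : 0 ≤ 2 / r := by positivity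
    have h2 : ‖∫ t in (-2 * r⁻¹)..(2 * r⁻¹), 1 - charFun μ t‖
        ≤ C * (2 / r) ^ γ * |2 * r⁻¹ - -2 * r⁻¹| := by
      refine intervalIntegral.norm_integral_le_of_norm_le_const fun u hu => ?_
      have hri : 0 < r⁻¹ := by positivity
      rw [Set.uIoc_of_le (by linarith)] at hu
      have hu' : |u| ≤ 2 / r := by
        rw [div_eq_mul_inv]
        exact abs_le.2 ⟨by linarith [hu.1], hu.2⟩
      refine (h u (hu'.trans ?_)).trans ?_
      · rw [div_le_iff₀ hr0]
        linarith
      · gcongr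
    calc _ ≤ _ := h1
      _ ≤ 2⁻¹ * r * (C * (2 / r) ^ γ * |2 * r⁻¹ - -2 * r⁻¹|) := by gcongr
      _ = 2 * C * (2 / r) ^ γ := by
          have : |2 * r⁻¹ - -2 * r⁻¹| = 4 * r⁻¹ := by
            rw [abs_of_nonneg]
            · ring
            · have : 0 < r⁻¹ := by positivity
              linarith
          rw [this]
          field_simp
          ring
  -- The summand `exp γ` covers `t ≤ 1` by the trivial bound one. For `t > 1`, where `exp t ≥ 2`,
  -- the tail at `r = exp t / 2` gives `2C · 4^γ`.
  set D : ℝ := 2 * C * 4 ^ γ + Real.exp γ with hD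
  have hbound : ∀ t : ℝ, 0 < t →
      μ {x | t < Real.log (1 + |x|)} ≤ ENNReal.ofReal (D * Real.exp (-γ * t)) := by
    intro t ht
    have h40 : 0 ≤ 2 * C * (4 : ℝ) ^ γ := by positivity
    rw [ENNReal.le_ofReal_iff_toReal_le (measure_ne_top _ _) (by positivity)]
    rcases le_or_gt t 1 with h1 | h1
    · refine (measureReal_le_one (μ := μ)).trans ?_
      have : 1 ≤ Real.exp γ * Real.exp (-γ * t) := by
        rw [← Real.exp_add, Real.one_le_exp_iff]
        nlinarith
      refine this.trans ?_
      gcongr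
      linarith
    · have he : 2 ≤ Real.exp t := by
        have := Real.add_one_le_exp t
        linarith
      have hsub : {x : ℝ | t < Real.log (1 + |x|)} ⊆ {x | Real.exp t / 2 < |x|} := by
        intro x hx
        have h2 : Real.exp t < 1 + |x| := by
          have := Real.exp_lt_exp.2 hx
          rwa [Real.exp_log (by positivity)] at this
        show Real.exp t / 2 < |x|
        linarith
      refine (measureReal_mono hsub).trans ((htail _ (by linarith)).trans ?_)
      have h3 : (2 / (Real.exp t / 2)) ^ γ = 4 ^ γ * Real.exp (-γ * t) := by
        have : 2 / (Real.exp t / 2) = 4 * Real.exp (-t) := by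
          rw [Real.exp_neg]
          field_simp
          norm_num
        rw [this, Real.mul_rpow (by norm_num) (Real.exp_pos _).le, ← Real.exp_mul]
        congr 2
        ring
      rw [h3, ← mul_assoc]
      gcongr
      linarith [Real.exp_pos γ]
  have hnn : ∀ x : ℝ, 0 ≤ Real.log (1 + |x|) := fun x =>
    Real.log_nonneg (by linarith [abs_nonneg x])
  have hmeas : Measurable fun x : ℝ => Real.log (1 + |x|) := by fun_prop
  refine ⟨hmeas.aestronglyMeasurable, ?_⟩
  rw [hasFiniteIntegral_iff_ofReal (by filter_upwards with x using hnn x),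
    lintegral_eq_lintegral_meas_lt μ (by filter_upwards with x using hnn x) hmeas.aemeasurable]
  have hint : IntegrableOn (fun t => D * Real.exp (-γ * t)) (Set.Ioi 0) :=
    (exp_neg_integrableOn_Ioi 0 hγ).const_mul D
  calc _ ≤ ∫⁻ t in Set.Ioi (0 : ℝ), ENNReal.ofReal (D * Real.exp (-γ * t)) :=
        setLIntegral_mono' measurableSet_Ioi fun t ht => hbound t ht
    _ < ∞ := hint.lintegral_lt_top

/-- The Cauchy kernel decays only polynomially, so its logarithm is controlled by a logarithmic
moment. This covers stable laws that lack a mean. The Lipschitz constant comes from `2|x| ≤ 1 + x²`.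
-/
lemma isReference_of_integrable_log {μ : Measure ℝ}
    (h : Integrable (fun x => Real.log (1 + |x|)) μ) :
    IsReference μ (fun x => (1 + x ^ 2)⁻¹) 1 where
  pos x := by positivity
  integrable := integrable_inv_one_add_sq
  lipschitz x y := by
    have hd : ∀ x : ℝ, HasDerivAt (fun x : ℝ => Real.log (1 + x ^ 2)⁻¹)
        (-(2 * x / (1 + x ^ 2))) x := fun x => by
      have h1 : HasDerivAt (fun x : ℝ => 1 + x ^ 2) (2 * x) x := by
        simpa using (hasDerivAt_pow 2 x).const_add 1
      have h2 := (h1.log (by positivity)).neg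
      refine h2.congr_of_eventuallyEq ?_
      filter_upwards with z
      simp [Real.log_inv]
    have := convex_univ.norm_image_sub_le_of_norm_hasDerivWithin_le (C := 1)
      (fun x _ => (hd x).hasDerivWithinAt) (fun x _ => ?_) (Set.mem_univ y) (Set.mem_univ x)
    · simpa [Real.norm_eq_abs] using this
    · rw [Real.norm_eq_abs, abs_neg, abs_div, abs_of_pos (show 0 < 1 + x ^ 2 by positivity),
        div_le_one (by positivity), abs_mul, abs_two]
      nlinarith [sq_nonneg (|x| - 1), sq_abs x]
  integrable_log := by
    refine (h.const_mul 2).mono' ?_ ?_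
    · exact Measurable.aestronglyMeasurable (by fun_prop)
    · filter_upwards with x
      rw [Real.log_inv, norm_neg, Real.norm_eq_abs, abs_of_nonneg
        (Real.log_nonneg (by nlinarith [sq_nonneg x]))]
      have : 2 * Real.log (1 + |x|) = Real.log ((1 + |x|) ^ 2) := by
        rw [Real.log_pow]
        norm_num
      rw [this]
      refine Real.log_le_log (by positivity) ?_
      nlinarith [sq_abs x, abs_nonneg x]

/-! ### Affine images -/

lemma pdf_withDensity {g : ℝ → ℝ≥0∞} (hg : Measurable g) :
    pdf (volume.withDensity g) =ᵐ[volume] fun x => (g x).toReal := by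
  filter_upwards [Measure.rnDeriv_withDensity volume hg] with x hx
  rw [pdf, hx]

lemma lintegral_comp_affine {a : ℝ} (ha : 0 < a) (s : ℝ) {G : ℝ → ℝ≥0∞} (hG : Measurable G) :
    ∫⁻ x, G (a * x + s) = ENNReal.ofReal a⁻¹ * ∫⁻ y, G y := by
  have h1 : ∫⁻ x, G (a * x + s) = ∫⁻ y, G (y + s) ∂(Measure.map (a * ·) volume) := by
    rw [lintegral_map (by fun_prop) (by fun_prop)]
  rw [h1, Real.map_volume_mul_left ha.ne', lintegral_smul_measure,
    lintegral_add_right_eq_self, abs_of_pos (by positivity), smul_eq_mul]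

lemma diffEntropy_map_affine {μ : Measure ℝ} [IsProbabilityMeasure μ] (hac : μ ≪ volume)
    (hh : HasDiffEntropy μ) {a : ℝ} (ha : 0 < a) (s : ℝ) :
    diffEntropy (μ.map fun x => a * x + s) = diffEntropy μ + Real.log a := by
  have hrn := Measure.measurable_rnDeriv μ volume
  set g : ℝ → ℝ≥0∞ := fun y => ENNReal.ofReal a⁻¹ * μ.rnDeriv volume (a⁻¹ * (y - s)) with hg
  have hgm : Measurable g := by fun_prop
  have hmap : μ.map (fun x => a * x + s) = volume.withDensity g := by
    ext t ht
    have hfm : Measurable fun x : ℝ => a * x + s := by fun_prop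
    rw [Measure.map_apply hfm ht, withDensity_apply _ ht,
      ← Measure.setLIntegral_rnDeriv hac, ← lintegral_indicator (hfm ht), ← lintegral_indicator ht]
    have h2 := lintegral_comp_affine ha s (G := fun y => t.indicator
      (fun y => μ.rnDeriv volume (a⁻¹ * (y - s))) y) (Measurable.indicator (by fun_prop) ht)
    have h3 : ∀ x, t.indicator (fun y => μ.rnDeriv volume (a⁻¹ * (y - s))) (a * x + s)
        = ((fun x => a * x + s) ⁻¹' t).indicator (fun x => μ.rnDeriv volume x) x := fun x => by
      have : a⁻¹ * (a * x + s - s) = x := by field_simp; ring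
      by_cases hx : a * x + s ∈ t
      · rw [Set.indicator_of_mem hx, Set.indicator_of_mem (by exact hx), this]
      · rw [Set.indicator_of_notMem hx, Set.indicator_of_notMem (by exact hx)]
    simp_rw [h3] at h2
    rw [h2, ← lintegral_const_mul _ (Measurable.indicator (by fun_prop) ht)]
    refine lintegral_congr fun y => ?_
    by_cases hy : y ∈ t
    · simp [hy, hg]
    · simp [hy]
  have hpdf : pdf (μ.map fun x => a * x + s)
      =ᵐ[volume] fun y => a⁻¹ * pdf μ (a⁻¹ * (y - s)) := by
    rw [hmap]
    filter_upwards [pdf_withDensity hgm] with y hy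
    rw [hy, hg, ENNReal.toReal_mul, ENNReal.toReal_ofReal (by positivity), pdf]
  set F : ℝ → ℝ := fun x => Real.negMulLog (a⁻¹ * pdf μ x) with hF
  have h1 : diffEntropy (μ.map fun x => a * x + s) = ∫ y, F (a⁻¹ * (y - s)) := by
    refine integral_congr_ae ?_
    filter_upwards [hpdf] with y hy
    rw [hy]
  have h2 : ∫ y, F (a⁻¹ * (y - s)) = a * ∫ x, F x := by
    rw [integral_sub_right_eq_self (fun y => F (a⁻¹ * y)) s, Measure.integral_comp_mul_left,
      inv_inv, abs_of_pos ha, smul_eq_mul]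
  have h3 : ∫ x, F x = Real.negMulLog a⁻¹ + a⁻¹ * diffEntropy μ := by
    have e : F = fun x => pdf μ x * Real.negMulLog a⁻¹ + a⁻¹ * Real.negMulLog (pdf μ x) := by
      funext x
      rw [hF]
      exact Real.negMulLog_mul _ _
    have e1 : ∫ x, pdf μ x = 1 := by
      rw [← setIntegral_univ, setIntegral_pdf hac]; simp
    have hh' : Integrable (fun x => Real.negMulLog (pdf μ x)) := hh
    rw [e, integral_add ((integrable_pdf μ).mul_const _) (hh'.const_mul _), integral_mul_const,
      integral_const_mul, e1, one_mul]
    rfl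
  rw [h1, h2, h3]
  unfold Real.negMulLog
  rw [Real.log_inv]
  field_simp
  ring


/-! ### The stable exponent -/

/-- The skewed part of the stable exponent. -/
noncomputable def stableSkew (α w : ℝ) : ℝ := |w| ^ α * Real.sign w * stablePhi α w

lemma abs_mul_sign (w : ℝ) : |w| * Real.sign w = w := by
  rcases lt_trichotomy w 0 with h | rfl | h
  · rw [Real.sign_of_neg h, abs_of_neg h]; ring
  · simp
  · rw [Real.sign_of_pos h, abs_of_pos h]; ring

lemma stableSkew_one (w : ℝ) : stableSkew 1 w = -(2 / Real.pi) * (w * Real.log w) := by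
  rw [stableSkew, Real.rpow_one, abs_mul_sign, stablePhi, if_pos rfl, Real.log_abs]
  ring

/-- Each one-sided power is continuous, which shows that the jump of the sign at zero is harmless.
-/
lemma rpow_mul_sign {α : ℝ} (hα : 0 < α) (w : ℝ) :
    |w| ^ α * Real.sign w = (max w 0) ^ α - (max (-w) 0) ^ α := by
  rcases lt_trichotomy w 0 with h | rfl | h
  · rw [Real.sign_of_neg h, abs_of_neg h, max_eq_right h.le, max_eq_left (by linarith),
      Real.zero_rpow hα.ne']
    ring
  · simp
  · rw [Real.sign_of_pos h, abs_of_pos h, max_eq_left h.le, max_eq_right (by linarith),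
      Real.zero_rpow hα.ne']
    ring

lemma stableSkew_of_ne {α : ℝ} (h : α ≠ 1) (w : ℝ) :
    stableSkew α w = |w| ^ α * Real.sign w * Real.tan (Real.pi * α / 2) := by
  rw [stableSkew, stablePhi, if_neg h]

lemma continuous_stableSkew {α : ℝ} (hα : 0 < α) : Continuous (stableSkew α) := by
  by_cases h : α = 1
  · subst h
    have : stableSkew 1 = fun w => -(2 / Real.pi) * (w * Real.log w) := funext stableSkew_one
    rw [this]
    exact continuous_const.mul Real.continuous_mul_log
  · have : stableSkew α = fun w => ((max w 0) ^ α - (max (-w) 0) ^ α)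
        * Real.tan (Real.pi * α / 2) := by
      funext w
      rw [stableSkew_of_ne h, rpow_mul_sign hα]
    rw [this]
    refine Continuous.mul (Continuous.sub ?_ ?_) continuous_const
    · exact (continuous_id.max continuous_const).rpow_const fun _ => Or.inr hα.le
    · exact (continuous_neg.max continuous_const).rpow_const fun _ => Or.inr hα.le

lemma stableSkew_zero {α : ℝ} : stableSkew α 0 = 0 := by
  simp [stableSkew]

/-- For `α ≠ 1` the skew part is homogeneous and `κ = 0`. For `α = 1` the logarithm adds a term
linear in `u`, which only shifts the law. -/
lemma exists_stableSkew_mul {α a : ℝ} (ha : 0 < a) :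
    ∃ κ : ℝ, ∀ u, stableSkew α (a * u) = a ^ α * stableSkew α u + κ * u := by
  by_cases h : α = 1
  · subst h
    refine ⟨-(2 / Real.pi) * (a * Real.log a), fun u => ?_⟩
    rw [stableSkew_one, stableSkew_one, Real.rpow_one]
    rcases eq_or_ne u 0 with rfl | hu
    · simp
    · rw [Real.log_mul ha.ne' hu]
      ring
  · refine ⟨0, fun u => ?_⟩
    have hs : Real.sign (a * u) = Real.sign u := by
      rcases lt_trichotomy u 0 with h | rfl | h
      · rw [Real.sign_of_neg h, Real.sign_of_neg (mul_neg_of_pos_of_neg ha h)]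
      · simp
      · rw [Real.sign_of_pos h, Real.sign_of_pos (mul_pos ha h)]
    rw [stableSkew_of_ne h, stableSkew_of_ne h, hs, abs_mul, abs_of_pos ha,
      Real.mul_rpow ha.le (abs_nonneg u)]
    ring

lemma abs_rpow_le {γ δ u : ℝ} (hγ : 0 < γ) (hδ : γ ≤ δ) (hu : |u| ≤ 2) :
    |u| ^ δ ≤ 2 ^ δ * |u| ^ γ := by
  have h1 : |u| ^ δ = |u| ^ (δ - γ) * |u| ^ γ := by
    rw [← Real.rpow_add_of_nonneg (abs_nonneg u) (by linarith) hγ.le]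
    congr 1
    ring
  rw [h1]
  gcongr
  calc |u| ^ (δ - γ) ≤ 2 ^ (δ - γ) := Real.rpow_le_rpow (abs_nonneg u) hu (by linarith)
    _ ≤ 2 ^ δ := Real.rpow_le_rpow_of_exponent_le (by norm_num) (by linarith)

lemma abs_mul_log_le {u : ℝ} (hu : |u| ≤ 2) :
    |u * Real.log u| ≤ 8 * |u| ^ (1 / 2 : ℝ) := by
  rcases eq_or_ne u 0 with rfl | hu0
  · simp
  have hpos : 0 < |u| := abs_pos.2 hu0
  set x := |u| / 2 with hx
  have hx0 : 0 < x := by positivity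
  have hx1 : x ≤ 1 := by rw [hx]; linarith
  have hux : |u| = 2 * x := by rw [hx]; ring
  have h1 := Real.abs_log_mul_self_rpow_lt x (1 / 2) hx0 hx1 (by norm_num)
  have hsq : x = x ^ (1 / 2 : ℝ) * x ^ (1 / 2 : ℝ) := by
    rw [← Real.rpow_add hx0]
    norm_num
  have hle : x ^ (1 / 2 : ℝ) ≤ |u| ^ (1 / 2 : ℝ) :=
    Real.rpow_le_rpow hx0.le (by rw [hx]; linarith) (by norm_num)
  have hx12 : 0 < x ^ (1 / 2 : ℝ) := by positivity
  have hx12' : x ^ (1 / 2 : ℝ) ≤ 1 := Real.rpow_le_one hx0.le hx1 (by norm_num)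
  have hlog : |Real.log u| ≤ 1 + |Real.log x| := by
    rw [← Real.log_abs, hux, Real.log_mul two_ne_zero hx0.ne']
    refine (abs_add_le _ _).trans ?_
    have h2 : |Real.log 2| ≤ 1 := by
      rw [abs_of_pos (Real.log_pos (by norm_num))]
      linarith [Real.log_two_lt_d9]
    linarith
  rw [abs_mul, abs_of_pos hx12] at h1
  rw [abs_mul, hux]
  have h3 : x * |Real.log x| ≤ 2 * x ^ (1 / 2 : ℝ) := by
    calc x * |Real.log x| = x ^ (1 / 2 : ℝ) * (|Real.log x| * x ^ (1 / 2 : ℝ)) := by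
          nth_rewrite 1 [hsq]; ring
      _ ≤ x ^ (1 / 2 : ℝ) * 2 := by
          gcongr
          linarith
      _ = _ := by ring
  have h4 : x ≤ x ^ (1 / 2 : ℝ) := by
    nth_rewrite 1 [hsq]
    nlinarith
  calc 2 * x * |Real.log u| ≤ 2 * x * (1 + |Real.log x|) := by gcongr
    _ = 2 * x + 2 * (x * |Real.log x|) := by ring
    _ ≤ 8 * |u| ^ (1 / 2 : ℝ) := by linarith
    _ = 8 * (2 * x) ^ (1 / 2 : ℝ) := by rw [hux]

/-- The power `min α 1 / 2` dominates `|u|^α`, `|u|` and, thanks to the halving, `|u log u|` on `|u|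
≤ 2`, so one exponent serves all stable laws. -/
lemma exists_abs_stableSkew_le {α : ℝ} (hα : 0 < α) :
    ∃ C : ℝ, 0 ≤ C ∧ ∀ u, |u| ≤ 2 → |stableSkew α u| ≤ C * |u| ^ (min α 1 / 2) := by
  have hm : 0 < min α 1 := lt_min hα one_pos
  by_cases h : α = 1
  · subst h
    refine ⟨|-(2 / Real.pi)| * 8, by positivity, fun u hu => ?_⟩
    rw [stableSkew_one, abs_mul, mul_assoc, min_self]
    gcongr
    exact abs_mul_log_le hu
  · refine ⟨|Real.tan (Real.pi * α / 2)| * 2 ^ α, by positivity, fun u hu => ?_⟩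
    have hs : |Real.sign u| ≤ 1 := by
      rcases Real.sign_apply_eq u with h | h | h <;> simp [h]
    have h1 := abs_rpow_le (half_pos hm) (show min α 1 / 2 ≤ α by
      linarith [min_le_left α 1]) hu
    rw [stableSkew_of_ne h, abs_mul, abs_mul, abs_of_nonneg (Real.rpow_nonneg (abs_nonneg u) α),
      mul_comm, mul_assoc]
    refine mul_le_mul_of_nonneg_left ?_ (abs_nonneg _)
    calc |u| ^ α * |Real.sign u| ≤ |u| ^ α * 1 := by gcongr
      _ ≤ _ := by linarith

lemma stableExponent_eq (α β σ μ w : ℝ) :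
    stableExponent α β σ μ w = ((-(σ ^ α * |w| ^ α) : ℝ) : ℂ)
      + ((w * μ + σ ^ α * β * stableSkew α w : ℝ) : ℂ) * Complex.I := by
  rw [stableExponent, stableSkew]
  push_cast
  ring

lemma continuous_stableExponent {α : ℝ} (hα : 0 < α) (β σ μ : ℝ) :
    Continuous (stableExponent α β σ μ) := by
  have h1 := continuous_stableSkew hα
  have h2 : Continuous fun w : ℝ => |w| ^ α := continuous_abs.rpow_const fun _ => Or.inr hα.le
  have : stableExponent α β σ μ = fun w => ((-(σ ^ α * |w| ^ α) : ℝ) : ℂ)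
      + ((w * μ + σ ^ α * β * stableSkew α w : ℝ) : ℂ) * Complex.I :=
    funext (stableExponent_eq α β σ μ)
  rw [this]
  fun_prop

lemma stableExponent_zero {α : ℝ} (hα : 0 < α) (β σ μ : ℝ) : stableExponent α β σ μ 0 = 0 := by
  rw [stableExponent_eq]
  simp [stableSkew_zero, Real.zero_rpow hα.ne']

lemma exists_norm_stableExponent_le {α σ : ℝ} (hα : 0 < α) (hσ : 0 < σ) (β μ : ℝ) :
    ∃ C : ℝ, 0 ≤ C ∧ ∀ u, |u| ≤ 2 →
      ‖stableExponent α β σ μ u‖ ≤ C * |u| ^ (min α 1 / 2) := by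
  have hm : 0 < min α 1 := lt_min hα one_pos
  obtain ⟨C, hC, hb⟩ := exists_abs_stableSkew_le hα
  refine ⟨σ ^ α * 2 ^ α + 2 * |μ| + σ ^ α * |β| * C, by positivity, fun u hu => ?_⟩
  have h1 := abs_rpow_le (half_pos hm) (show min α 1 / 2 ≤ α by linarith [min_le_left α 1]) hu
  have h2 := abs_rpow_le (half_pos hm) (show min α 1 / 2 ≤ 1 by linarith [min_le_right α 1]) hu
  rw [Real.rpow_one, Real.rpow_one] at h2
  have h3 := hb u hu
  have hσ' : 0 < σ ^ α := by positivity
  rw [stableExponent_eq]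
  refine (norm_add_le _ _).trans ?_
  rw [norm_mul, Complex.norm_I, mul_one, Complex.norm_real, Complex.norm_real, Real.norm_eq_abs,
    Real.norm_eq_abs, abs_neg, abs_mul, abs_of_pos hσ',
    abs_of_nonneg (Real.rpow_nonneg (abs_nonneg u) α)]
  calc σ ^ α * |u| ^ α + |u * μ + σ ^ α * β * stableSkew α u|
      ≤ σ ^ α * |u| ^ α + (|u| * |μ| + σ ^ α * |β| * |stableSkew α u|) := by
        gcongr
        refine (abs_add_le _ _).trans (le_of_eq ?_)
        rw [abs_mul, abs_mul, abs_mul, abs_of_pos hσ']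
    _ ≤ σ ^ α * (2 ^ α * |u| ^ (min α 1 / 2)) + (2 * |u| ^ (min α 1 / 2) * |μ|
          + σ ^ α * |β| * (C * |u| ^ (min α 1 / 2))) := by gcongr
    _ = _ := by ring

lemma norm_one_sub_exp_le {z : ℂ} (hz : z.re ≤ 0) : ‖1 - Complex.exp z‖ ≤ 2 * ‖z‖ := by
  rcases le_or_gt ‖z‖ 1 with h | h
  · rw [norm_sub_rev]
    exact Complex.norm_exp_sub_one_le h
  · have h1 : ‖Complex.exp z‖ ≤ 1 := by
      rw [Complex.norm_exp]
      exact Real.exp_le_one_iff.2 hz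
    have := norm_sub_le 1 (Complex.exp z)
    rw [norm_one] at this
    linarith

lemma re_stableExponent (α β σ μ w : ℝ) :
    (stableExponent α β σ μ w).re = -(σ ^ α * |w| ^ α) := by
  rw [stableExponent_eq]
  simp

lemma integrable_exp_neg_mul_abs_rpow {α c : ℝ} (hα : 0 < α) (hc : 0 < c) :
    Integrable fun u : ℝ => Real.exp (-c * |u| ^ α) := by
  have h1 : IntegrableOn (fun u : ℝ => Real.exp (-c * |u| ^ α)) (Set.Ioi 0) := by
    have := integrableOn_rpow_mul_exp_neg_mul_rpow (s := 0) (by norm_num) hα hc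
    refine this.congr_fun (fun x hx => ?_) measurableSet_Ioi
    simp only [Real.rpow_zero, one_mul, abs_of_pos (Set.mem_Ioi.1 hx)]
  have h2 : IntegrableOn (fun u : ℝ => Real.exp (-c * |u| ^ α)) (Set.Iic 0) := by
    rw [integrableOn_Iic_iff_integrableOn_Iio]
    have := (integrable_indicator_iff measurableSet_Ioi).2 h1
    have h3 := this.comp_neg
    rw [← integrable_indicator_iff measurableSet_Iio]
    refine h3.congr ?_
    filter_upwards with x
    by_cases hx : x < 0
    · rw [Set.indicator_of_mem (by simpa using hx), Set.indicator_of_mem (by simpa using hx),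
        abs_neg]
    · rw [Set.indicator_of_notMem (by simpa using hx), Set.indicator_of_notMem (by simpa using hx)]
  rw [← integrableOn_univ, ← Set.Iic_union_Ioi (a := (0 : ℝ))]
  exact h2.union h1

/-! ### The laws of the samples of a stable noise -/

section

variable {ρ : Measure ℝ} [IsProbabilityMeasure ρ] {α β σ μ : ℝ} {n : ℕ}

lemma integrable_charFun_of_stable (hα : 0 < α) (hσ : 0 < σ) (hn : 0 < n)
    (h : ∀ u, charFun ρ u = Complex.exp (stableExponent α β σ μ u / n)) :
    Integrable (charFun ρ) := by
  have hn' : (0 : ℝ) < n := by exact_mod_cast hn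
  have hσ' : 0 < σ ^ α := by positivity
  refine (integrable_exp_neg_mul_abs_rpow hα (div_pos hσ' hn')).mono'
    measurable_charFun.aestronglyMeasurable ?_
  filter_upwards with u
  rw [h, Complex.norm_exp, Complex.div_natCast_re, re_stableExponent]
  refine le_of_eq ?_
  congr 1
  ring

lemma integrable_log_of_stable (hα : 0 < α) (hσ : 0 < σ) (hn : 0 < n)
    (h : ∀ u, charFun ρ u = Complex.exp (stableExponent α β σ μ u / n)) :
    Integrable (fun x => Real.log (1 + |x|)) ρ := by
  have hn' : (1 : ℝ) ≤ n := by exact_mod_cast hn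
  have hσ' : 0 < σ ^ α := by positivity
  obtain ⟨C, hC, hb⟩ := exists_norm_stableExponent_le hα hσ β μ
  refine integrable_log_of_charFun (C := 2 * C) (γ := min α 1 / 2)
    (half_pos (lt_min hα one_pos)) (by positivity) fun u hu => ?_
  rw [h]
  refine (norm_one_sub_exp_le ?_).trans ?_
  · rw [Complex.div_natCast_re, re_stableExponent]
    exact div_nonpos_of_nonpos_of_nonneg (neg_nonpos.2 (by positivity)) (by linarith)
  · rw [norm_div, Complex.norm_natCast, mul_assoc]
    gcongr
    exact (div_le_self (norm_nonneg _) hn').trans (hb u hu)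

/-- Regularity of the law of a sample of a stable noise. -/
lemma regular_of_stable (hα : 0 < α) (hσ : 0 < σ) (hn : 0 < n)
    (h : ∀ u, charFun ρ u = Complex.exp (stableExponent α β σ μ u / n)) :
    ρ ≪ volume ∧ IsReference ρ (fun x => (1 + x ^ 2)⁻¹) 1 ∧ HasDiffEntropy ρ := by
  obtain ⟨M, hM, hle⟩ := exists_le_smul_volume (integrable_charFun_of_stable hα hσ hn h)
  have hac := absolutelyContinuous_of_le_smul hle
  have hr := isReference_of_integrable_log (integrable_log_of_stable hα hσ hn h)
  refine ⟨hac, hr, hr.hasDiffEntropy hac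
    (l := fun x => -(pdf ρ x * |Real.log M|)) ((integrable_pdf ρ).mul_const _).neg ?_⟩
  filter_upwards [pdf_le_of_le_smul hM hle] with x hx
  exact neg_mul_abs_log_le_negMulLog (pdf_nonneg ρ x) hx

lemma charFun_map_affine (ρ : Measure ℝ) (a s u : ℝ) :
    charFun (ρ.map fun x => a * x + s) u
      = Complex.exp ((s * u : ℝ) * Complex.I) * charFun ρ (a * u) := by
  rw [charFun_apply_real, charFun_apply_real, integral_map (by fun_prop) (by fun_prop),
    ← integral_const_mul]
  refine integral_congr_ae ?_
  filter_upwards with x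
  rw [← Complex.exp_add]
  congr 1
  push_cast
  ring

/-- Self-similarity: `a = n^(-1/α)` satisfies `a^α = 1/n`, and linear terms of the exponent enter
only the shift, which differential entropy ignores. -/
lemma exists_affine_of_stable (hα : 0 < α) (hn : 0 < n) {ρ₁ : Measure ℝ}
    [IsProbabilityMeasure ρ₁]
    (h₁ : ∀ u, charFun ρ₁ u = Complex.exp (stableExponent α β σ μ u))
    (h : ∀ u, charFun ρ u = Complex.exp (stableExponent α β σ μ u / n)) :
    ∃ s : ℝ, ρ = ρ₁.map fun x => (n : ℝ) ^ (-(1 / α)) * x + s := by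
  have hn' : (0 : ℝ) < n := by exact_mod_cast hn
  set a : ℝ := (n : ℝ) ^ (-(1 / α)) with ha
  have ha0 : 0 < a := by positivity
  have haα : a ^ α = 1 / n := by
    rw [ha, ← Real.rpow_mul hn'.le]
    have : -(1 / α) * α = -1 := by field_simp
    rw [this, Real.rpow_neg_one, one_div]
  obtain ⟨κ, hκ⟩ := exists_stableSkew_mul (α := α) ha0
  -- The required drift `μ/n`, less the drift `aμ` carried along by the scaling and the linear term
  -- of the skew part.
  refine ⟨μ / n - a * μ - σ ^ α * β * κ, ?_⟩
  have : IsProbabilityMeasure (ρ₁.map fun x => a * x + (μ / n - a * μ - σ ^ α * β * κ)) :=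
    Measure.isProbabilityMeasure_map (by fun_prop)
  refine Measure.ext_of_charFun ?_
  ext u
  rw [charFun_map_affine, h, h₁, ← Complex.exp_add, stableExponent_eq, stableExponent_eq, hκ,
    abs_mul, abs_of_pos ha0, Real.mul_rpow ha0.le (abs_nonneg u), haα]
  congr 1
  push_cast
  field_simp
  ring

end

/-! ### Sample entropies of a stable noise. -/

section

variable {Ω : Type*} [MeasurableSpace Ω] {P : Measure Ω} [IsProbabilityMeasure P]
  {X : Ω → 𝓢(ℝ, ℝ) →L[ℝ] ℝ} {α β σ μ : ℝ}

/-- The quantization entropy of a stable noise. -/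
theorem IsStableNoise.exists_entropy (h : IsStableNoise P X α β σ μ) :
    ∃ c : ℝ, ∀ n : ℕ, 0 < n →
      diffEntropy (P.map (timeQuant P X n 1)) = c - 1 / α * Real.log n ∧
      ∃ H : ℝ → ℝ, (∀ m, 0 < m → quantEntropy P X m n = ENNReal.ofReal (n * H m) ∧ 0 ≤ H m) ∧
        Tendsto (fun m => H m - Real.log m) atTop
          (𝓝 (diffEntropy (P.map (timeQuant P X n 1)))) := by
  have hα := h.stability.1
  have hcont := continuous_stableExponent hα β σ μ
  have h0 := stableExponent_zero hα β σ μ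
  have hmeas : ∀ n : ℕ, 0 < n → Measurable (timeQuant P X n 1) := fun n hn =>
    (h.noise.isPairing_timeQuant hcont h0 hn 1).1
  have hcf := fun (n : ℕ) (hn : 0 < n) => h.noise.charFun_timeQuant hcont h0 hn 1
  refine ⟨diffEntropy (P.map (timeQuant P X 1 1)), fun n hn => ?_⟩
  have i1 := Measure.isProbabilityMeasure_map (μ := P) (hmeas 1 one_pos).aemeasurable
  have i2 := Measure.isProbabilityMeasure_map (μ := P) (hmeas n hn).aemeasurable
  have hn' : (0 : ℝ) < n := by exact_mod_cast hn
  obtain ⟨hac, hr, hh⟩ := regular_of_stable hα h.scale hn (hcf n hn)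
  obtain ⟨hac1, hr1, hh1⟩ := regular_of_stable hα h.scale one_pos (hcf 1 one_pos)
  obtain ⟨s, hs⟩ := exists_affine_of_stable hα hn
    (fun u => by simpa using hcf 1 one_pos u) (hcf n hn)
  refine ⟨?_, fun m => (shannonEntropy (P.map (timeQuant P X n 1)) (quantize m)).toReal,
    fun m hm => ⟨?_, ENNReal.toReal_nonneg⟩, hr.tendsto_shannonEntropy hac hh⟩
  · rw [hs, diffEntropy_map_affine hac1 hh1 (by positivity), Real.log_rpow hn']
    ring
  · rw [h.noise.quantEntropy_eq hcont h0 hn, ENNReal.ofReal_mul hn'.le, ENNReal.ofReal_natCast,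
      ENNReal.ofReal_toReal (hr.shannonEntropy_ne_top hac hh hm)]

end


/-! ### Compound Poisson laws -/

/-- Convolution powers. -/
noncomputable def convPow (ν : Measure ℝ) : ℕ → Measure ℝ
  | 0 => Measure.dirac 0
  | k + 1 => ν.conv (convPow ν k)

instance isProbabilityMeasure_convPow (ν : Measure ℝ) [IsProbabilityMeasure ν] :
    ∀ k, IsProbabilityMeasure (convPow ν k)
  | 0 => by unfold convPow; infer_instance
  | k + 1 => by
    have := isProbabilityMeasure_convPow ν k
    unfold convPow
    infer_instance

lemma charFun_convPow (ν : Measure ℝ) [IsProbabilityMeasure ν] (u : ℝ) :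
    ∀ k, charFun (convPow ν k) u = charFun ν u ^ k
  | 0 => by simp [convPow]
  | k + 1 => by rw [convPow, charFun_conv, charFun_convPow ν u k, pow_succ']

/-- The weights of the number of remaining jumps, given that there is at least one jump. -/
noncomputable def jumpWeight (s : ℝ) (k : ℕ) : ℝ :=
  s ^ (k + 1) / (k + 1).factorial / (Real.exp s - 1)

lemma exp_sub_one_pos {s : ℝ} (hs : 0 < s) : 0 < Real.exp s - 1 := by
  have := Real.add_one_lt_exp hs.ne'
  linarith

lemma jumpWeight_nonneg {s : ℝ} (hs : 0 < s) (k : ℕ) : 0 ≤ jumpWeight s k := by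
  have := exp_sub_one_pos hs
  unfold jumpWeight
  positivity

lemma hasSum_exp_sub_one (z : ℂ) :
    HasSum (fun k : ℕ => z ^ (k + 1) / (k + 1).factorial) (Complex.exp z - 1) := by
  have h := NormedSpace.expSeries_div_hasSum_exp z
  rw [← Complex.exp_eq_exp_ℂ] at h
  simpa using (hasSum_nat_add_iff' 1).2 h

lemma hasSum_jumpWeight {s : ℝ} (hs : 0 < s) : HasSum (jumpWeight s) 1 := by
  have h := NormedSpace.expSeries_div_hasSum_exp s
  rw [← Real.exp_eq_exp_ℝ] at h
  have h1 := ((hasSum_nat_add_iff' 1).2 h).div_const (Real.exp s - 1)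
  simp only [Finset.range_one, Finset.sum_singleton, pow_zero, Nat.factorial_zero, Nat.cast_one,
    div_one] at h1
  rwa [div_self (exp_sub_one_pos hs).ne'] at h1

/-- The law of the sum of all jumps but one, given that there is at least one jump. -/
noncomputable def residualLaw (ν : Measure ℝ) (s : ℝ) : Measure ℝ :=
  Measure.sum fun k => ENNReal.ofReal (jumpWeight s k) • convPow ν k

/-- The compound Poisson law conditioned on having at least one jump. -/
noncomputable def jumpLaw (ν : Measure ℝ) (s : ℝ) : Measure ℝ := ν.conv (residualLaw ν s)

section

set_option linter.unusedSectionVars false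

variable {ν : Measure ℝ} [IsProbabilityMeasure ν] {s : ℝ}

lemma isProbabilityMeasure_residualLaw (hs : 0 < s) : IsProbabilityMeasure (residualLaw ν s) := by
  constructor
  rw [residualLaw, Measure.sum_apply _ MeasurableSet.univ]
  simp only [Measure.smul_apply, measure_univ, smul_eq_mul, mul_one]
  rw [← ENNReal.ofReal_tsum_of_nonneg (jumpWeight_nonneg hs) (hasSum_jumpWeight hs).summable,
    (hasSum_jumpWeight hs).tsum_eq, ENNReal.ofReal_one]

lemma isProbabilityMeasure_jumpLaw (hs : 0 < s) : IsProbabilityMeasure (jumpLaw ν s) := by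
  have := isProbabilityMeasure_residualLaw (ν := ν) hs
  unfold jumpLaw
  infer_instance

lemma hasSum_charFun_residualLaw (hs : 0 < s) (u : ℝ) :
    HasSum (fun k => (jumpWeight s k : ℂ) * charFun ν u ^ k) (charFun (residualLaw ν s) u) := by
  have := isProbabilityMeasure_residualLaw (ν := ν) hs
  have hi : Integrable (fun x : ℝ => Complex.exp (u * x * Complex.I)) (residualLaw ν s) := by
    refine (integrable_const (1 : ℝ)).mono' (by fun_prop) ?_
    filter_upwards with x
    rw [← Complex.ofReal_mul, Complex.norm_exp_ofReal_mul_I]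
  have h := hasSum_integral_measure hi
  have e : (fun k => (jumpWeight s k : ℂ) * charFun ν u ^ k) = fun k => ∫ x : ℝ,
      Complex.exp (u * x * Complex.I) ∂(ENNReal.ofReal (jumpWeight s k) • convPow ν k) := by
    funext k
    rw [integral_smul_measure, ENNReal.toReal_ofReal (jumpWeight_nonneg hs k), ← charFun_convPow,
      charFun_apply_real]
    rfl
  rw [e, charFun_apply_real]
  exact h

lemma charFun_jumpLaw (hs : 0 < s) (u : ℝ) :
    (Real.exp s - 1 : ℂ) * charFun (jumpLaw ν s) u = Complex.exp (s * charFun ν u) - 1 := by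
  have := isProbabilityMeasure_residualLaw (ν := ν) hs
  have hne : (Real.exp s - 1 : ℂ) ≠ 0 := by
    have := (exp_sub_one_pos hs).ne'
    exact_mod_cast this
  rw [jumpLaw, charFun_conv]
  have h := ((hasSum_charFun_residualLaw (ν := ν) hs u).mul_left
    ((Real.exp s - 1 : ℂ) * charFun ν u))
  rw [← mul_assoc]
  have e : (fun k => (Real.exp s - 1 : ℂ) * charFun ν u * ((jumpWeight s k : ℂ) * charFun ν u ^ k))
      = fun k : ℕ => (s * charFun ν u) ^ (k + 1) / (k + 1).factorial := by
    funext k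
    rw [jumpWeight]
    push_cast at hne ⊢
    field_simp
    ring
  rw [e] at h
  exact h.unique (hasSum_exp_sub_one (s * charFun ν u))

/-- Decomposition of a compound Poisson law into its atom and an absolutely continuous part. -/
lemma compoundPoisson_eq {ρ : Measure ℝ} [IsProbabilityMeasure ρ] (hs : 0 < s)
    (h : ∀ u, charFun ρ u = Complex.exp (s * (charFun ν u - 1))) :
    ρ = ENNReal.ofReal (Real.exp (-s)) • Measure.dirac 0
      + ENNReal.ofReal (1 - Real.exp (-s)) • jumpLaw ν s := by
  have := isProbabilityMeasure_jumpLaw (ν := ν) hs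
  have he : Real.exp (-s) ≤ 1 := Real.exp_le_one_iff.2 (by linarith)
  have : IsFiniteMeasure (ENNReal.ofReal (Real.exp (-s)) • Measure.dirac (0 : ℝ)) :=
    Measure.smul_finite _ ENNReal.ofReal_ne_top
  have : IsFiniteMeasure (ENNReal.ofReal (1 - Real.exp (-s)) • jumpLaw ν s) :=
    Measure.smul_finite _ ENNReal.ofReal_ne_top
  refine Measure.ext_of_charFun ?_
  ext u
  have hi : ∀ κ : Measure ℝ, IsFiniteMeasure κ →
      Integrable (fun x : ℝ => Complex.exp (u * x * Complex.I)) κ := fun κ hκ => by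
    refine (integrable_const (1 : ℝ)).mono' (by fun_prop) ?_
    filter_upwards with x
    rw [← Complex.ofReal_mul, Complex.norm_exp_ofReal_mul_I]
  rw [h, charFun_apply_real (μ := _ + _),
    integral_add_measure (hi _ inferInstance) (hi _ inferInstance),
    integral_smul_measure, integral_smul_measure, ← charFun_apply_real, ← charFun_apply_real,
    ENNReal.toReal_ofReal (Real.exp_pos _).le, ENNReal.toReal_ofReal (by linarith)]
  have h1 := charFun_jumpLaw (ν := ν) hs u
  have h2 : (1 - Real.exp (-s) : ℝ) = Real.exp (-s) * (Real.exp s - 1) := by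
    rw [mul_sub, ← Real.exp_add]
    simp
  rw [h2, Complex.real_smul, Complex.real_smul]
  push_cast at h1 ⊢
  rw [mul_assoc, h1, mul_sub, mul_sub, ← Complex.exp_add, charFun_dirac]
  simp
  ring_nf

lemma conv_le_conv {κ κ' : Measure ℝ} [IsFiniteMeasure κ] [IsFiniteMeasure κ'] {C : ℝ≥0∞}
    (h : κ ≤ C • κ') : ν.conv κ ≤ C • ν.conv κ' := by
  refine Measure.le_iff.2 fun t ht => ?_
  have e : ∀ τ : Measure ℝ, IsFiniteMeasure τ →
      (ν.conv τ) t = ∫⁻ x, τ ((fun y => x + y) ⁻¹' t) ∂ν := fun τ _ => by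
    rw [← lintegral_indicator_one ht, Measure.lintegral_conv (measurable_one.indicator ht)]
    refine lintegral_congr fun x => ?_
    rw [← lintegral_indicator_one ((measurable_const_add x) ht)]
    rfl
  rw [Measure.smul_apply, e κ inferInstance, e κ' inferInstance, smul_eq_mul]
  have hm : Measurable fun x => κ' ((fun y => x + y) ⁻¹' t) :=
    measurable_measure_prodMk_left (ν := κ') (s := (fun z : ℝ × ℝ => z.1 + z.2) ⁻¹' t)
      (measurable_add ht)
  rw [← lintegral_const_mul _ hm]
  exact lintegral_mono fun x => h _

/-- Since `exp s - 1 ≥ s`, the weight at `s` is at most `s^k/(k+1)! ≤ lam^k/(k+1)!`. This constant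
does not depend on `s`, so the domination persists as `s → 0`. -/
lemma residualLaw_le {lam : ℝ} (hs : 0 < s) (hle : s ≤ lam) :
    residualLaw ν s ≤ ENNReal.ofReal ((Real.exp lam - 1) / lam) • residualLaw ν lam := by
  have hl : 0 < lam := hs.trans_le hle
  have hel := exp_sub_one_pos hl
  refine Measure.le_iff.2 fun t ht => ?_
  rw [Measure.smul_apply, smul_eq_mul, residualLaw, residualLaw, Measure.sum_apply _ ht,
    Measure.sum_apply _ ht, ← ENNReal.tsum_mul_left]
  refine ENNReal.tsum_le_tsum fun k => ?_
  rw [Measure.smul_apply, Measure.smul_apply, smul_eq_mul, smul_eq_mul, ← mul_assoc,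
    ← ENNReal.ofReal_mul (by positivity)]
  gcongr
  have h1 : (Real.exp lam - 1) / lam * jumpWeight lam k = lam ^ k / (k + 1).factorial := by
    rw [jumpWeight, pow_succ]
    field_simp
  have h2 : jumpWeight s k ≤ s ^ k / (k + 1).factorial := by
    have h3 := exp_sub_one_pos hs
    have h4 : s ≤ Real.exp s - 1 := by
      have := Real.add_one_le_exp s
      linarith
    rw [jumpWeight, div_le_iff₀ h3, pow_succ, div_mul_eq_mul_div]
    gcongr
  rw [h1]
  exact h2.trans (by gcongr)

lemma jumpLaw_le {lam : ℝ} (hs : 0 < s) (hle : s ≤ lam) :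
    jumpLaw ν s ≤ ENNReal.ofReal ((Real.exp lam - 1) / lam) • jumpLaw ν lam := by
  have := isProbabilityMeasure_residualLaw (ν := ν) hs
  have := isProbabilityMeasure_residualLaw (ν := ν) (hs.trans_le hle)
  exact conv_le_conv (residualLaw_le hs hle)

/-- Given at least one jump, there is exactly one with probability `s/(exp s - 1) ≥ exp (-s)`, and
then the law is `ν`. -/
lemma le_jumpLaw (hs : 0 < s) : ENNReal.ofReal (Real.exp (-s)) • ν ≤ jumpLaw ν s := by
  have := isProbabilityMeasure_residualLaw (ν := ν) hs
  have h1 : Measure.dirac 0 ≤ ENNReal.ofReal (Real.exp s) • residualLaw ν s := by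
    have h2 : ENNReal.ofReal (jumpWeight s 0) • Measure.dirac 0 ≤ residualLaw ν s :=
      Measure.le_sum (fun k => ENNReal.ofReal (jumpWeight s k) • convPow ν k) 0
    refine Measure.le_iff.2 fun t ht => ?_
    have h3 := h2 t
    rw [Measure.smul_apply, smul_eq_mul] at h3 ⊢
    have h4 : 1 ≤ Real.exp s * jumpWeight s 0 := by
      have h5 := exp_sub_one_pos hs
      simp only [jumpWeight, zero_add, pow_one, Nat.factorial_one, Nat.cast_one, div_one]
      rw [← mul_div_assoc, le_div_iff₀ h5, one_mul]
      have h6 := Real.add_one_le_exp (-s)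
      have h7 : Real.exp s * Real.exp (-s) = 1 := by
        rw [← Real.exp_add]; simp
      nlinarith [Real.exp_pos s]
    calc Measure.dirac 0 t ≤ ENNReal.ofReal (Real.exp s * jumpWeight s 0) * Measure.dirac 0 t := by
          refine le_mul_of_one_le_left (zero_le) ?_
          exact ENNReal.one_le_ofReal.2 h4
      _ = ENNReal.ofReal (Real.exp s) * (ENNReal.ofReal (jumpWeight s 0) * Measure.dirac 0 t) := by
          rw [ENNReal.ofReal_mul (Real.exp_pos s).le, mul_assoc]
      _ ≤ _ := by gcongr
  have h2 : ν.conv (Measure.dirac 0) ≤ ENNReal.ofReal (Real.exp s) • jumpLaw ν s :=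
    conv_le_conv h1
  rw [Measure.conv_dirac_zero] at h2
  refine Measure.le_iff.2 fun t ht => ?_
  have h3 := h2 t
  rw [Measure.smul_apply, smul_eq_mul] at h3 ⊢
  calc ENNReal.ofReal (Real.exp (-s)) * ν t
      ≤ ENNReal.ofReal (Real.exp (-s)) * (ENNReal.ofReal (Real.exp s) * jumpLaw ν s t) := by gcongr
    _ = jumpLaw ν s t := by
        rw [← mul_assoc, ← ENNReal.ofReal_mul (Real.exp_pos _).le, ← Real.exp_add]
        simp

/-- This transfers the entropy hypothesis, which concerns the unit-interval sample `ρ`, to every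
conditioned law. The constant combines `(exp lam - 1)/lam` with the mass `1 - exp (-lam)` of the
jump part of `ρ`. -/
lemma jumpLaw_le_compoundPoisson {lam : ℝ} {ρ : Measure ℝ} [IsProbabilityMeasure ρ] (hs : 0 < s)
    (hle : s ≤ lam) (h : ∀ u, charFun ρ u = Complex.exp (lam * (charFun ν u - 1))) :
    jumpLaw ν s ≤ ENNReal.ofReal (Real.exp lam / lam) • ρ := by
  have hl : 0 < lam := hs.trans_le hle
  refine (jumpLaw_le hs hle).trans (Measure.le_iff.2 fun t ht => ?_)
  have h1 : ENNReal.ofReal (1 - Real.exp (-lam)) * jumpLaw ν lam t ≤ ρ t := by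
    conv_rhs => rw [compoundPoisson_eq hl h]
    simp
  rw [Measure.smul_apply, Measure.smul_apply, smul_eq_mul, smul_eq_mul]
  have h2 : (Real.exp lam - 1) / lam = Real.exp lam / lam * (1 - Real.exp (-lam)) := by
    have : Real.exp lam * Real.exp (-lam) = 1 := by rw [← Real.exp_add]; simp
    field_simp
    linarith
  rw [h2, ENNReal.ofReal_mul (by positivity), mul_assoc]
  gcongr

end

/-! ### The exponential smoothing of a law as a reference density -/

/-- The convolution of a law with the Laplace kernel. -/
noncomputable def laplaceSmoothing (ρ : Measure ℝ) (x : ℝ) : ℝ := ∫ y, Real.exp (-|x - y|) ∂ρ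

section

variable {ρ : Measure ℝ} [IsProbabilityMeasure ρ]

lemma integrable_laplaceKernel (x : ℝ) : Integrable (fun y => Real.exp (-|x - y|)) ρ := by
  refine (integrable_const (1 : ℝ)).mono' (by fun_prop) ?_
  filter_upwards with y
  rw [Real.norm_eq_abs, Real.abs_exp]
  exact Real.exp_le_one_iff.2 (neg_nonpos.2 (abs_nonneg _))

lemma laplaceSmoothing_pos (x : ℝ) : 0 < laplaceSmoothing ρ x :=
  integral_exp_pos (integrable_laplaceKernel x)

lemma laplaceSmoothing_le_one (x : ℝ) : laplaceSmoothing ρ x ≤ 1 := by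
  calc laplaceSmoothing ρ x ≤ ∫ _, (1 : ℝ) ∂ρ :=
        integral_mono (integrable_laplaceKernel x) (integrable_const 1) fun y =>
          Real.exp_le_one_iff.2 (neg_nonpos.2 (abs_nonneg _))
    _ = 1 := by simp

/-- The triangle inequality inside the exponential kernel; its logarithmic form is the Lipschitz
property of a reference. -/
lemma laplaceSmoothing_le_mul (x z : ℝ) :
    laplaceSmoothing ρ x ≤ Real.exp |x - z| * laplaceSmoothing ρ z := by
  rw [laplaceSmoothing, laplaceSmoothing, ← integral_const_mul]
  refine integral_mono (integrable_laplaceKernel x)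
    ((integrable_laplaceKernel z).const_mul _) fun y => ?_
  simp only [← Real.exp_add]
  refine Real.exp_le_exp.2 ?_
  have := abs_sub_le z x y
  rw [abs_sub_comm z x] at this
  linarith

lemma laplaceSmoothing_lipschitz (x z : ℝ) :
    |Real.log (laplaceSmoothing ρ x) - Real.log (laplaceSmoothing ρ z)| ≤ 1 * |x - z| := by
  have h : ∀ x z, Real.log (laplaceSmoothing ρ x)
      ≤ |x - z| + Real.log (laplaceSmoothing ρ z) := fun x z => by
    have h1 := Real.log_le_log (laplaceSmoothing_pos x) (laplaceSmoothing_le_mul (ρ := ρ) x z)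
    rwa [Real.log_mul (Real.exp_pos _).ne' (laplaceSmoothing_pos z).ne', Real.log_exp] at h1
  have h1 := h x z
  have h2 := h z x
  rw [abs_sub_comm z x] at h2
  rw [abs_le]
  constructor <;> linarith

lemma integrable_laplaceSmoothing : Integrable (laplaceSmoothing ρ) := by
  have hk : Integrable fun x : ℝ => Real.exp (-|x|) := by
    have := integrable_exp_neg_mul_abs_rpow (α := 1) (c := 1) one_pos one_pos
    simpa using this
  have hm : Measurable fun z : ℝ × ℝ => Real.exp (-|z.1 - z.2|) := by fun_prop
  have : Integrable (fun z : ℝ × ℝ => Real.exp (-|z.1 - z.2|)) (volume.prod ρ) := by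
    rw [integrable_prod_iff' hm.aestronglyMeasurable]
    refine ⟨by filter_upwards with y using hk.comp_sub_right y, ?_⟩
    simp only [Real.norm_eq_abs, Real.abs_exp]
    have : ∀ y : ℝ, ∫ x, Real.exp (-|x - y|) = ∫ x, Real.exp (-|x|) := fun y =>
      integral_sub_right_eq_self (fun x => Real.exp (-|x|)) y
    simp_rw [this]
    exact integrable_const _
  exact this.integral_prod_left

lemma measurable_log_laplaceSmoothing :
    Measurable fun x => Real.log (laplaceSmoothing ρ x) := by
  have : Continuous fun x => Real.log (laplaceSmoothing ρ x) := by
    refine (LipschitzWith.of_dist_le_mul (K := 1) fun x y => ?_).continuous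
    rw [Real.dist_eq, Real.dist_eq]
    exact laplaceSmoothing_lipschitz x y
  exact this.measurable

lemma exp_mul_measureReal_cell_le {k : ℤ} {x : ℝ} (hx : x ∈ cell 1 k) :
    Real.exp (-1) * ρ.real (cell 1 k) ≤ laplaceSmoothing ρ x := by
  calc Real.exp (-1) * ρ.real (cell 1 k)
      = ∫ y, (cell 1 k).indicator (fun _ => Real.exp (-1)) y ∂ρ := by
        rw [integral_indicator (measurableSet_cell 1 k), setIntegral_const, smul_eq_mul, mul_comm]
    _ ≤ laplaceSmoothing ρ x := by
        refine integral_mono ((integrable_const _).indicator (measurableSet_cell 1 k))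
          (integrable_laplaceKernel x) fun y => ?_
        by_cases hy : y ∈ cell 1 k
        · rw [Set.indicator_of_mem hy]
          refine Real.exp_le_exp.2 (neg_le_neg ?_)
          have h1 := abs_sub_center_le one_pos hx
          have h2 := abs_sub_center_le one_pos hy
          rw [abs_sub_comm] at h2
          have := abs_sub_le x ((k : ℝ) / 1) y
          linarith
        · rw [Set.indicator_of_notMem hy]
          exact (Real.exp_pos _).le

/-- On a unit cell of mass `p` the smoothing is at least `p/e`, so minus its logarithm is at most `1
- log p`. Integrated and summed, this gives one plus the entropy of the step-one quantization. -/
lemma integrable_log_laplaceSmoothing (h : shannonEntropy ρ (quantize 1) < ∞) :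
    Integrable (fun x => Real.log (laplaceSmoothing ρ x)) ρ := by
  have hneg : ∀ x, 0 ≤ -Real.log (laplaceSmoothing ρ x) := fun x =>
    neg_nonneg.2 (Real.log_nonpos (laplaceSmoothing_pos x).le (laplaceSmoothing_le_one x))
  rw [← integrable_neg_iff]
  refine ⟨measurable_log_laplaceSmoothing.neg.aestronglyMeasurable, ?_⟩
  rw [hasFiniteIntegral_iff_ofReal (by filter_upwards with x using hneg x),
    ← setLIntegral_univ, ← iUnion_cell 1,
    lintegral_iUnion (measurableSet_cell 1) (pairwise_disjoint_cell 1)]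
  have hle : ∀ k : ℤ, ∫⁻ x in cell 1 k, ENNReal.ofReal ((-fun x =>
      Real.log (laplaceSmoothing ρ x)) x) ∂ρ
      ≤ ρ (cell 1 k) + ENNReal.ofReal (Real.negMulLog (ρ.real (cell 1 k))) := by
    intro k
    set p := ρ.real (cell 1 k) with hp
    rcases (measureReal_nonneg : 0 ≤ ρ.real (cell 1 k)).eq_or_lt with h0 | h0
    · have : ρ (cell 1 k) = 0 := by
        rw [← ENNReal.ofReal_toReal (measure_ne_top ρ (cell 1 k))]
        rw [measureReal_def] at h0
        simp [← h0]
      rw [setLIntegral_measure_zero _ _ this]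
      exact zero_le
    · have hlog0 : 0 ≤ 1 - Real.log p := by
        have := Real.log_nonpos h0.le (measureReal_le_one (μ := ρ) (s := cell 1 k))
        linarith
      calc _ ≤ ∫⁻ x in cell 1 k, ENNReal.ofReal (1 - Real.log p) ∂ρ := by
            refine setLIntegral_mono' (measurableSet_cell 1 k) fun x hx => ?_
            refine ENNReal.ofReal_le_ofReal ?_
            have h1 := Real.log_le_log (by positivity) (exp_mul_measureReal_cell_le (ρ := ρ) hx)
            rw [Real.log_mul (Real.exp_pos _).ne' h0.ne', Real.log_exp] at h1
            simp only [Pi.neg_apply]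
            linarith
        _ = ENNReal.ofReal (p + Real.negMulLog p) := by
            rw [setLIntegral_const, ← ENNReal.ofReal_toReal (measure_ne_top ρ (cell 1 k)),
              ← ENNReal.ofReal_mul hlog0]
            congr 1
            rw [← measureReal_def, ← hp]
            unfold Real.negMulLog
            ring
        _ ≤ ENNReal.ofReal p + ENNReal.ofReal (Real.negMulLog p) := ENNReal.ofReal_add_le
        _ = _ := by rw [hp, measureReal_def, ENNReal.ofReal_toReal (measure_ne_top _ _)]
  refine (ENNReal.tsum_le_tsum hle).trans_lt ?_
  rw [ENNReal.tsum_add]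
  refine ENNReal.add_lt_top.2 ⟨?_, ?_⟩
  · rw [← measure_iUnion (pairwise_disjoint_cell 1) (measurableSet_cell 1)]
    exact measure_lt_top _ _
  · rwa [shannonEntropy_quantize one_pos] at h

lemma isReference_laplaceSmoothing (h : shannonEntropy ρ (quantize 1) < ∞) {κ : Measure ℝ} {C : ℝ}
    (hle : κ ≤ ENNReal.ofReal C • ρ) : IsReference κ (laplaceSmoothing ρ) 1 where
  pos := laplaceSmoothing_pos
  integrable := integrable_laplaceSmoothing
  lipschitz := laplaceSmoothing_lipschitz
  integrable_log := ((integrable_log_laplaceSmoothing h).smul_measure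
    ENNReal.ofReal_ne_top).mono_measure hle

lemma integral_neg_log_laplaceSmoothing_le (h : shannonEntropy ρ (quantize 1) < ∞)
    {κ : Measure ℝ} {C : ℝ} (hC : 0 ≤ C) (hle : κ ≤ ENNReal.ofReal C • ρ) :
    ∫ x, -Real.log (laplaceSmoothing ρ x) ∂κ
      ≤ C * ∫ x, -Real.log (laplaceSmoothing ρ x) ∂ρ := by
  have h1 : ∫ x, -Real.log (laplaceSmoothing ρ x) ∂κ
      ≤ ∫ x, -Real.log (laplaceSmoothing ρ x) ∂(ENNReal.ofReal C • ρ) := by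
    refine integral_mono_measure hle ?_
      ((integrable_log_laplaceSmoothing h).neg.smul_measure ENNReal.ofReal_ne_top)
    filter_upwards with x
    exact neg_nonneg.2 (Real.log_nonpos (laplaceSmoothing_pos x).le (laplaceSmoothing_le_one x))
  rwa [integral_smul_measure, ENNReal.toReal_ofReal hC, smul_eq_mul] at h1

end


/-! ### Differential entropy of a convolution -/

lemma withDensity_pdf {ν : Measure ℝ} [IsFiniteMeasure ν] (hac : ν ≪ volume) :
    volume.withDensity (fun x => ENNReal.ofReal (pdf ν x)) = ν := by
  conv_rhs => rw [← Measure.withDensity_rnDeriv_eq ν volume hac]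
  refine withDensity_congr_ae ?_
  filter_upwards [Measure.rnDeriv_ne_top ν volume] with x hx
  rw [pdf, ENNReal.ofReal_toReal hx]

section

set_option linter.unusedSectionVars false

variable {ν κ : Measure ℝ} [IsProbabilityMeasure ν] [IsProbabilityMeasure κ]

lemma conv_eq_withDensity (hac : ν ≪ volume) :
    ν.conv κ = volume.withDensity fun x => ∫⁻ y, ENNReal.ofReal (pdf ν (x - y)) ∂κ := by
  have hp := measurable_pdf ν
  ext t ht
  have hm1 : Measurable (t.indicator (1 : ℝ → ℝ≥0∞)) := measurable_one.indicator ht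
  have hm : Measurable fun z : ℝ × ℝ =>
      ENNReal.ofReal (pdf ν (z.1 - z.2)) * t.indicator (1 : ℝ → ℝ≥0∞) z.1 := by fun_prop
  rw [Measure.conv_comm, ← lintegral_indicator_one ht, Measure.lintegral_conv hm1,
    withDensity_apply _ ht, ← lintegral_indicator ht]
  calc ∫⁻ y, (∫⁻ x, t.indicator 1 (y + x) ∂ν) ∂κ
      = ∫⁻ y, (∫⁻ x, ENNReal.ofReal (pdf ν (x - y)) * t.indicator 1 x) ∂κ := by
        refine lintegral_congr fun y => ?_
        conv_lhs => rw [← withDensity_pdf hac]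
        rw [lintegral_withDensity_eq_lintegral_mul _ (by fun_prop) (by fun_prop),
          ← lintegral_sub_right_eq_self _ y]
        refine lintegral_congr fun x => ?_
        simp
    _ = ∫⁻ x, (∫⁻ y, ENNReal.ofReal (pdf ν (x - y)) * t.indicator 1 x ∂κ) := by
        refine lintegral_lintegral_swap ?_
        exact (hm.comp measurable_swap).aemeasurable
    _ = _ := by
        refine lintegral_congr fun x => ?_
        rw [lintegral_mul_const _ (by fun_prop)]
        by_cases hx : x ∈ t <;> simp [hx]

lemma conv_absolutelyContinuous_left (hac : ν ≪ volume) : ν.conv κ ≪ volume := by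
  rw [conv_eq_withDensity hac]
  exact withDensity_absolutelyContinuous _ _

lemma pdf_conv (hac : ν ≪ volume) :
    pdf (ν.conv κ) =ᵐ[volume] fun x => ∫ y, pdf ν (x - y) ∂κ := by
  have hp := measurable_pdf ν
  have hm : Measurable fun z : ℝ × ℝ => ENNReal.ofReal (pdf ν (z.1 - z.2)) := by fun_prop
  rw [conv_eq_withDensity hac]
  filter_upwards [pdf_withDensity (hm.lintegral_prod_right' (ν := κ))] with x hx
  rw [hx, integral_eq_lintegral_of_nonneg_ae]
  · filter_upwards with y using pdf_nonneg _ _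
  · exact Measurable.aestronglyMeasurable (by fun_prop)

lemma integrable_comp_sub_prod {h : ℝ → ℝ} (hm : Measurable h) (hi : Integrable h) :
    Integrable (fun z : ℝ × ℝ => h (z.1 - z.2)) (volume.prod κ) := by
  have hm' : Measurable fun z : ℝ × ℝ => h (z.1 - z.2) := by fun_prop
  rw [integrable_prod_iff' hm'.aestronglyMeasurable]
  refine ⟨by filter_upwards with y using hi.comp_sub_right y, ?_⟩
  have : ∀ y : ℝ, ∫ x, ‖h (x - y)‖ = ∫ x, ‖h x‖ := fun y =>
    integral_sub_right_eq_self (fun x => ‖h x‖) y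
  simp_rw [this]
  exact integrable_const _

/-- The positive part of `t log t`. -/
noncomputable def posMulLog (t : ℝ) : ℝ := max (t * Real.log t) 0

lemma continuous_posMulLog : Continuous posMulLog :=
  Real.continuous_mul_log.max continuous_const

/-- The density of a convolution is an average of translates, so Jensen applies. Truncating at zero
drops the part of `t log t` that spreading might make non-integrable. -/
lemma convexOn_posMulLog : ConvexOn ℝ (Set.Ici 0) posMulLog :=
  Real.convexOn_mul_log.sup (convexOn_const 0 (convex_Ici 0))

lemma integrable_posMulLog_pdf (hh : HasDiffEntropy ν) :
    Integrable fun x => posMulLog (pdf ν x) := by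
  have h : Integrable fun x => Real.negMulLog (pdf ν x) := hh
  refine h.neg.pos_part.congr ?_
  filter_upwards with x
  simp [posMulLog, Real.negMulLog]

/-- Convolution does not increase the positive part of the negative entropy. -/
lemma integrable_posMulLog_conv (hac : ν ≪ volume) (hh : HasDiffEntropy ν) :
    Integrable (fun x => posMulLog (pdf (ν.conv κ) x)) ∧
      ∫ x, posMulLog (pdf (ν.conv κ) x) ≤ ∫ x, posMulLog (pdf ν x) := by
  have hψ := continuous_posMulLog
  have hi := integrable_posMulLog_pdf hh
  have hm : Measurable fun x => posMulLog (pdf ν x) := hψ.measurable.comp (measurable_pdf ν)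
  have h1 := integrable_comp_sub_prod (κ := κ) (measurable_pdf ν) (integrable_pdf ν)
  have h2 := integrable_comp_sub_prod (κ := κ) hm hi
  have hle : ∀ᵐ x, posMulLog (pdf (ν.conv κ) x) ≤ ∫ y, posMulLog (pdf ν (x - y)) ∂κ := by
    filter_upwards [pdf_conv (κ := κ) hac, h1.prod_right_ae, h2.prod_right_ae] with x hx e1 e2
    rw [hx]
    exact convexOn_posMulLog.map_integral_le hψ.continuousOn isClosed_Ici
      (by filter_upwards with y using pdf_nonneg _ _) e1 e2
  have hint : Integrable fun x => ∫ y, posMulLog (pdf ν (x - y)) ∂κ := h2.integral_prod_left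
  have hI : Integrable (fun x => posMulLog (pdf (ν.conv κ) x)) := by
    refine hint.mono' (hψ.measurable.comp (measurable_pdf _)).aestronglyMeasurable ?_
    filter_upwards [hle] with x hx
    rw [Real.norm_eq_abs, abs_of_nonneg (le_max_right _ _)]
    exact hx
  refine ⟨hI, ?_⟩
  calc ∫ x, posMulLog (pdf (ν.conv κ) x) ≤ ∫ x, ∫ y, posMulLog (pdf ν (x - y)) ∂κ :=
        integral_mono_ae hI hint hle
    _ = ∫ y, (∫ x, posMulLog (pdf ν (x - y))) ∂κ := integral_integral_swap h2
    _ = ∫ x, posMulLog (pdf ν x) := by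
        have : ∀ y : ℝ, ∫ x, posMulLog (pdf ν (x - y)) = ∫ x, posMulLog (pdf ν x) := fun y =>
          integral_sub_right_eq_self (fun x => posMulLog (pdf ν x)) y
        simp_rw [this]
        simp

lemma neg_posMulLog_le (t : ℝ) : -posMulLog t ≤ Real.negMulLog t := by
  have := le_max_left (t * Real.log t) 0
  unfold posMulLog Real.negMulLog
  linarith

end

/-! ### Entropy of a law with an atom at zero -/

lemma zero_mem_cell (m : ℝ) : (0 : ℝ) ∈ cell m 0 := by
  rw [mem_cell, mul_zero, add_zero]
  norm_num

section

set_option linter.unusedSectionVars false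

variable {Q ρ : Measure ℝ} [IsProbabilityMeasure Q] {p : ℝ}

lemma measureReal_cell_mixture (hp0 : 0 ≤ p) (hp1 : p ≤ 1)
    (h : ρ = ENNReal.ofReal (1 - p) • Measure.dirac 0 + ENNReal.ofReal p • Q) (m : ℝ) (k : ℤ) :
    ρ.real (cell m k) = (if k = 0 then 1 - p else 0) + p * Q.real (cell m k) := by
  have h1 : (Measure.dirac (0 : ℝ)) (cell m k) = if k = 0 then 1 else 0 := by
    rw [Measure.dirac_apply' _ (measurableSet_cell m k)]
    by_cases hk : k = 0
    · subst hk
      simp [zero_mem_cell]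
    · rw [if_neg hk, Set.indicator_of_notMem]
      intro h0
      rw [mem_cell, mem_cell.1 (zero_mem_cell m)] at h0
      exact hk h0.symm
  rw [h, measureReal_def, Measure.add_apply, Measure.smul_apply, Measure.smul_apply, h1,
    smul_eq_mul, smul_eq_mul, ENNReal.toReal_add, ENNReal.toReal_mul, ENNReal.toReal_mul,
    ENNReal.toReal_ofReal hp0, ENNReal.toReal_ofReal (by linarith)]
  · congr 1
    split_ifs <;> simp
  · split_ifs <;> simp
  · exact ENNReal.mul_ne_top ENNReal.ofReal_ne_top (measure_ne_top _ _)

lemma hasSum_negMulLog_cell {m : ℝ} (hm : 0 < m) (hfin : shannonEntropy Q (quantize m) ≠ ∞) :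
    HasSum (fun k => Real.negMulLog (Q.real (cell m k)))
      (shannonEntropy Q (quantize m)).toReal := by
  rw [shannonEntropy_quantize hm] at hfin ⊢
  have h0 : ∀ k, 0 ≤ Real.negMulLog (Q.real (cell m k)) := fun k =>
    Real.negMulLog_nonneg measureReal_nonneg measureReal_le_one
  have h := (ENNReal.hasSum_toReal hfin)
  rw [← ENNReal.tsum_toReal_eq fun _ => ENNReal.ofReal_ne_top] at h
  simpa only [ENNReal.toReal_ofReal (h0 _)] using h

/-- The entropy of the quantization of `(1 - p) δ₀ + p Q`. -/
lemma shannonEntropy_mixture [IsProbabilityMeasure ρ] (hp0 : 0 ≤ p) (hp1 : p ≤ 1)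
    (h : ρ = ENNReal.ofReal (1 - p) • Measure.dirac 0 + ENNReal.ofReal p • Q) {m : ℝ}
    (hm : 0 < m) (hfin : shannonEntropy Q (quantize m) ≠ ∞) :
    shannonEntropy ρ (quantize m) = ENNReal.ofReal
      (Real.negMulLog p + p * (shannonEntropy Q (quantize m)).toReal
        + (Real.negMulLog (1 - p + p * Q.real (cell m 0))
          - Real.negMulLog (p * Q.real (cell m 0)))) ∧
    0 ≤ Real.negMulLog p + p * (shannonEntropy Q (quantize m)).toReal
        + (Real.negMulLog (1 - p + p * Q.real (cell m 0))
          - Real.negMulLog (p * Q.real (cell m 0))) := by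
  -- Every cell is first treated as if there were no atom, where `negMulLog (pq)` splits; the last
  -- summand corrects the cell of zero.
  have h1 := (((hasSum_measureReal_cell Q m).mul_right (Real.negMulLog p)).add
    ((hasSum_negMulLog_cell hm hfin).mul_left p)).add
    (hasSum_ite_eq (0 : ℤ) (Real.negMulLog (1 - p + p * Q.real (cell m 0))
          - Real.negMulLog (p * Q.real (cell m 0))))
  rw [one_mul] at h1
  have e : (fun k : ℤ => Q.real (cell m k) * Real.negMulLog p
      + p * Real.negMulLog (Q.real (cell m k))
      + if k = 0 then Real.negMulLog (1 - p + p * Q.real (cell m 0))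
          - Real.negMulLog (p * Q.real (cell m 0)) else 0)
      = fun k => Real.negMulLog (ρ.real (cell m k)) := by
    funext k
    rw [measureReal_cell_mixture hp0 hp1 h, ← Real.negMulLog_mul]
    by_cases hk : k = 0
    · subst hk
      simp
    · simp [hk]
  rw [e] at h1
  have h0 : ∀ k, 0 ≤ Real.negMulLog (ρ.real (cell m k)) := fun k =>
    Real.negMulLog_nonneg measureReal_nonneg measureReal_le_one
  rw [shannonEntropy_quantize hm, ← ENNReal.ofReal_tsum_of_nonneg h0 h1.summable, h1.tsum_eq]
  exact ⟨rfl, h1.tsum_eq ▸ tsum_nonneg h0⟩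

lemma tendsto_measureReal_cell_zero (hac : Q ≪ volume) :
    Tendsto (fun m => Q.real (cell m 0)) atTop (𝓝 0) := by
  have h : Tendsto (fun m => ∫ x, (cell m 0).indicator (fun _ => (1 : ℝ)) x ∂Q) atTop
      (𝓝 (∫ _, (0 : ℝ) ∂Q)) := by
    refine tendsto_integral_filter_of_dominated_convergence (fun _ => (1 : ℝ)) ?_ ?_
      (integrable_const _) ?_
    · filter_upwards with m
      exact (measurable_const.indicator (measurableSet_cell m 0)).aestronglyMeasurable
    · filter_upwards with m
      filter_upwards with x
      unfold Set.indicator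
      split_ifs <;> simp
    · have : ∀ᵐ x ∂Q, x ≠ 0 := hac.ae_le (Measure.ae_ne volume (0 : ℝ))
      filter_upwards [this] with x hx
      refine tendsto_const_nhds.congr' ?_
      have hx' : 0 < |x| := abs_pos.2 hx
      filter_upwards [eventually_gt_atTop (1 / |x|)] with m hm
      have hm0 : 0 < m := lt_trans (by positivity) hm
      rw [Set.indicator_of_notMem]
      intro hmem
      have h1 := abs_sub_center_le hm0 hmem
      rw [Int.cast_zero, zero_div, sub_zero, le_div_iff₀ (by positivity)] at h1
      rw [div_lt_iff₀ hx'] at hm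
      linarith
  have e : ∀ m, ∫ x, (cell m 0).indicator (fun _ => (1 : ℝ)) x ∂Q = Q.real (cell m 0) := fun m => by
    rw [integral_indicator (measurableSet_cell m 0)]
    simp
  simpa [e] using h

/-- As `m → 0` from above the central cell exhausts the line. Such a coarse resolution is where the
expansion will be shown to fail. -/
lemma exists_half_le_measureReal_cell (Q : Measure ℝ) [IsProbabilityMeasure Q] :
    ∃ m : ℝ, 0 < m ∧ 1 / 2 ≤ Q.real (cell m 0) := by
  have h : Tendsto (fun m => ∫ x, (cell m 0).indicator (fun _ => (1 : ℝ)) x ∂Q) (𝓝[>] 0)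
      (𝓝 (∫ _, (1 : ℝ) ∂Q)) := by
    refine tendsto_integral_filter_of_dominated_convergence (fun _ => (1 : ℝ)) ?_ ?_
      (integrable_const _) ?_
    · filter_upwards with m
      exact (measurable_const.indicator (measurableSet_cell m 0)).aestronglyMeasurable
    · filter_upwards with m
      filter_upwards with x
      unfold Set.indicator
      split_ifs <;> simp
    · filter_upwards with x
      refine tendsto_const_nhds.congr' ?_
      have ht : Tendsto (fun m : ℝ => m * x) (𝓝[>] 0) (𝓝 0) := by
        have : Tendsto (fun m : ℝ => m * x) (𝓝 0) (𝓝 (0 * x)) := tendsto_id.mul_const x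
        rw [zero_mul] at this
        exact this.mono_left nhdsWithin_le_nhds
      filter_upwards [ht.eventually (Ioo_mem_nhds (show (-(1 / 2) : ℝ) < 0 by norm_num)
        (show (0 : ℝ) < 1 / 2 by norm_num))] with m hm
      rw [Set.indicator_of_mem]
      rw [mem_cell, Int.floor_eq_iff]
      push_cast
      constructor <;> linarith [hm.1, hm.2]
  have e : ∀ m, ∫ x, (cell m 0).indicator (fun _ => (1 : ℝ)) x ∂Q = Q.real (cell m 0) := fun m => by
    rw [integral_indicator (measurableSet_cell m 0)]
    simp
  simp only [e, integral_const, probReal_univ, smul_eq_mul, mul_one] at h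
  obtain ⟨m, h1, h2⟩ := ((h.eventually_const_lt (show (1 / 2 : ℝ) < 1 by norm_num)).and
    self_mem_nhdsWithin).exists
  exact ⟨m, h2, h1.le⟩

end


/-! ### Entropy of the jump law -/

/-- The point is uniformity in `s`. Above, a single reference, the smoothing of `ρ`, serves all `s`
through the domination by `D • ρ`; below, convolving `ν` cannot increase the integral of
`posMulLog`. -/
lemma exists_bound_jumpLaw {ν : Measure ℝ} [IsProbabilityMeasure ν] (hac : ν ≪ volume)
    (hh : HasDiffEntropy ν) {lam : ℝ} (hl : 0 < lam) {ρ : Measure ℝ} [IsProbabilityMeasure ρ]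
    (h : ∀ u, charFun ρ u = Complex.exp (lam * (charFun ν u - 1)))
    (hfin : shannonEntropy ρ (quantize 1) < ∞) :
    ∃ C : ℝ, 0 ≤ C ∧ ∀ s, 0 < s → s ≤ lam → jumpLaw ν s ≪ volume ∧
      |diffEntropy (jumpLaw ν s)| ≤ C ∧
      Tendsto (fun m => (shannonEntropy (jumpLaw ν s) (quantize m)).toReal - Real.log m) atTop
        (𝓝 (diffEntropy (jumpLaw ν s))) ∧
      ∀ m, 0 < m → shannonEntropy (jumpLaw ν s) (quantize m) ≠ ∞ ∧
        (shannonEntropy (jumpLaw ν s) (quantize m)).toReal ≤ Real.log m + C + 1 / m := by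
  set D := Real.exp lam / lam with hD
  have hD0 : 0 ≤ D := by positivity
  set U := D * (∫ x, -Real.log (laplaceSmoothing ρ x) ∂ρ) + (∫ x, laplaceSmoothing ρ x) - 1
  set W := ∫ x, posMulLog (pdf ν x)
  refine ⟨|U| + |W|, by positivity, fun s hs hsl => ?_⟩
  have := isProbabilityMeasure_residualLaw (ν := ν) hs
  have := isProbabilityMeasure_jumpLaw (ν := ν) hs
  have hle := jumpLaw_le_compoundPoisson hs hsl h
  have hr := isReference_laplaceSmoothing hfin hle
  have hU := integral_neg_log_laplaceSmoothing_le hfin hD0 hle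
  have hacQ : jumpLaw ν s ≪ volume := conv_absolutelyContinuous_left hac
  obtain ⟨hi, hiW⟩ := integrable_posMulLog_conv (κ := residualLaw ν s) hac hh
  have hhQ : HasDiffEntropy (jumpLaw ν s) :=
    hr.hasDiffEntropy hacQ hi.neg (Eventually.of_forall fun x => neg_posMulLog_le _)
  have h1 := hr.diffEntropy_le hacQ hhQ
  have h2 : -W ≤ diffEntropy (jumpLaw ν s) := by
    refine (neg_le_neg hiW).trans ?_
    rw [← integral_neg]
    exact integral_mono hi.neg hhQ fun x => neg_posMulLog_le _
  refine ⟨hacQ, ?_, hr.tendsto_shannonEntropy hacQ hhQ, fun m hm =>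
    ⟨hr.shannonEntropy_ne_top hacQ hhQ hm, ?_⟩⟩
  · rw [abs_le]
    constructor
    · linarith [le_abs_self W, abs_nonneg U]
    · linarith [le_abs_self U, abs_nonneg W]
  · have := hr.shannonEntropy_le hacQ hhQ hm
    linarith [le_abs_self U, abs_nonneg W]

/-! ### Elementary estimates -/

lemma negMulLog_one_sub_le {t : ℝ} (h1 : t ≤ 1) : Real.negMulLog (1 - t) ≤ t := by
  rcases h1.eq_or_lt with rfl | h1
  · simp
  · have hx : 0 < 1 - t := by linarith
    have h := Real.one_sub_inv_le_log_of_pos hx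
    have h2 := mul_le_mul_of_nonneg_left h hx.le
    rw [mul_sub, mul_inv_cancel₀ hx.ne'] at h2
    unfold Real.negMulLog
    linarith

lemma mul_exp_neg_le (s : ℝ) : s * Real.exp (-s) ≤ 1 - Real.exp (-s) := by
  have := mul_le_mul_of_nonneg_right (Real.add_one_le_exp s) (Real.exp_pos (-s)).le
  rw [← Real.exp_add, add_neg_cancel, Real.exp_zero] at this
  linarith

lemma one_sub_exp_neg_mem {s : ℝ} (hs : 0 < s) :
    0 < 1 - Real.exp (-s) ∧ 1 - Real.exp (-s) ≤ 1 ∧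
      Real.log s - s ≤ Real.log (1 - Real.exp (-s)) ∧
      Real.log (1 - Real.exp (-s)) ≤ Real.log s := by
  have h0 : 0 < 1 - Real.exp (-s) := by
    have := Real.exp_lt_one_iff.2 (neg_lt_zero.2 hs)
    linarith
  refine ⟨h0, by linarith [Real.exp_pos (-s)], ?_, ?_⟩
  · have := Real.log_le_log (by positivity) (mul_exp_neg_le s)
    rwa [Real.log_mul hs.ne' (Real.exp_pos _).ne', Real.log_exp, ← sub_eq_add_neg] at this
  · exact Real.log_le_log h0 (by linarith [Real.add_one_le_exp (-s)])

lemma tendsto_mixture_entropy {Q : Measure ℝ} [IsProbabilityMeasure Q] (hac : Q ≪ volume) {p c : ℝ}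
    (hp0 : 0 < p) {HQ : ℝ → ℝ} (h : Tendsto (fun m => HQ m - Real.log m) atTop (𝓝 c)) :
    Tendsto (fun m => (Real.negMulLog p + p * HQ m
        + (Real.negMulLog (1 - p + p * Q.real (cell m 0))
          - Real.negMulLog (p * Q.real (cell m 0)))) / p - Real.log m) atTop
      (𝓝 (-Real.log p + c + Real.negMulLog (1 - p) / p)) := by
  have hq := tendsto_measureReal_cell_zero hac
  have hpq : Tendsto (fun m => p * Q.real (cell m 0)) atTop (𝓝 0) := by
    simpa using hq.const_mul p
  have h1 : Tendsto (fun m => Real.negMulLog (1 - p + p * Q.real (cell m 0))) atTop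
      (𝓝 (Real.negMulLog (1 - p))) := by
    have := hpq.const_add (1 - p)
    rw [add_zero] at this
    exact (Real.continuous_negMulLog.tendsto _).comp this
  have h2 : Tendsto (fun m => Real.negMulLog (p * Q.real (cell m 0))) atTop (𝓝 0) := by
    have := (Real.continuous_negMulLog.tendsto 0).comp hpq
    rwa [Real.negMulLog_zero] at this
  have h3 := (h.const_add (-Real.log p)).add ((h1.sub h2).div_const p)
  rw [sub_zero] at h3
  refine h3.congr fun m => ?_
  rw [show Real.negMulLog p = -Real.log p * p by unfold Real.negMulLog; ring]
  field_simp
  ring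

/-- Merging the atom with a central cell of `Q`-mass `q ≥ r` saves at least `p r (-log p)` of the
cost `negMulLog p`, which leaves the factor `1 - r`. -/
lemma mixture_entropy_div_le {p q r HQ : ℝ} (hp0 : 0 < p) (hp1 : p ≤ 1) (hr : 0 < r) (hrq : r ≤ q)
    (hq1 : q ≤ 1) :
    (Real.negMulLog p + p * HQ + (Real.negMulLog (1 - p + p * q) - Real.negMulLog (p * q))) / p
      ≤ (1 - r) * -Real.log p + HQ + 1 := by
  have hq0 : 0 < q := hr.trans_le hrq
  have hlp : 0 ≤ -Real.log p := neg_nonneg.2 (Real.log_nonpos hp0.le hp1)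
  have hlq : Real.log q ≤ 0 := Real.log_nonpos hq0.le hq1
  have h1 : Real.negMulLog (1 - p + p * q) ≤ p := by
    have h0 : p * (1 - q) ≤ p := by nlinarith
    have := negMulLog_one_sub_le (t := p * (1 - q)) (h0.trans hp1)
    rw [show 1 - p + p * q = 1 - p * (1 - q) by ring]
    linarith
  have h2 : -Real.negMulLog (p * q) ≤ p * (q * Real.log p) := by
    unfold Real.negMulLog
    rw [Real.log_mul hp0.ne' hq0.ne']
    have : p * q * Real.log q ≤ 0 := mul_nonpos_of_nonneg_of_nonpos (by positivity) hlq
    nlinarith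
  rw [div_le_iff₀ hp0]
  have h3 : r * -Real.log p ≤ q * -Real.log p := mul_le_mul_of_nonneg_right hrq hlp
  have h4 := mul_le_mul_of_nonneg_left h3 hp0.le
  have h5 : Real.negMulLog p = p * -Real.log p := by unfold Real.negMulLog; ring
  rw [h5]
  nlinarith

/-! ### Quantization entropy of an impulsive Poisson noise -/

lemma poissonExponent_eq {ν : Measure ℝ} [IsProbabilityMeasure ν] (hac : ν ≪ volume) (lam w : ℝ) :
    poissonExponent lam ν w = lam * (charFun ν w - 1) := by
  have h0 : ∀ᵐ x ∂ν, x ∈ ({0} : Set ℝ)ᶜ := hac.ae_le (Measure.ae_ne volume (0 : ℝ))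
  have hi : Integrable (fun a : ℝ => Complex.exp (Complex.I * a * w)) ν := by
    refine (integrable_const (1 : ℝ)).mono' (by fun_prop) ?_
    filter_upwards with a
    rw [mul_assoc, ← Complex.ofReal_mul, mul_comm, Complex.norm_exp_ofReal_mul_I]
  rw [poissonExponent, Measure.restrict_eq_self_of_ae_mem h0, integral_sub hi (integrable_const _),
    charFun_apply_real]
  congr 2
  · refine integral_congr_ae ?_
    filter_upwards with a
    congr 1
    ring
  · simp

section

variable {Ω : Type*} [MeasurableSpace Ω] {P : Measure Ω} [IsProbabilityMeasure P]
  {X : Ω → 𝓢(ℝ, ℝ) →L[ℝ] ℝ} {lam : ℝ} {ν : Measure ℝ}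

/-- The quantization entropy of an impulsive Poisson noise. -/
theorem IsPoissonNoise.exists_entropy (h : IsPoissonNoise P X lam ν) (hac : ν ≪ volume)
    (hh : HasDiffEntropy ν)
    (hfin : shannonEntropy P (fun ω => quantize 1 (timeQuant P X 1 1 ω)) < ∞) :
    ∃ B r m₀ : ℝ, 0 < r ∧ 0 < m₀ ∧ ∀ n : ℕ, 0 < n → ∃ (H : ℝ → ℝ) (z : ℝ),
      (∀ m, 0 < m → quantEntropy P X m n = ENNReal.ofReal (n * H m) ∧ 0 ≤ H m) ∧
      Tendsto (fun m => H m / (1 - Real.exp (-lam / n)) - Real.log m) atTop (𝓝 z) ∧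
      |z - Real.log n| ≤ B ∧
      H m₀ / (1 - Real.exp (-lam / n)) ≤ B + (1 - r) * Real.log n := by
  have hl := h.rate
  have := h.prob
  have hexp : poissonExponent lam ν = fun w => (lam : ℂ) * (charFun ν w - 1) :=
    funext fun w => poissonExponent_eq hac lam w
  have hcont : Continuous (poissonExponent lam ν) := by
    rw [hexp]
    fun_prop
  have h0 : poissonExponent lam ν 0 = 0 := by simp [hexp]
  have hmeas : ∀ n : ℕ, 0 < n → Measurable (timeQuant P X n 1) := fun n hn =>
    (h.noise.isPairing_timeQuant hcont h0 hn 1).1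
  have hcf : ∀ (n : ℕ), 0 < n → ∀ u, charFun (P.map (timeQuant P X n 1)) u
      = Complex.exp ((lam / n : ℝ) * (charFun ν u - 1)) := fun n hn u => by
    rw [h.noise.charFun_timeQuant hcont h0 hn 1, hexp]
    congr 1
    push_cast
    ring
  have hprob : ∀ n : ℕ, 0 < n → IsProbabilityMeasure (P.map (timeQuant P X n 1)) := fun n hn =>
    Measure.isProbabilityMeasure_map (hmeas n hn).aemeasurable
  have := hprob 1 one_pos
  rw [← shannonEntropy_map (hmeas 1 one_pos) (measurable_quantize 1)] at hfin
  obtain ⟨C, hC, hQ⟩ := exists_bound_jumpLaw hac hh hl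
    (fun u => by simpa using hcf 1 one_pos u) hfin
  obtain ⟨m₀, hm₀, hν⟩ := exists_half_le_measureReal_cell ν
  have hB : 0 ≤ |Real.log lam| + lam := by positivity
  -- `|log lam| + lam` bounds `-log p - log n`, `C` bounds the entropy of the jump law, and `1`
  -- bounds `negMulLog (1 - p) / p`; the rest comes from evaluating at `m₀`. The fraction `r` is
  -- half of `exp (-lam)`, the share of `ν` in every jump law.
  refine ⟨|Real.log lam| + lam + C + 1 + |Real.log m₀| + 1 / m₀, Real.exp (-lam) / 2, m₀,
    by positivity, hm₀, fun n hn => ?_⟩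
  have hn1 : (1 : ℝ) ≤ n := by exact_mod_cast hn
  have hn' : (0 : ℝ) < n := by linarith
  set s := lam / n with hs
  have hs0 : 0 < s := by positivity
  have hsl : s ≤ lam := div_le_self hl.le hn1
  rw [show -lam / (n : ℝ) = -s by rw [hs]; ring]
  obtain ⟨hp0, hp1, hlp1, hlp2⟩ := one_sub_exp_neg_mem hs0
  have hρ := @compoundPoisson_eq ν _ s _ (hprob n hn) hs0 (hcf n hn)
  set p := 1 - Real.exp (-s) with hp
  rw [show Real.exp (-s) = 1 - p by rw [hp]; ring] at hρ
  have := isProbabilityMeasure_jumpLaw (ν := ν) hs0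
  obtain ⟨hacQ, hdQ, htQ, hmQ⟩ := hQ s hs0 hsl
  have := hprob n hn
  have hlog : |-Real.log p - Real.log n| ≤ |Real.log lam| + lam := by
    have e : Real.log s = Real.log lam - Real.log n := Real.log_div hl.ne' hn'.ne'
    rw [abs_le]
    constructor
    · linarith [le_abs_self (Real.log lam)]
    · linarith [neg_abs_le (Real.log lam)]
  have hrq : Real.exp (-lam) / 2 ≤ (jumpLaw ν s).real (cell m₀ 0) := by
    have h1 := le_jumpLaw (ν := ν) hs0 (cell m₀ 0)
    rw [Measure.smul_apply, smul_eq_mul] at h1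
    have h2 := ENNReal.toReal_mono (measure_ne_top _ _) h1
    rw [ENNReal.toReal_mul, ENNReal.toReal_ofReal (Real.exp_pos _).le] at h2
    have h3 : Real.exp (-lam) ≤ Real.exp (-s) := Real.exp_le_exp.2 (by linarith)
    have h4 : Real.exp (-lam) * (1 / 2) ≤ Real.exp (-s) * (ν (cell m₀ 0)).toReal :=
      mul_le_mul h3 hν (by norm_num) (Real.exp_pos _).le
    rw [measureReal_def]
    linarith
  refine ⟨fun m => Real.negMulLog p + p * (shannonEntropy (jumpLaw ν s) (quantize m)).toReal
        + (Real.negMulLog (1 - p + p * (jumpLaw ν s).real (cell m 0))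
          - Real.negMulLog (p * (jumpLaw ν s).real (cell m 0))),
    -Real.log p + diffEntropy (jumpLaw ν s) + Real.negMulLog (1 - p) / p, fun m hm => ?_,
    tendsto_mixture_entropy hacQ hp0 htQ, ?_, ?_⟩
  · obtain ⟨e1, e2⟩ := shannonEntropy_mixture hp0.le hp1 hρ hm (hmQ m hm).1
    refine ⟨?_, e2⟩
    rw [h.noise.quantEntropy_eq hcont h0 hn, e1, ENNReal.ofReal_mul hn'.le, ENNReal.ofReal_natCast]
  · have h1 : 0 ≤ Real.negMulLog (1 - p) / p :=
      div_nonneg (Real.negMulLog_nonneg (by linarith) (by linarith)) hp0.le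
    have h2 : Real.negMulLog (1 - p) / p ≤ 1 := by
      rw [div_le_one hp0]
      exact negMulLog_one_sub_le hp1
    have h3 : 0 ≤ |Real.log m₀| := abs_nonneg _
    have h4 : 0 ≤ 1 / m₀ := by positivity
    rw [abs_le] at hlog hdQ ⊢
    constructor <;> linarith [hlog.1, hlog.2, hdQ.1, hdQ.2]
  · have h1 := mixture_entropy_div_le (HQ := (shannonEntropy (jumpLaw ν s) (quantize m₀)).toReal)
      hp0 hp1 (by positivity) hrq measureReal_le_one
    have h2 := (hmQ m₀ hm₀).2
    have h3 : Real.exp (-lam) / 2 ≤ 1 := hrq.trans measureReal_le_one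
    have h4 : (1 - Real.exp (-lam) / 2) * (-Real.log p - Real.log n) ≤ |Real.log lam| + lam := by
      refine (mul_le_mul_of_nonneg_left ((le_abs_self _).trans hlog) (by linarith)).trans ?_
      exact mul_le_of_le_one_left hB (by linarith [Real.exp_pos (-lam)])
    have h5 := le_abs_self (Real.log m₀)
    linarith

end


/-! ### Thresholds in terms of real-valued entropies -/

lemma abs_coe_div_sub {E κ x : ℝ} (hE : 0 ≤ E) :
    (((ENNReal.ofReal E : ℝ≥0∞) : EReal) / (κ : EReal) - (x : EReal)).abs
      = ENNReal.ofReal |E / κ - x| := by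
  rw [EReal.coe_ennreal_ofReal, max_eq_left hE, ← EReal.coe_div, ← EReal.coe_sub, EReal.abs_def]

section

variable {Ω : Type*} [MeasurableSpace Ω] {P : Measure Ω} {X : Ω → 𝓢(ℝ, ℝ) →L[ℝ] ℝ}
  {H : ℕ → ℝ → ℝ}

lemma hasExpansion_iff
    (hH : ∀ n : ℕ, 0 < n → ∀ m, 0 < m → quantEntropy P X m n = ENNReal.ofReal (n * H n m) ∧ 0 ≤ H n m)
    {κ p ζ a : ℕ → ℝ} (hκ : ∀ n, κ n = n * p n) (ha : ∀ n, 0 < a n) :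
    HasExpansion P X κ ζ a ↔ ∀ ε, 0 < ε → ∀ᶠ n in atTop, ∀ m, a n ≤ m →
      |H n m / p n - Real.log m - ζ n| ≤ ε := by
  have key : ∀ n : ℕ, 0 < n → ∀ m, a n ≤ m →
      ((quantEntropy P X m n : EReal) / (κ n : EReal) - ((Real.log m + ζ n : ℝ) : EReal)).abs
        = ENNReal.ofReal |H n m / p n - Real.log m - ζ n| := fun n hn m hm => by
    obtain ⟨h1, h2⟩ := hH n hn m ((ha n).trans_le hm)
    have hn' : (n : ℝ) ≠ 0 := by exact_mod_cast hn.ne'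
    rw [h1, abs_coe_div_sub (by positivity), hκ, mul_div_mul_left _ _ hn', sub_add_eq_sub_sub]
  rw [HasExpansion, ENNReal.tendsto_nhds_zero]
  constructor
  · intro h ε hε
    filter_upwards [h (ENNReal.ofReal ε) (ENNReal.ofReal_pos.2 hε), eventually_gt_atTop 0]
      with n h1 hn m hm
    have h2 := (le_iSup₂ (f := fun m (_ : m ∈ Set.Ici (a n)) =>
      ((quantEntropy P X m n : EReal) / (κ n : EReal) - ((Real.log m + ζ n : ℝ) : EReal)).abs)
      m hm).trans h1
    rw [key n hn m hm] at h2
    exact (ENNReal.ofReal_le_ofReal_iff hε.le).1 h2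
  · intro h ε hε
    obtain ⟨δ, h1, h2⟩ := ENNReal.lt_iff_exists_nnreal_btwn.1 hε
    filter_upwards [h δ (by exact_mod_cast h1), eventually_gt_atTop 0] with n h3 hn
    refine iSup₂_le fun m hm => ?_
    rw [key n hn m hm]
    refine (ENNReal.ofReal_le_ofReal (h3 m hm)).trans ?_
    rw [ENNReal.ofReal_coe_nnreal]
    exact h2.le

/-- For each fixed `n` the limit in `m` lets `a n` be chosen so that the error is at most `1/(n+1)`
from there on. -/
lemma exists_threshold {p z : ℕ → ℝ}
    (ht : ∀ n : ℕ, 0 < n → Tendsto (fun m => H n m / p n - Real.log m) atTop (𝓝 (z n))) :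
    ∃ a : ℕ → ℝ, (∀ n, 0 < a n) ∧ ∀ ε, 0 < ε → ∀ᶠ n in atTop, ∀ m, a n ≤ m →
      |H n m / p n - Real.log m - z n| ≤ ε := by
  have h : ∀ n : ℕ, ∃ a : ℝ, 0 < a ∧ (0 < n → ∀ m, a ≤ m →
      |H n m / p n - Real.log m - z n| ≤ 1 / ((n : ℝ) + 1)) := fun n => by
    rcases n.eq_zero_or_pos with rfl | hn
    · exact ⟨1, one_pos, fun h => absurd h (lt_irrefl _)⟩
    · obtain ⟨b, hb⟩ := eventually_atTop.1 ((Metric.tendsto_nhds.1 (ht n hn)) (1 / ((n : ℝ) + 1))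
        (by positivity))
      refine ⟨max b 1, by positivity, fun _ m hm => ?_⟩
      have := hb m ((le_max_left _ _).trans hm)
      rw [Real.dist_eq] at this
      exact this.le
  choose a ha h using h
  refine ⟨a, ha, fun ε hε => ?_⟩
  filter_upwards [tendsto_one_div_add_atTop_nhds_zero_nat.eventually_lt_const hε,
    eventually_gt_atTop 0] with n h1 hn m hm
  exact (h n hn m hm).trans h1.le

/-- Letting `m → ∞` pins any admissible `ζ` to the true limit, so nothing about an arbitrary
threshold depends on which `ζ` witnesses it. -/
lemma abs_limit_sub_le {h : ℝ → ℝ} {z ζ a ε : ℝ}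
    (ht : Tendsto (fun m => h m - Real.log m) atTop (𝓝 z))
    (hb : ∀ m, a ≤ m → |h m - Real.log m - ζ| ≤ ε) : |z - ζ| ≤ ε := by
  refine le_of_tendsto (ht.sub_const ζ).abs ?_
  filter_upwards [eventually_ge_atTop a] with m hm using hb m hm

end

lemma tendsto_iSup_sub_nhds_bot {h₁ h₂ : ℝ → ℕ → ℝ≥0∞} {E₁ E₂ : ℕ → ℝ → ℝ} {a g : ℕ → ℝ}
    (hE : ∀ᶠ n in atTop, ∀ m, a n ≤ m → (h₁ m n = ENNReal.ofReal (E₁ n m) ∧ 0 ≤ E₁ n m) ∧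
      (h₂ m n = ENNReal.ofReal (E₂ n m) ∧ 0 ≤ E₂ n m) ∧ E₁ n m - E₂ n m ≤ g n)
    (hg : Tendsto g atTop atBot) :
    Tendsto (fun n => ⨆ m ∈ Set.Ici (a n), ((h₁ m n : EReal) - (h₂ m n : EReal))) atTop (𝓝 ⊥) := by
  rw [EReal.tendsto_nhds_bot_iff_real]
  intro x
  filter_upwards [hE, hg.eventually_lt_atBot x] with n h1 h2
  refine lt_of_le_of_lt (iSup₂_le fun m hm => ?_) (EReal.coe_lt_coe_iff.2 h2)
  obtain ⟨⟨e1, p1⟩, ⟨e2, p2⟩, h3⟩ := h1 m hm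
  rw [e1, e2, EReal.coe_ennreal_ofReal, EReal.coe_ennreal_ofReal, max_eq_left p1, max_eq_left p2,
    ← EReal.coe_sub]
  exact EReal.coe_le_coe_iff.2 h3

/-! ### Comparison of stable noises -/

section

variable {Ω₁ Ω₂ : Type*} [MeasurableSpace Ω₁] [MeasurableSpace Ω₂]
  {P₁ : Measure Ω₁} {P₂ : Measure Ω₂} [IsProbabilityMeasure P₁] [IsProbabilityMeasure P₂]
  {X₁ : Ω₁ → 𝓢(ℝ, ℝ) →L[ℝ] ℝ} {X₂ : Ω₂ → 𝓢(ℝ, ℝ) →L[ℝ] ℝ}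

theorem IsStableNoise.exists_isContinuousThreshold {α β σ μ : ℝ} (h : IsStableNoise P₁ X₁ α β σ μ) :
    ∃ a, IsContinuousThreshold P₁ X₁ a := by
  obtain ⟨c, hc⟩ := h.exists_entropy
  choose! hd H hH using hc
  obtain ⟨a, ha, h1⟩ := exists_threshold (H := H) (p := fun _ => 1)
    (z := fun n => diffEntropy (P₁.map (timeQuant P₁ X₁ n 1)))
    (fun n hn => by simpa using (hH n hn).2)
  exact ⟨a, ha, (hasExpansion_iff (fun n hn => (hH n hn).1) (fun n => (mul_one (n : ℝ)).symm) ha).2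
    h1⟩

theorem IsStableNoise.compare {α₁ β₁ σ₁ μ₁ α₂ β₂ σ₂ μ₂ : ℝ}
    (h₁ : IsStableNoise P₁ X₁ α₁ β₁ σ₁ μ₁) (h₂ : IsStableNoise P₂ X₂ α₂ β₂ σ₂ μ₂) (hα : α₁ < α₂)
    {a₁ a₂ a : ℕ → ℝ} (t₁ : IsContinuousThreshold P₁ X₁ a₁) (t₂ : IsContinuousThreshold P₂ X₂ a₂)
    (ha : ∀ n, max (a₁ n) (a₂ n) ≤ a n) :
    limsup (fun n => ⨆ m ∈ Set.Ici (a n), quantEntropy P₁ X₁ m n / quantEntropy P₂ X₂ m n) atTop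
      ≤ 1 ∧
    Tendsto (fun n => ⨆ m ∈ Set.Ici (a n),
      ((quantEntropy P₁ X₁ m n : EReal) - (quantEntropy P₂ X₂ m n : EReal))) atTop (𝓝 ⊥) := by
  obtain ⟨c₁, hc₁⟩ := h₁.exists_entropy
  obtain ⟨c₂, hc₂⟩ := h₂.exists_entropy
  choose! d₁ H₁ hH₁ using hc₁
  choose! d₂ H₂ hH₂ using hc₂
  have b₁ := (hasExpansion_iff (fun n hn => (hH₁ n hn).1) (fun n => (mul_one (n : ℝ)).symm)
    t₁.1).1 t₁.2 1 one_pos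
  have b₂ := (hasExpansion_iff (fun n hn => (hH₂ n hn).1) (fun n => (mul_one (n : ℝ)).symm)
    t₂.1).1 t₂.2 1 one_pos
  set δ := 1 / α₁ - 1 / α₂ with hδ
  have hδ0 : 0 < δ := sub_pos.2 (one_div_lt_one_div_of_lt h₁.stability.1 hα)
  have hlog : Tendsto (fun n : ℕ => Real.log n) atTop atTop :=
    Real.tendsto_log_atTop.comp tendsto_natCast_atTop_atTop
  -- The `2` collects an error of one from each expansion; `log m` has cancelled.
  set g : ℕ → ℝ := fun n => c₁ - c₂ + 2 - δ * Real.log n with hg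
  have hgt : Tendsto g atTop atBot := by
    have h := tendsto_atBot_add_const_left atTop (c₁ - c₂ + 2)
      (tendsto_neg_atTop_atBot.comp (hlog.const_mul_atTop hδ0))
    refine h.congr fun n => ?_
    simp only [hg, Function.comp]
    ring
  have key : ∀ᶠ n in atTop, ∀ m, a n ≤ m →
      (quantEntropy P₁ X₁ m n = ENNReal.ofReal (n * H₁ n m) ∧ 0 ≤ (n : ℝ) * H₁ n m) ∧
      (quantEntropy P₂ X₂ m n = ENNReal.ofReal (n * H₂ n m) ∧ 0 ≤ (n : ℝ) * H₂ n m) ∧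
      (n : ℝ) * H₁ n m - n * H₂ n m ≤ n * g n := by
    filter_upwards [b₁, b₂, eventually_gt_atTop 0] with n e1 e2 hn m hm
    have m1 := (le_max_left (a₁ n) (a₂ n)).trans ((ha n).trans hm)
    have m2 := (le_max_right (a₁ n) (a₂ n)).trans ((ha n).trans hm)
    obtain ⟨q1, r1⟩ := (hH₁ n hn).1 m ((t₁.1 n).trans_le m1)
    obtain ⟨q2, r2⟩ := (hH₂ n hn).1 m ((t₂.1 n).trans_le m2)
    have f1 := (abs_le.1 (e1 m m1)).2
    have f2 := (abs_le.1 (e2 m m2)).1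
    rw [d₁ n hn, div_one] at f1
    rw [d₂ n hn, div_one] at f2
    refine ⟨⟨q1, by positivity⟩, ⟨q2, by positivity⟩, ?_⟩
    rw [← mul_sub]
    refine mul_le_mul_of_nonneg_left ?_ (Nat.cast_nonneg n)
    simp only [hg, hδ]
    linarith
  refine ⟨limsup_le_of_le (h := ?_), tendsto_iSup_sub_nhds_bot key
    (tendsto_natCast_atTop_atTop.atTop_mul_atBot₀ hgt)⟩
  -- Once `g n ≤ 0` the first entropy is at most the second for every admissible `m`, so the ratio
  -- is at most one.
  filter_upwards [key, hgt.eventually_le_atBot 0] with n k hn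
  refine iSup₂_le fun m hm => ?_
  obtain ⟨⟨q1, -⟩, ⟨q2, -⟩, h3⟩ := k m hm
  refine ENNReal.div_le_of_le_mul ?_
  rw [one_mul, q1, q2]
  refine ENNReal.ofReal_le_ofReal ?_
  have := mul_nonpos_of_nonneg_of_nonpos (Nat.cast_nonneg (α := ℝ) n) hn
  linarith

end

/-! ### Comparison of impulsive Poisson noises -/

lemma tendsto_natCast_mul_one_sub_exp (lam : ℝ) :
    Tendsto (fun n : ℕ => (n : ℝ) * (1 - Real.exp (-lam / n))) atTop (𝓝 lam) := by
  have h1 : Tendsto (fun n : ℕ => lam * Real.exp (-lam / n)) atTop (𝓝 lam) := by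
    have h2 : Tendsto (fun n : ℕ => -lam / (n : ℝ)) atTop (𝓝 0) :=
      tendsto_const_nhds.div_atTop tendsto_natCast_atTop_atTop
    simpa using ((Real.continuous_exp.tendsto 0).comp h2).const_mul lam
  refine tendsto_of_tendsto_of_tendsto_of_le_of_le' h1 tendsto_const_nhds ?_ ?_
  · filter_upwards [eventually_gt_atTop 0] with n hn
    have hn' : (0 : ℝ) < n := by exact_mod_cast hn
    have := mul_le_mul_of_nonneg_left (mul_exp_neg_le (lam / n)) hn'.le
    rwa [← mul_assoc, mul_div_cancel₀ _ hn'.ne', ← neg_div] at this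
  · filter_upwards [eventually_gt_atTop 0] with n hn
    have hn' : (0 : ℝ) < n := by exact_mod_cast hn
    have h3 : 1 - Real.exp (-lam / n) ≤ lam / n := by
      have := Real.add_one_le_exp (-lam / n)
      rw [neg_div] at this ⊢
      linarith
    have := mul_le_mul_of_nonneg_left h3 hn'.le
    rwa [mul_div_cancel₀ _ hn'.ne'] at this

lemma one_sub_exp_div_pos {lam : ℝ} (hl : 0 < lam) {n : ℕ} (hn : 0 < n) :
    0 < 1 - Real.exp (-lam / n) := by
  have hn' : (0 : ℝ) < n := by exact_mod_cast hn
  have := (one_sub_exp_neg_mem (s := lam / n) (by positivity)).1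
  rwa [← neg_div] at this

lemma tendsto_log_natCast : Tendsto (fun n : ℕ => Real.log n) atTop atTop :=
  Real.tendsto_log_atTop.comp tendsto_natCast_atTop_atTop

section

variable {Ω : Type*} [MeasurableSpace Ω] {P : Measure Ω} [IsProbabilityMeasure P]
  {X : Ω → 𝓢(ℝ, ℝ) →L[ℝ] ℝ} {lam : ℝ} {ν : Measure ℝ}

theorem IsPoissonNoise.exists_isPoissonThreshold (h : IsPoissonNoise P X lam ν) (hac : ν ≪ volume)
    (hh : HasDiffEntropy ν)
    (hfin : shannonEntropy P (fun ω => quantize 1 (timeQuant P X 1 1 ω)) < ∞) :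
    ∃ a, IsPoissonThreshold P X lam a := by
  obtain ⟨B, r, m₀, hr, hm₀, hc⟩ := h.exists_entropy hac hh hfin
  choose! H z hH ht hz _ using hc
  obtain ⟨a, ha, h1⟩ := exists_threshold (p := fun n => 1 - Real.exp (-lam / n)) ht
  have hB : 0 ≤ B := (abs_nonneg _).trans (hz 1 one_pos)
  -- Once `log n ≥ 2B`, the limit `z n` lies between `(log n)/2` and `2 log n`. The earlier values
  -- do not affect the expansion and are set to `log n`, which respects the bounds even at `n = 1`,
  -- where they force zero.
  refine ⟨a, ha, fun n => if 2 * B ≤ Real.log n then z n else Real.log n,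
    ⟨1 / 2, 2, by norm_num, by norm_num, fun n hn => ?_⟩, ?_⟩
  · have h0 : 0 ≤ Real.log n := Real.log_natCast_nonneg n
    have h2 := abs_le.1 (hz n hn)
    dsimp only
    split_ifs with h3
    · constructor <;> linarith [h2.1, h2.2]
    · constructor <;> linarith
  · refine (hasExpansion_iff hH (fun _ => rfl) ha).2 fun ε hε => ?_
    filter_upwards [h1 ε hε, tendsto_log_natCast.eventually_ge_atTop (2 * B)] with n h2 h3 m hm
    rw [if_pos h3]
    exact h2 m hm

/-- Above a threshold, the quantization entropy is `κ(n) (log m + log n + O(1))`. -/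
theorem IsPoissonNoise.exists_entropy_bound (h : IsPoissonNoise P X lam ν) (hac : ν ≪ volume)
    (hh : HasDiffEntropy ν)
    (hfin : shannonEntropy P (fun ω => quantize 1 (timeQuant P X 1 1 ω)) < ∞) {a : ℕ → ℝ}
    (ha : IsPoissonThreshold P X lam a) :
    ∃ B m₀ : ℝ, 0 ≤ B ∧ 0 < m₀ ∧ ∀ᶠ n : ℕ in atTop, ∀ m, a n ≤ m → m₀ ≤ m ∧
      ∃ e : ℝ, |e| ≤ B ∧ 0 ≤ n * (1 - Real.exp (-lam / n)) * (Real.log m + Real.log n + e) ∧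
        quantEntropy P X m n = ENNReal.ofReal
          (n * (1 - Real.exp (-lam / n)) * (Real.log m + Real.log n + e)) := by
  obtain ⟨B, r, m₀, hr, hm₀, hc⟩ := h.exists_entropy hac hh hfin
  choose! H z hH ht hz hu using hc
  obtain ⟨ha0, ζ, -, hexp⟩ := ha
  have b := (hasExpansion_iff hH (fun _ => rfl) ha0).1 hexp 1 one_pos
  have hB : 0 ≤ B := (abs_nonneg _).trans (hz 1 one_pos)
  -- One unit for the error of the expansion and one for the distance between `ζ n` and the true
  -- limit.
  refine ⟨B + 2, m₀, by linarith, hm₀, ?_⟩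
  filter_upwards [b, eventually_gt_atTop 0,
    (tendsto_log_natCast.const_mul_atTop hr).eventually_gt_atTop (2 * B + 2 - Real.log m₀)]
    with n h1 hn h2 m hm
  have h3 := abs_le.1 (abs_limit_sub_le (ht n hn) h1)
  have h4 := abs_le.1 (hz n hn)
  -- Were `a n < m₀`, the expansion at `m₀` would make the normalized entropy at least `log m₀ + log
  -- n - B - 2`, whereas it is at most `B + (1 - r) log n`.
  have hlt : m₀ ≤ a n := by
    by_contra! hlt
    have h5 := (abs_le.1 (h1 m₀ hlt.le)).1
    have h6 := hu n hn
    linarith [h3.2, h4.1]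
  have hp := one_sub_exp_div_pos h.rate hn
  have e1 : n * (1 - Real.exp (-lam / n)) * (Real.log m + Real.log n
      + (H n m / (1 - Real.exp (-lam / n)) - Real.log m - Real.log n)) = n * H n m := by
    rw [show ∀ u v w : ℝ, u + v + (w - u - v) = w from fun u v w => by ring, mul_assoc,
      mul_div_cancel₀ _ hp.ne']
  obtain ⟨q, hq⟩ := hH n hn m ((ha0 n).trans_le hm)
  refine ⟨hlt.trans hm, H n m / (1 - Real.exp (-lam / n)) - Real.log m - Real.log n, ?_, ?_, ?_⟩
  · have h5 := abs_le.1 (h1 m hm)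
    rw [abs_le]
    constructor <;> linarith [h3.1, h3.2, h4.1, h4.2, h5.1, h5.2]
  · rw [e1]
    positivity
  · rw [e1, q]

end

lemma abs_div_sub_div_le {k₁ k₂ x e₁ e₂ B L : ℝ} (hk₁ : 0 ≤ k₁) (hk₂ : 0 < k₂) (hL : B < L)
    (hx : L ≤ x) (h₁ : |e₁| ≤ B) (h₂ : |e₂| ≤ B) :
    |k₁ * (x + e₁) / (k₂ * (x + e₂)) - k₁ / k₂| ≤ k₁ / k₂ * (2 * B / (L - B)) := by
  have hB : 0 ≤ B := (abs_nonneg _).trans h₁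
  have hx2 : L - B ≤ x + e₂ := by linarith [(abs_le.1 h₂).1]
  have hx0 : 0 < x + e₂ := by linarith
  have e : k₁ * (x + e₁) / (k₂ * (x + e₂)) - k₁ / k₂ = k₁ / k₂ * ((e₁ - e₂) / (x + e₂)) := by
    field_simp
    ring
  rw [e, abs_mul, abs_of_nonneg (by positivity : 0 ≤ k₁ / k₂), abs_div, abs_of_pos hx0]
  refine mul_le_mul_of_nonneg_left ?_ (by positivity)
  refine div_le_div₀ (by positivity) ?_ (by linarith) hx2
  calc |e₁ - e₂| ≤ |e₁| + |e₂| := abs_sub _ _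
    _ ≤ 2 * B := by linarith

section

variable {Ω₁ Ω₂ : Type*} [MeasurableSpace Ω₁] [MeasurableSpace Ω₂]
  {P₁ : Measure Ω₁} {P₂ : Measure Ω₂} [IsProbabilityMeasure P₁] [IsProbabilityMeasure P₂]
  {X₁ : Ω₁ → 𝓢(ℝ, ℝ) →L[ℝ] ℝ} {X₂ : Ω₂ → 𝓢(ℝ, ℝ) →L[ℝ] ℝ}

/-- Both entropies are `kᵢ (x + O(1))` with the same `x = log m + log n`, and `x ≥ L n → ∞` for all
admissible `m`. The ratio is thus uniformly close to `k₁/k₂`. -/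
theorem IsPoissonNoise.compare {lam₁ lam₂ : ℝ} {ν₁ ν₂ : Measure ℝ}
    (h₁ : IsPoissonNoise P₁ X₁ lam₁ ν₁) (h₂ : IsPoissonNoise P₂ X₂ lam₂ ν₂)
    (hac₁ : ν₁ ≪ volume) (hac₂ : ν₂ ≪ volume) (hh₁ : HasDiffEntropy ν₁) (hh₂ : HasDiffEntropy ν₂)
    (hfin₁ : shannonEntropy P₁ (fun ω => quantize 1 (timeQuant P₁ X₁ 1 1 ω)) < ∞)
    (hfin₂ : shannonEntropy P₂ (fun ω => quantize 1 (timeQuant P₂ X₂ 1 1 ω)) < ∞)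
    (hlam : lam₁ < lam₂) {a₁ a₂ a : ℕ → ℝ} (t₁ : IsPoissonThreshold P₁ X₁ lam₁ a₁)
    (t₂ : IsPoissonThreshold P₂ X₂ lam₂ a₂) (ha : ∀ n, max (a₁ n) (a₂ n) ≤ a n) :
    Tendsto (fun n => ⨆ m ∈ Set.Ici (a n), quantEntropy P₁ X₁ m n / quantEntropy P₂ X₂ m n) atTop
      (𝓝 (ENNReal.ofReal (lam₁ / lam₂))) ∧
    Tendsto (fun n => ⨆ m ∈ Set.Ici (a n),
      ((quantEntropy P₁ X₁ m n : EReal) - (quantEntropy P₂ X₂ m n : EReal))) atTop (𝓝 ⊥) := by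
  obtain ⟨B₁, m₁, hB₁, hm₁, b₁⟩ := h₁.exists_entropy_bound hac₁ hh₁ hfin₁ t₁
  obtain ⟨B₂, m₂, hB₂, hm₂, b₂⟩ := h₂.exists_entropy_bound hac₂ hh₂ hfin₂ t₂
  set k₁ : ℕ → ℝ := fun n => n * (1 - Real.exp (-lam₁ / n)) with hk₁
  set k₂ : ℕ → ℝ := fun n => n * (1 - Real.exp (-lam₂ / n)) with hk₂
  have l₁ : Tendsto k₁ atTop (𝓝 lam₁) := tendsto_natCast_mul_one_sub_exp lam₁
  have l₂ : Tendsto k₂ atTop (𝓝 lam₂) := tendsto_natCast_mul_one_sub_exp lam₂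
  set B := max B₁ B₂
  set L : ℕ → ℝ := fun n => Real.log m₁ + Real.log n
  have hL : Tendsto L atTop atTop := tendsto_atTop_add_const_left _ _ tendsto_log_natCast
  have key : ∀ᶠ n in atTop, ∀ m, a n ≤ m → ∃ x e₁ e₂ : ℝ, L n ≤ x ∧ |e₁| ≤ B ∧ |e₂| ≤ B ∧
      (quantEntropy P₁ X₁ m n = ENNReal.ofReal (k₁ n * (x + e₁)) ∧ 0 ≤ k₁ n * (x + e₁)) ∧
      (quantEntropy P₂ X₂ m n = ENNReal.ofReal (k₂ n * (x + e₂)) ∧ 0 ≤ k₂ n * (x + e₂)) := by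
    filter_upwards [b₁, b₂] with n c1 c2 m hm
    obtain ⟨d1, e₁, f1, g1, q1⟩ := c1 m ((le_max_left _ _).trans ((ha n).trans hm))
    obtain ⟨-, e₂, f2, g2, q2⟩ := c2 m ((le_max_right _ _).trans ((ha n).trans hm))
    exact ⟨Real.log m + Real.log n, e₁, e₂, by linarith [Real.log_le_log hm₁ d1],
      f1.trans (le_max_left _ _), f2.trans (le_max_right _ _), ⟨q1, g1⟩, ⟨q2, g2⟩⟩
  constructor
  · set η : ℕ → ℝ := fun n => k₁ n / k₂ n * (2 * B / (L n - B)) with hη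
    have hr : Tendsto (fun n => k₁ n / k₂ n) atTop (𝓝 (lam₁ / lam₂)) := l₁.div l₂ h₂.rate.ne'
    have hηt : Tendsto η atTop (𝓝 0) := by
      have := hr.mul ((tendsto_const_nhds (x := 2 * B)).div_atTop
        (tendsto_atTop_add_const_right atTop (-B) hL))
      simpa [← sub_eq_add_neg] using this
    have hlo : Tendsto (fun n => ENNReal.ofReal (k₁ n / k₂ n - η n)) atTop
        (𝓝 (ENNReal.ofReal (lam₁ / lam₂))) := by
      have := hr.sub hηt
      rw [sub_zero] at this
      exact ENNReal.tendsto_ofReal this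
    have hhi : Tendsto (fun n => ENNReal.ofReal (k₁ n / k₂ n + η n)) atTop
        (𝓝 (ENNReal.ofReal (lam₁ / lam₂))) := by
      have := hr.add hηt
      rw [add_zero] at this
      exact ENNReal.tendsto_ofReal this
    have hq : ∀ᶠ n in atTop, ∀ m, a n ≤ m →
        ENNReal.ofReal (k₁ n / k₂ n - η n) ≤ quantEntropy P₁ X₁ m n / quantEntropy P₂ X₂ m n ∧
        quantEntropy P₁ X₁ m n / quantEntropy P₂ X₂ m n ≤ ENNReal.ofReal (k₁ n / k₂ n + η n) := by
      filter_upwards [key, l₁.eventually_const_lt h₁.rate, l₂.eventually_const_lt h₂.rate,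
        hL.eventually_gt_atTop B] with n c p1 p2 hLB m hm
      obtain ⟨x, e₁, e₂, hx, f1, f2, ⟨q1, -⟩, ⟨q2, -⟩⟩ := c m hm
      have hpos : 0 < k₂ n * (x + e₂) :=
        mul_pos p2 (by linarith [(abs_le.1 f2).1])
      rw [q1, q2, ← ENNReal.ofReal_div_of_pos hpos]
      have := abs_le.1 (abs_div_sub_div_le p1.le p2 hLB hx f1 f2)
      exact ⟨ENNReal.ofReal_le_ofReal (by simp only [hη]; linarith [this.1]),
        ENNReal.ofReal_le_ofReal (by simp only [hη]; linarith [this.2])⟩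
    refine tendsto_of_tendsto_of_tendsto_of_le_of_le' hlo hhi ?_ ?_
    · filter_upwards [hq] with n h
      -- The supremum is bounded below by its value at `m = a n`.
      exact (h (a n) le_rfl).1.trans (le_iSup₂ (f := fun m (_ : m ∈ Set.Ici (a n)) =>
        quantEntropy P₁ X₁ m n / quantEntropy P₂ X₂ m n) (a n) Set.self_mem_Ici)
    · filter_upwards [hq] with n h
      exact iSup₂_le fun m hm => (h m hm).2
  -- Eventually `k₁ < k₂`, so `(k₁ - k₂) x` is largest at the lower bound `L n` of `x`, which
  -- removes the dependence on `m`.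
  · have hg : Tendsto (fun n => (k₁ n - k₂ n) * L n + (k₁ n + k₂ n) * B) atTop atBot :=
      ((l₁.sub l₂).neg_mul_atTop (sub_neg.2 hlam) hL).atBot_add ((l₁.add l₂).mul_const B)
    refine tendsto_iSup_sub_nhds_bot (E₁ := fun n m => (quantEntropy P₁ X₁ m n).toReal)
      (E₂ := fun n m => (quantEntropy P₂ X₂ m n).toReal) ?_ hg
    filter_upwards [key, l₁.eventually_const_lt h₁.rate, l₂.eventually_const_lt h₂.rate,
      (l₁.sub l₂).eventually_lt_const (sub_neg.2 hlam)] with n c p1 p2 h12 m hm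
    obtain ⟨x, e₁, e₂, hx, f1, f2, ⟨q1, r1⟩, ⟨q2, r2⟩⟩ := c m hm
    rw [q1, q2, ENNReal.toReal_ofReal r1, ENNReal.toReal_ofReal r2]
    refine ⟨⟨rfl, r1⟩, ⟨rfl, r2⟩, ?_⟩
    have i1 := mul_le_mul_of_nonpos_left hx h12.le
    have i2 := mul_le_mul_of_nonneg_left (abs_le.1 f1).2 p1.le
    have i3 := mul_le_mul_of_nonneg_left (abs_le.1 f2).1 p2.le
    linarith

end

end LevyNoise

theorem mainTheorem5 {Ω₁ Ω₂ : Type*} [MeasurableSpace Ω₁] [MeasurableSpace Ω₂]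
    (P₁ : Measure Ω₁) (P₂ : Measure Ω₂) [IsProbabilityMeasure P₁] [IsProbabilityMeasure P₂]
    (X₁ : Ω₁ → 𝓢(ℝ, ℝ) →L[ℝ] ℝ) (X₂ : Ω₂ → 𝓢(ℝ, ℝ) →L[ℝ] ℝ) :
    -- stable white noises
    (∀ α₁ β₁ σ₁ μ₁ α₂ β₂ σ₂ μ₂ : ℝ,
      LevyNoise.IsStableNoise P₁ X₁ α₁ β₁ σ₁ μ₁ →
      LevyNoise.IsStableNoise P₂ X₂ α₂ β₂ σ₂ μ₂ →
      α₁ < α₂ →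
      (∃ m₁, LevyNoise.IsContinuousThreshold P₁ X₁ m₁) ∧
      (∃ m₂, LevyNoise.IsContinuousThreshold P₂ X₂ m₂) ∧
      ∀ m₁ m₂ m' : ℕ → ℝ,
        LevyNoise.IsContinuousThreshold P₁ X₁ m₁ →
        LevyNoise.IsContinuousThreshold P₂ X₂ m₂ →
        (∀ n, max (m₁ n) (m₂ n) ≤ m' n) →
        limsup (fun n => ⨆ m ∈ Set.Ici (m' n),
            LevyNoise.quantEntropy P₁ X₁ m n / LevyNoise.quantEntropy P₂ X₂ m n) atTop ≤ 1 ∧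
        Tendsto (fun n => ⨆ m ∈ Set.Ici (m' n),
            ((LevyNoise.quantEntropy P₁ X₁ m n : EReal)
              - (LevyNoise.quantEntropy P₂ X₂ m n : EReal))) atTop (𝓝 ⊥)) ∧
    -- impulsive Poisson white noises
    (∀ (lam₁ lam₂ : ℝ) (ν₁ ν₂ : Measure ℝ),
      LevyNoise.IsPoissonNoise P₁ X₁ lam₁ ν₁ →
      LevyNoise.IsPoissonNoise P₂ X₂ lam₂ ν₂ →
      ν₁ ≪ volume → ν₂ ≪ volume →
      LevyNoise.HasDiffEntropy ν₁ → LevyNoise.HasDiffEntropy ν₂ →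
      LevyNoise.shannonEntropy P₁
        (fun ω => LevyNoise.quantize 1 (LevyNoise.timeQuant P₁ X₁ 1 1 ω)) < ∞ →
      LevyNoise.shannonEntropy P₂
        (fun ω => LevyNoise.quantize 1 (LevyNoise.timeQuant P₂ X₂ 1 1 ω)) < ∞ →
      lam₁ < lam₂ →
      (∃ m₁, LevyNoise.IsPoissonThreshold P₁ X₁ lam₁ m₁) ∧
      (∃ m₂, LevyNoise.IsPoissonThreshold P₂ X₂ lam₂ m₂) ∧
      ∀ m₁ m₂ m' : ℕ → ℝ,
        LevyNoise.IsPoissonThreshold P₁ X₁ lam₁ m₁ →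
        LevyNoise.IsPoissonThreshold P₂ X₂ lam₂ m₂ →
        (∀ n, max (m₁ n) (m₂ n) ≤ m' n) →
        Tendsto (fun n => ⨆ m ∈ Set.Ici (m' n),
            LevyNoise.quantEntropy P₁ X₁ m n / LevyNoise.quantEntropy P₂ X₂ m n) atTop
          (𝓝 (ENNReal.ofReal (lam₁ / lam₂))) ∧
        lam₁ / lam₂ < 1 ∧
        Tendsto (fun n => ⨆ m ∈ Set.Ici (m' n),
            ((LevyNoise.quantEntropy P₁ X₁ m n : EReal)
              - (LevyNoise.quantEntropy P₂ X₂ m n : EReal))) atTop (𝓝 ⊥)) := by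
  refine ⟨fun α₁ β₁ σ₁ μ₁ α₂ β₂ σ₂ μ₂ h₁ h₂ hα => ⟨h₁.exists_isContinuousThreshold,
    h₂.exists_isContinuousThreshold, fun m₁ m₂ m' t₁ t₂ hm => h₁.compare h₂ hα t₁ t₂ hm⟩,
    fun lam₁ lam₂ ν₁ ν₂ h₁ h₂ hac₁ hac₂ hh₁ hh₂ hf₁ hf₂ hlam =>
      ⟨h₁.exists_isPoissonThreshold hac₁ hh₁ hf₁, h₂.exists_isPoissonThreshold hac₂ hh₂ hf₂,
        fun m₁ m₂ m' t₁ t₂ hm => ?_⟩⟩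
  have h := h₁.compare h₂ hac₁ hac₂ hh₁ hh₂ hf₁ hf₂ hlam t₁ t₂ hm
  exact ⟨h.1, (div_lt_one h₂.rate).2 hlam, h.2⟩
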